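/- Let $M$ be a (connected) Riemann surface and $f\colon M\to S^4=\mathbb{HP}^1$ a conformal immersion, for example a constrained Willmore immersion (the hypothesis that $f$ is constrained Willmore is not needed: a solution of the equation $(1)$ below exists in each of the two cases that are compared). Let $L\subset V=M\times\mathbb{H}^2$ be the line bundle with $L_p=f(p)$, let $\nabla$ be the trivial connection on $V$, let $\delta=\pi\nabla|_L\in\Omega^1(\mathrm{Hom}(L,V/L))$ be the derivative of $f$, and write $(*\omega)(X)=\omega(JX)$ for $1$-forms, $J$ being the complex structure of $TM$. Let $S\in\Gamma(\mathrm{End}\,V)$ be the mean curvature sphere congruence of $f$, i.e. $S^2=-1$, $SL=L$, $*\delta=S\delta=\delta S$ and $Q|_L=0$, where $A=\frac14(S\nabla S+*\nabla S)$ and $Q=\frac14(S\nabla S-*\nabla S)$. A Lagrange multiplier for $f$ is a smooth $1$-form $\eta$ with values in $\mathcal R=\{B\in\mathrm{End}(V)\mid \mathrm{im}\,B\subset L\subset\ker B\}$ such that $$d^\nabla(2{*}A+\eta)=0; \qquad (1)$$ put $2{*}A_\circ=2{*}A+\eta$. We say that $\ker(A_\circ)$ is constantly equal to a point $\ell\in\mathbb{HP}^1$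 if $\ker(A_\circ)_p=\ell$ at every $p\in M$ with $(A_\circ)_p\neq0$. We call $f$ CMC with respect to a 3-dimensional Euclidean subgeometry if some Möbius transformation $g\in GL(2,\mathbb H)$ maps $f(M)$ into $\mathrm{Im}\,\mathbb{H}\cup\{\infty\}=\mathbb{R}^3\cup\{\infty\}$ and $g\circ f$, restricted to the points that are not mapped to $\infty$, is a surface of constant mean curvature in $\mathbb{R}^3$ (the surface may pass through $\infty$, as minimal surfaces with planar ends do); and CMC with respect to a 3-dimensional spherical subgeometry if some $g\in GL(2,\mathbb H)$ maps $f$ to a surface of constant mean curvature in the unit sphere $S^3\subset\mathbb{H}$. A totally umbilic 3-sphere in $\mathbb{HP}^1$ is the set of null lines of an indefinite quaternionic hermitian form on $\mathbb{H}^2$. Then: 1. $f$ is CMC with respect to a 3-dimensional Euclidean or spherical subgeometry if and only if $f(M)$ is contained in a totally umbilic 3-sphere and $f$ admits a Lagrange multiplier $\eta$ such that $\ker(A_\circ)$ is constantly equal to some point $\ell$. 2. $f$ is CMC with respect to a 3-dimensional Euclidean subgeometry if and only if there are a totally umbilic 3-sphere containing $f(M)$ and a Lagrange multiplier $\eta$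 such that $\ker(A_\circ)$ is constantly equal to a point of that 3-sphere. 3. For every totally umbilic 3-sphere $K$ containing $f(M)$ and every Lagrange multiplier $\eta$ with $A_\circ\not\equiv0$ for which $\ker(A_\circ)$ is constantly equal to a point $\ell$: $f$ is CMC with respect to a 3-dimensional Euclidean subgeometry if and only if $\ell\in K$. -/

import Mathlib

open scoped Manifold ContDiff Quaternion Matrix

noncomputable section

namespace QSurf

/-- The quaternionic plane `V = ℍ²`. Its scalars act from the right, so it is a module over
`ℍᵐᵒᵖ`, and its endomorphisms are the quaternionic matrices acting by `B *ᵥ v`. -/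
abbrev V : Type := Fin 2 → ℍ[ℝ]

/-- Quaternionic `2 × 2` matrices, i.e. `End(V)`. -/
abbrev Mat : Type := Matrix (Fin 2) (Fin 2) ℍ[ℝ]

/-- The conformal 4-sphere `S⁴ = ℍP¹`: the quaternionic lines in `ℍ²`. -/
abbrev HP1 : Type := Projectivization (ℍ[ℝ])ᵐᵒᵖ V

/-- A matrix as an endomorphism of the right vector space `ℍ²`. -/
def matEnd (B : Mat) : V →ₗ[(ℍ[ℝ])ᵐᵒᵖ] V where
  toFun v := B *ᵥ v
  map_add' v w := Matrix.mulVec_add B v w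
  map_smul' c v := by
    ext1 i
    simp only [Matrix.mulVec, dotProduct, Fin.sum_univ_two, Pi.smul_apply, RingHom.id_apply,
      MulOpposite.smul_eq_mul_unop, add_mul, mul_assoc]

/-- The orthogonal projection of `ℍ²` onto the line `ℓ`: the matrix `v v* / |v|²` for any nonzero
`v ∈ ℓ`. The map `ℓ ↦ lineProj ℓ` is the standard smooth embedding of `ℍP¹` into `End(ℍ²)`. -/
def lineProj (ℓ : HP1) : Mat :=
  Matrix.of fun i j =>
    (‖ℓ.rep 0‖ ^ 2 + ‖ℓ.rep 1‖ ^ 2)⁻¹ • (ℓ.rep i * star (ℓ.rep j))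

/-- A totally umbilic (round) 3-sphere in `S⁴ = ℍP¹`: the set of null lines of an indefinite
quaternionic hermitian form. -/
def IsRoundThreeSphere (K : Set HP1) : Prop :=
  ∃ G : Mat, G.IsHermitian ∧
    (∃ v : V, 0 < (star v ⬝ᵥ (G *ᵥ v)).re) ∧ (∃ v : V, (star v ⬝ᵥ (G *ᵥ v)).re < 0) ∧
    K = {ℓ : HP1 | ∀ v ∈ ℓ.submodule, star v ⬝ᵥ (G *ᵥ v) = 0}

/-- The Möbius transformation given by `g ∈ GL(2, ℍ)` maps `ℓ` to the point `∞ = [(1,0)]`. -/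
def ToInfinity (g : Matˣ) (ℓ : HP1) : Prop := ((g : Mat) *ᵥ ℓ.rep) 1 = 0

/-- The affine coordinate `x ∈ ℍ` of the image `g ℓ = [(x,1)]` of `ℓ` under the Möbius
transformation `g ∈ GL(2, ℍ)` (meaningful if `g ℓ ≠ ∞`). -/
def affineCoord (g : Matˣ) (ℓ : HP1) : ℍ[ℝ] :=
  ((g : Mat) *ᵥ ℓ.rep) 0 * (((g : Mat) *ᵥ ℓ.rep) 1)⁻¹

variable {M : Type*} [TopologicalSpace M] [ChartedSpace ℂ M]

/-- The (real) tangent spaces of the Riemann surface `M`. -/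
abbrev Tan (p : M) : Type := TangentSpace 𝓘(ℝ, ℂ) p

/-- The complex structure of the tangent space. On 1-forms, `(*τ)(X) = τ (rot X)`. -/
def rot {p : M} (X : Tan p) : Tan p := (Complex.I * (show ℂ from X) : ℂ)

/-- The differential of a function `F : M → ℍ`. -/
def dQ (F : M → ℍ[ℝ]) (p : M) (X : Tan p) : ℍ[ℝ] := mfderiv 𝓘(ℝ, ℂ) 𝓘(ℝ, ℍ[ℝ]) F p X

/-- The differential (trivial connection, entry by entry) of a section of `End(V)`. -/
def dMat (B : M → Mat) (p : M) (X : Tan p) : Mat :=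
  Matrix.of fun i j => dQ (fun q => B q i j) p X

/-- Smooth sections of `End(V)`. -/
def SmoothMat (B : M → Mat) : Prop :=
  ∀ i j, ContMDiff 𝓘(ℝ, ℂ) 𝓘(ℝ, ℍ[ℝ]) ∞ fun p => B p i j

/-- The 1-forms on `M` with values in `End(V)` (without a smoothness condition). -/
abbrev Form (M : Type*) [TopologicalSpace M] [ChartedSpace ℂ M] : Type _ :=
  (p : M) → Tan p →ₗ[ℝ] Mat

/-- The value on the coordinate vector `v ∈ ℂ` of a 1-form read in the holomorphic chart `e`. -/
def inChart (e : OpenPartialHomeomorph M ℂ) (τ : (p : M) → Tan p → Mat) (v z : ℂ) : Mat :=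
  τ (e.symm z) (mfderiv 𝓘(ℝ, ℂ) 𝓘(ℝ, ℂ) e.symm z v)

/-- Smooth 1-forms: the coefficients are smooth in all charts. -/
def SmoothForm (τ : (p : M) → Tan p → Mat) : Prop :=
  ∀ e ∈ atlas ℂ M, ∀ v : ℂ, ∀ i j, ContDiffOn ℝ ∞ (fun z => inChart e τ v z i j) e.target

/-- `d^∇ τ = 0` for the trivial connection `∇`: with `z = x + iy` a holomorphic coordinate and
`τ = τ_x dx + τ_y dy`, this is `∂τ_y/∂x = ∂τ_x/∂y`. -/
def ClosedForm (τ : (p : M) → Tan p → Mat) : Prop :=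
  ∀ e ∈ atlas ℂ M, ∀ z ∈ e.target, ∀ i j,
    fderiv ℝ (fun w => inChart e τ Complex.I w i j) z 1 =
      fderiv ℝ (fun w => inChart e τ 1 w i j) z Complex.I

/-- The derivative `δ = π ∇|_L ∈ Ω¹ Hom(L, V/L)` of `f : M → ℍP¹`, where `L_p = f p`. If `P` is
the field of orthogonal projections onto `L`, a section `ψ` of `L` satisfies `ψ = P ψ`, hence
`dψ = dP ψ + P dψ`, hence `π (dψ) = π (dP ψ)`. -/
def delta (f : M → HP1) (p : M) (X : Tan p) :
    (f p).submodule →ₗ[(ℍ[ℝ])ᵐᵒᵖ] (V ⧸ (f p).submodule) :=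
  (f p).submodule.mkQ ∘ₗ matEnd (dMat (fun q => lineProj (f q)) p X) ∘ₗ (f p).submodule.subtype

/-- Conformal immersions `f : M → S⁴ = ℍP¹`: `f` is smooth, `δ` vanishes nowhere, and there are
complex structures `J` on `L` and `J'` on `V/L` with `*δ = δ J = J' δ`. (They are determined by
`δ`, hence automatically smooth.) -/
structure IsConformalImmersion (f : M → HP1) : Prop where
  smooth : SmoothMat fun p => lineProj (f p)
  delta_ne_zero : ∀ p : M, ∃ X : Tan p, delta f p X ≠ 0
  conformal : ∀ p : M,
    ∃ (J : Module.End (ℍ[ℝ])ᵐᵒᵖ (f p).submodule)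
      (J' : Module.End (ℍ[ℝ])ᵐᵒᵖ (V ⧸ (f p).submodule)),
      J ∘ₗ J = -LinearMap.id ∧ J' ∘ₗ J' = -LinearMap.id ∧
      ∀ X : Tan p, delta f p (rot X) = delta f p X ∘ₗ J ∧
        delta f p (rot X) = J' ∘ₗ delta f p X

/-- The Hopf field `A = (S ∇S + *∇S)/4` of a complex structure `S` on `V`. -/
def hopfA (S : M → Mat) (p : M) (X : Tan p) : Mat :=
  (1 / 4 : ℝ) • (S p * dMat S p X + dMat S p (rot X))

/-- The Hopf field `Q = (S ∇S - *∇S)/4` of a complex structure `S` on `V`. -/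
def hopfQ (S : M → Mat) (p : M) (X : Tan p) : Mat :=
  (1 / 4 : ℝ) • (S p * dMat S p X - dMat S p (rot X))

/-- `S` is the mean curvature sphere congruence of `f`:
`S² = -1`, `S L = L`, `*δ = S δ = δ S` and `Q|_L = 0`. -/
structure IsMeanCurvatureSphere (f : M → HP1) (S : M → Mat) : Prop where
  smooth : SmoothMat S
  sq : ∀ p, S p * S p = -1
  maps : ∀ p, (f p).submodule.map (matEnd (S p)) = (f p).submodule
  star_delta_left : ∀ p (X : Tan p), ∀ v ∈ (f p).submodule,
    dMat (fun q => lineProj (f q)) p (rot X) *ᵥ v -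
      S p *ᵥ (dMat (fun q => lineProj (f q)) p X *ᵥ v) ∈ (f p).submodule
  star_delta_right : ∀ p (X : Tan p), ∀ v ∈ (f p).submodule,
    dMat (fun q => lineProj (f q)) p (rot X) *ᵥ v -
      dMat (fun q => lineProj (f q)) p X *ᵥ (S p *ᵥ v) ∈ (f p).submodule
  hopfQ_eq_zero : ∀ p (X : Tan p), ∀ v ∈ (f p).submodule, hopfQ S p X *ᵥ v = 0

/-- `η` is a Lagrange multiplier for `f` with mean curvature sphere `S`: a smooth 1-form with
values in `{B ∈ End(V) | im B ⊂ L ⊂ ker B}` that solves the Euler-Lagrange equation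
`d^∇ (2*A + η) = 0` of constrained Willmore surfaces. -/
structure IsLagrangeMultiplier (f : M → HP1) (S : M → Mat) (η : Form M) : Prop where
  smooth : SmoothForm fun p X => η p X
  im_le : ∀ p (X : Tan p) (v : V), η p X *ᵥ v ∈ (f p).submodule
  le_ker : ∀ p (X : Tan p), ∀ v ∈ (f p).submodule, η p X *ᵥ v = 0
  closed : ClosedForm fun (p : M) (X : Tan p) => (2 : ℝ) • hopfA S p (rot X) + η p X

/-- The 1-form `A_∘ = A - *η/2`, i.e. the form defined by `2*A_∘ = 2*A + η`. -/
def Acirc (S : M → Mat) (η : Form M) (p : M) (X : Tan p) : Mat :=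
  hopfA S p X - (1 / 2 : ℝ) • η p (rot X)

/-- The kernel line of `A_∘` is constantly equal to `ℓ`: at every point at which `A_∘` does not
vanish, its kernel is the line `ℓ`. -/
def KernelIsConstant (S : M → Mat) (η : Form M) (ℓ : HP1) : Prop :=
  ∀ p : M, (∃ X : Tan p, Acirc S η p X ≠ 0) →
    ∀ v : V, v ∈ ℓ.submodule ↔ ∀ X : Tan p, Acirc S η p X *ᵥ v = 0

/-- On the open set `U`, the map `F` (a conformal immersion into `ℍ = ℝ⁴`) has unit normal field
`n` and the mean curvature `-(1/2) Tr ⟨dF, dn⟩` in the direction `n` is constantly `h`; the trace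
is taken with respect to the induced metric. -/
structure HasConstantMeanCurvatureAlong (U : Set M) (F n : M → ℍ[ℝ]) (h : ℝ) : Prop where
  smooth : ContMDiffOn 𝓘(ℝ, ℂ) 𝓘(ℝ, ℍ[ℝ]) ∞ n U
  unit : ∀ p ∈ U, ‖n p‖ = 1
  normal : ∀ p ∈ U, ∀ X : Tan p, inner ℝ (dQ F p X) (n p) = 0
  mean : ∀ p ∈ U, ∀ X : Tan p,
    inner ℝ (dQ F p X) (dQ n p X) + inner ℝ (dQ F p (rot X)) (dQ n p (rot X)) =
      -2 * h * ‖dQ F p X‖ ^ 2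

/-- `f` is CMC with respect to a 3-dimensional Euclidean subgeometry: after a Möbius
transformation `f` takes values in `Im ℍ ∪ {∞} = ℝ³ ∪ {∞}` and, away from `∞`, is a surface in
`ℝ³ = Im ℍ` of constant mean curvature. The surface may pass through `∞`. -/
def IsCMCEuclidean (f : M → HP1) : Prop :=
  ∃ g : Matˣ, (∀ p, ¬ ToInfinity g (f p) → (affineCoord g (f p)).re = 0) ∧
    ∃ (n : M → ℍ[ℝ]) (h : ℝ), (∀ p, ¬ ToInfinity g (f p) → (n p).re = 0) ∧
      HasConstantMeanCurvatureAlong {p | ¬ ToInfinity g (f p)} (fun p => affineCoord g (f p)) n h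

/-- `f` is CMC with respect to a 3-dimensional spherical subgeometry: after a Möbius
transformation `f` is a surface of constant mean curvature in the unit sphere `S³ ⊂ ℍ = ℝ⁴`. -/
def IsCMCSpherical (f : M → HP1) : Prop :=
  ∃ g : Matˣ, (∀ p, ¬ ToInfinity g (f p) ∧ ‖affineCoord g (f p)‖ = 1) ∧
    ∃ (n : M → ℍ[ℝ]) (h : ℝ), (∀ p, inner ℝ (affineCoord g (f p)) (n p) = 0) ∧
      HasConstantMeanCurvatureAlong Set.univ (fun p => affineCoord g (f p)) n h

end QSurf

end

open scoped Manifold ContDiff Quaternion Matrix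

set_option linter.unusedSectionVars false

noncomputable section

namespace QSurf

variable {M : Type*} [TopologicalSpace M] [ChartedSpace ℂ M]

/-! Choose `g` sending the candidate point `ℓ` to `∞`, and let `x` be the affine coordinate of `g ∘
f`. Conformality gives `*dx = N dx = -dx R` with left and right normals `N² = R² = -1`. In the frame
`g` the mean curvature sphere is the conjugate by `((1, x), (0, 1))` of the lower triangular matrix
with rows `(N, 0)` and `(-H, -R)`; this is `frameMat`, and the structure `Frame` collects the
structure equations.

A Lagrange multiplier kills `L`, so `2*A + η` acts on the section `ψ = (x, 1)` of `L` as `2*A` does,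
namely by `ψ ↦ ψ b` with `b = dR - H dx`. If the form also kills `ℓ`, i.e. the vector that `g` maps
to `(1, 0)`, it is completely determined: it is `kernelForm`, with rows `(0, x b)` and `(0, b)`.
Since `dx ∧ b = 0` by type, it is closed exactly when `db = -dH ∧ dx` vanishes. Thus a multiplier
with constant kernel `ℓ` amounts to `dH ∧ dx = 0` (`dH_wedge_dx_of_multiplier`,
`exists_multiplier`).

A round 3-sphere `K` through `ℓ` can be normalised to `Im ℍ ∪ {∞}`, one avoiding `ℓ` to the unit
sphere, with `ℓ = ∞` in both cases (`exists_imSphere`, `exists_unitSphere`). In `Im ℍ` the function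
`H` is real and is the mean curvature up to sign; in the unit sphere `k = H x - R` is real and plays
that role. A real 1-form cannot become real after multiplication by an imaginary unit, so `dH ∧ dx =
0` forces `dH = 0`, respectively `dk = 0`. This gives both CMC cases. Points mapped to `∞` occur
only in the Euclidean case: there `H = 0`, so a constant `H` vanishes identically and `η = 0` is a
multiplier.

For the third statement, suppose `ℓ ∉ K` although `f` is also Euclidean CMC in a frame `g'`. Where
`b ≠ 0` the surface is not umbilic, so it lies in only one round 3-sphere, and the point at infinity
of `g'` lies on it. Writing this point as `e` with `|e| = 1` in the frame `g`, constancy of the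
second mean curvature makes `x̄ e` commute with `R`; the umbilicity argument
`Frame.eq_zero_of_commute` then yields `e = 0`, a contradiction
(`totalForm_eq_zero_of_sphere_of_im`). -/

/-- Smoothness at a point of a quaternion valued function. -/
abbrev SmAt (F : M → ℍ[ℝ]) (p : M) : Prop := ContMDiffAt 𝓘(ℝ, ℂ) 𝓘(ℝ, ℍ[ℝ]) ∞ F p

/-- Quaternionic conjugation as a continuous real linear map. -/
def conjCLM : ℍ[ℝ] →L[ℝ] ℍ[ℝ] where
  toFun q := star q
  map_add' := star_add
  map_smul' r q := by simp
  cont := continuous_star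

/-! ### Differential calculus for quaternion valued functions on the surface. -/

section Calculus

variable {F G : M → ℍ[ℝ]} {p : M}

theorem SmAt.mul (hF : SmAt F p) (hG : SmAt G p) : SmAt (fun q => F q * G q) p := by
  have h : ContDiff ℝ ∞ fun a : ℍ[ℝ] × ℍ[ℝ] => a.1 * a.2 := contDiff_fst.mul contDiff_snd
  exact h.contDiffAt.contMDiffAt.comp p (hF.prodMk_space hG)

theorem SmAt.add (hF : SmAt F p) (hG : SmAt G p) : SmAt (fun q => F q + G q) p :=
  ContMDiffAt.add hF hG

theorem SmAt.sub (hF : SmAt F p) (hG : SmAt G p) : SmAt (fun q => F q - G q) p :=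
  ContMDiffAt.sub hF hG

theorem SmAt.neg (hF : SmAt F p) : SmAt (fun q => -F q) p :=
  ContMDiffAt.neg hF

theorem SmAt.const (c : ℍ[ℝ]) : SmAt (fun _ : M => c) p := contMDiffAt_const

theorem SmAt.clm (L : ℍ[ℝ] →L[ℝ] ℍ[ℝ]) (hF : SmAt F p) : SmAt (fun q => L (F q)) p :=
  L.contDiff.contDiffAt.contMDiffAt.comp p hF

theorem SmAt.star (hF : SmAt F p) : SmAt (fun q => star (F q)) p := hF.clm conjCLM

theorem SmAt.smul (r : ℝ) (hF : SmAt F p) : SmAt (fun q => r • F q) p :=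
  hF.clm (r • ContinuousLinearMap.id ℝ ℍ[ℝ])

theorem SmAt.inv (hF : SmAt F p) (h : F p ≠ 0) : SmAt (fun q => (F q)⁻¹) p := by
  have := (contDiffAt_ringInverse ℝ (n := ∞) (Units.mk0 _ h)).contMDiffAt.comp p hF
  simpa [Function.comp_def] using this

theorem SmAt.congr (hF : SmAt F p) (h : G =ᶠ[nhds p] F) : SmAt G p :=
  ContMDiffAt.congr_of_eventuallyEq hF h

theorem SmAt.mdiff (hF : SmAt F p) : MDifferentiableAt 𝓘(ℝ, ℂ) 𝓘(ℝ, ℍ[ℝ]) F p :=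
  ContMDiffAt.mdifferentiableAt hF (by simp)

theorem dQ_mul (hF : SmAt F p) (hG : SmAt G p) (X : Tan p) :
    dQ (fun q => F q * G q) p X = dQ F p X * G p + F p * dQ G p X := by
  have h := congrArg (fun L : Tan p →L[ℝ] ℍ[ℝ] => L X)
    (hF.mdiff.hasMFDerivAt.mul' hG.mdiff.hasMFDerivAt).mfderiv
  rw [add_comm]
  exact h

theorem dQ_add (hF : SmAt F p) (hG : SmAt G p) (X : Tan p) :
    dQ (fun q => F q + G q) p X = dQ F p X + dQ G p X :=
  congrArg (fun L : Tan p →L[ℝ] ℍ[ℝ] => L X)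
    (hF.mdiff.hasMFDerivAt.add hG.mdiff.hasMFDerivAt).mfderiv

theorem dQ_sub (hF : SmAt F p) (hG : SmAt G p) (X : Tan p) :
    dQ (fun q => F q - G q) p X = dQ F p X - dQ G p X :=
  congrArg (fun L : Tan p →L[ℝ] ℍ[ℝ] => L X)
    (hF.mdiff.hasMFDerivAt.sub hG.mdiff.hasMFDerivAt).mfderiv

theorem dQ_neg (hF : SmAt F p) (X : Tan p) : dQ (fun q => -F q) p X = -dQ F p X :=
  congrArg (fun L : Tan p →L[ℝ] ℍ[ℝ] => L X) hF.mdiff.hasMFDerivAt.neg.mfderiv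

theorem dQ_const (c : ℍ[ℝ]) (X : Tan p) : dQ (fun _ : M => c) p X = 0 :=
  congrArg (fun L : Tan p →L[ℝ] ℍ[ℝ] => L X)
    (hasMFDerivAt_const (I := 𝓘(ℝ, ℂ)) (I' := 𝓘(ℝ, ℍ[ℝ])) c p).mfderiv

theorem dQ_clm (L : ℍ[ℝ] →L[ℝ] ℍ[ℝ]) (hF : SmAt F p) (X : Tan p) :
    dQ (fun q => L (F q)) p X = L (dQ F p X) :=
  congrArg (fun L : Tan p →L[ℝ] ℍ[ℝ] => L X)
    (HasMFDerivAt.comp p L.hasMFDerivAt hF.mdiff.hasMFDerivAt).mfderiv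

theorem dQ_star (hF : SmAt F p) (X : Tan p) :
    dQ (fun q => star (F q)) p X = star (dQ F p X) := dQ_clm conjCLM hF X

theorem dQ_congr (h : F =ᶠ[nhds p] G) (X : Tan p) : dQ F p X = dQ G p X :=
  congrArg (fun L : Tan p →L[ℝ] ℍ[ℝ] => L X) h.mfderiv_eq

theorem rot_rot (X : Tan p) : rot (rot X) = -X := by
  change Complex.I * (Complex.I * (show ℂ from X)) = -(show ℂ from X)
  rw [← mul_assoc, Complex.I_mul_I, neg_one_mul]

theorem rot_add (X Y : Tan p) : rot (X + Y) = rot X + rot Y :=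
  mul_add Complex.I (show ℂ from X) (show ℂ from Y)

theorem rot_smul (r : ℝ) (X : Tan p) : rot (r • X) = r • rot X :=
  mul_smul_comm r Complex.I (show ℂ from X)

theorem dQ_add_vec (X Y : Tan p) : dQ F p (X + Y) = dQ F p X + dQ F p Y := map_add _ _ _

theorem dQ_smul_vec (r : ℝ) (X : Tan p) : dQ F p (r • X) = r • dQ F p X := map_smul _ _ _

theorem dQ_neg_vec (X : Tan p) : dQ F p (-X) = -dQ F p X := map_neg _ _

theorem dQ_rot_rot (X : Tan p) : dQ F p (rot (rot X)) = -dQ F p X := by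
  rw [rot_rot, dQ_neg_vec]

/-- Two tangent vectors of a surface are related by a complex factor. -/
theorem exists_eq_smul_add_smul_rot (X Y : Tan p) (hX : X ≠ 0) :
    ∃ a b : ℝ, Y = a • X + b • rot X := by
  refine ⟨((show ℂ from Y) / (show ℂ from X)).re, ((show ℂ from Y) / (show ℂ from X)).im, ?_⟩
  change (show ℂ from Y) = ((show ℂ from Y) / (show ℂ from X)).re • (show ℂ from X) +
    ((show ℂ from Y) / (show ℂ from X)).im • (Complex.I * (show ℂ from X))
  rw [Complex.real_smul, Complex.real_smul, ← mul_assoc, ← add_mul, Complex.re_add_im,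
    div_mul_cancel₀ _ (show (show ℂ from X) ≠ 0 from hX)]

end Calculus

/-! ### Holomorphic charts and their coordinate vector fields. -/

theorem realManifold [h : IsManifold 𝓘(ℂ, ℂ) ω M] : IsManifold 𝓘(ℝ, ℂ) ∞ M := by
  refine isManifold_of_contDiffOn _ _ _ fun e e' he he' => ?_
  have := h.compatible he he'
  rw [contDiffGroupoid, mem_groupoid_of_pregroupoid] at this
  exact (ContDiffOn.restrict_scalars ℝ this.1).of_le le_top

/-- The coordinate vector field of the chart `e` with coordinates `v`. -/
def chartVec (e : OpenPartialHomeomorph M ℂ) (v : ℂ) (q : M) : Tan q :=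
  (show ℂ from mfderiv 𝓘(ℝ, ℂ) 𝓘(ℝ, ℂ) e.symm (e q) v)

theorem inChart_eq (e : OpenPartialHomeomorph M ℂ) (τ : (p : M) → Tan p → Mat) (v : ℂ) {z : ℂ}
    (hz : z ∈ e.target) : inChart e τ v z = τ (e.symm z) (chartVec e v (e.symm z)) := by
  unfold inChart chartVec
  rw [e.right_inv hz]

section Charts

variable {e : OpenPartialHomeomorph M ℂ}

variable [IsManifold 𝓘(ℂ, ℂ) ω M]

theorem mdifferentiable_of_mem_atlas_real (he : e ∈ atlas ℂ M) :
    e.MDifferentiable 𝓘(ℝ, ℂ) 𝓘(ℝ, ℂ) := by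
  have := realManifold (M := M)
  have : IsManifold 𝓘(ℝ, ℂ) 1 M := IsManifold.of_le (n := ∞) (by simp)
  exact mdifferentiable_of_mem_atlas he

theorem dQ_chartVec (he : e ∈ atlas ℂ M) {F : M → ℍ[ℝ]} {z : ℂ} (hz : z ∈ e.target)
    (hF : SmAt F (e.symm z)) (v : ℂ) :
    dQ F (e.symm z) (chartVec e v (e.symm z)) = fderiv ℝ (fun w => F (e.symm w)) z v := by
  have h1 := (mdifferentiable_of_mem_atlas_real he).mdifferentiableAt_symm hz
  have h2 := congrArg (fun L : ℂ →L[ℝ] ℍ[ℝ] => L v)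
    ((HasMFDerivAt.comp z hF.mdiff.hasMFDerivAt h1.hasMFDerivAt).mfderiv.symm.trans
      (mfderiv_eq_fderiv))
  unfold chartVec
  rw [e.right_inv hz]
  exact h2

theorem chartVec_ne_zero (he : e ∈ atlas ℂ M) {q : M} (hq : q ∈ e.source) {v : ℂ} (hv : v ≠ 0) :
    chartVec e v q ≠ 0 := by
  intro h
  have h1 := (mdifferentiable_of_mem_atlas_real he).symm.mfderiv_injective (e.map_source hq)
  exact hv (h1 (h.trans (map_zero (mfderiv 𝓘(ℝ, ℂ) 𝓘(ℝ, ℂ) e.symm (e q))).symm))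

/-- Tangent vectors at `q` are read in the preferred chart `chartAt ℂ q`, and `rot` is
multiplication by `I` there, whereas `e` is any chart of the atlas. The transition map is
holomorphic, so its real derivative is complex linear. -/
theorem chartVec_I_mul (he : e ∈ atlas ℂ M) {q : M} (hq : q ∈ e.source) (v : ℂ) :
    chartVec e (Complex.I * v) q = rot (chartVec e v q) := by
  have h1 := (mdifferentiable_of_mem_atlas_real he).mdifferentiableAt_symm (e.map_source hq)
  have h0 : IsManifold 𝓘(ℂ, ℂ) ω M := inferInstance
  have h2 := h0.compatible he (chart_mem_atlas ℂ q)
  rw [contDiffGroupoid, mem_groupoid_of_pregroupoid] at h2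
  have h3 : ContDiffOn ℂ ω (chartAt ℂ q ∘ e.symm) (e.symm ≫ₕ chartAt ℂ q).source := by
    simpa [contDiffPregroupoid] using h2.1
  have hmem : e q ∈ (e.symm ≫ₕ chartAt ℂ q).source := by simp [hq]
  have h4 := (h3.contDiffAt ((e.symm ≫ₕ chartAt ℂ q).open_source.mem_nhds hmem)).differentiableAt
    (by simp)
  have h5 : ∀ w : ℂ, chartVec e w q = fderiv ℂ (chartAt ℂ q ∘ e.symm) (e q) w := by
    intro w
    have h6 : fderivWithin ℝ (writtenInExtChartAt 𝓘(ℝ, ℂ) 𝓘(ℝ, ℂ) (e q) e.symm)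
        (Set.range 𝓘(ℝ, ℂ)) (extChartAt 𝓘(ℝ, ℂ) (e q) (e q)) =
          (fderiv ℂ (chartAt ℂ q ∘ e.symm) (e q)).restrictScalars ℝ := by
      rw [← h4.fderiv_restrictScalars ℝ]
      simp only [writtenInExtChartAt, extChartAt, mfld_simps, e.left_inv hq, fderivWithin_univ]
      rfl
    exact congrArg (fun L : ℂ →L[ℝ] ℂ => L w) (h1.mfderiv.trans h6)
  rw [h5, h5, ← smul_eq_mul Complex.I v, map_smul]
  rfl

theorem SmAt.comp_symm (he : e ∈ atlas ℂ M) {F : M → ℍ[ℝ]} {z : ℂ} (hz : z ∈ e.target)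
    (hF : SmAt F (e.symm z)) : ContDiffAt ℝ ∞ (fun w => F (e.symm w)) z := by
  have := realManifold (M := M)
  have h1 : ContMDiffAt 𝓘(ℝ, ℂ) 𝓘(ℝ, ℂ) ∞ e.symm z :=
    (contMDiffOn_symm_of_mem_maximalAtlas (IsManifold.subset_maximalAtlas he)).contMDiffAt
      (e.open_target.mem_nhds hz)
  exact (ContMDiffAt.comp z hF h1).contDiffAt

theorem SmAt.of_comp_symm (he : e ∈ atlas ℂ M) {F : M → ℍ[ℝ]} {q : M} (hq : q ∈ e.source)
    (hF : ContDiffAt ℝ ∞ (fun w => F (e.symm w)) (e q)) : SmAt F q := by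
  have := realManifold (M := M)
  have h1 : ContMDiffAt 𝓘(ℝ, ℂ) 𝓘(ℝ, ℂ) ∞ e q :=
    (contMDiffOn_of_mem_maximalAtlas (IsManifold.subset_maximalAtlas he)).contMDiffAt
      (e.open_source.mem_nhds hq)
  have h2 : SmAt ((fun w => F (e.symm w)) ∘ e) q := hF.contMDiffAt.comp q h1
  refine h2.congr ?_
  filter_upwards [e.open_source.mem_nhds hq] with x hx
  simp [e.left_inv hx]

/-- The derivative of a function along a coordinate vector field, read in the chart. -/
theorem dQ_chartVec_comp_symm (he : e ∈ atlas ℂ M) {F : M → ℍ[ℝ]} {q : M} (hq : q ∈ e.source)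
    (hF : ∀ᶠ x in nhds q, SmAt F x) (v : ℂ) :
    (fun w => dQ F (e.symm w) (chartVec e v (e.symm w))) =ᶠ[nhds (e q)]
      fun w => fderiv ℝ (fun w => F (e.symm w)) w v := by
  have h1 : Filter.Tendsto e.symm (nhds (e q)) (nhds q) := by
    simpa [ContinuousAt, e.left_inv hq] using e.continuousAt_symm (e.map_source hq)
  filter_upwards [h1.eventually hF, e.open_target.mem_nhds (e.map_source hq)] with w hw hw'
  exact dQ_chartVec he hw' hw v

theorem SmAt.dQ_chartVec (he : e ∈ atlas ℂ M) {F : M → ℍ[ℝ]} {q : M} (hq : q ∈ e.source)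
    (hF : ∀ᶠ x in nhds q, SmAt F x) (v : ℂ) : SmAt (fun x => dQ F x (chartVec e v x)) q := by
  refine SmAt.of_comp_symm he hq (ContDiffAt.congr_of_eventuallyEq ?_
    (dQ_chartVec_comp_symm he hq hF v))
  have h : SmAt F (e.symm (e q)) := by rw [e.left_inv hq]; exact hF.self_of_nhds
  exact ((h.comp_symm he (e.map_source hq)).fderiv_right (m := ∞) (by simp)).clm_apply
    contDiffAt_const

/-- Second derivatives along coordinate vector fields are symmetric. -/
theorem dQ_dQ_chartVec_comm (he : e ∈ atlas ℂ M) {F : M → ℍ[ℝ]} {q : M} (hq : q ∈ e.source)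
    (hF : ∀ᶠ x in nhds q, SmAt F x) (v w : ℂ) :
    dQ (fun x => dQ F x (chartVec e v x)) q (chartVec e w q) =
      dQ (fun x => dQ F x (chartVec e w x)) q (chartVec e v q) := by
  have hq' := e.map_source hq
  have key : ∀ v w : ℂ, dQ (fun x => dQ F x (chartVec e v x)) q (chartVec e w q) =
      fderiv ℝ (fderiv ℝ (fun w => F (e.symm w))) (e q) w v := by
    intro v w
    have h1 : SmAt F (e.symm (e q)) := by rw [e.left_inv hq]; exact hF.self_of_nhds
    have h2 := QSurf.dQ_chartVec he hq' (F := fun x => dQ F x (chartVec e v x))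
      (by rw [e.left_inv hq]; exact SmAt.dQ_chartVec he hq hF v) w
    rw [e.left_inv hq] at h2
    rw [h2, (dQ_chartVec_comp_symm he hq hF v).fderiv_eq, fderiv_clm_apply]
    · simp
    · exact ((h1.comp_symm he hq').fderiv_right (m := ∞) (by simp)).differentiableAt (by simp)
    · exact differentiableAt_const _
  have h1 : SmAt F (e.symm (e q)) := by rw [e.left_inv hq]; exact hF.self_of_nhds
  rw [key, key]
  exact ((h1.comp_symm he hq').isSymmSndFDerivAt (by
    rw [minSmoothness_of_isRCLikeNormedField]; exact ENat.LEInfty.out)) w v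

end Charts

end QSurf

namespace QSurf

/-! ### Quaternionic lines and their affine coordinates. -/

section Lines

variable {g : Matˣ} {ℓ : HP1} {v : V}

theorem mulVec_zero_entry (B : Mat) (v : V) : (B *ᵥ v) 0 = B 0 0 * v 0 + B 0 1 * v 1 := by
  simp [Matrix.mulVec, dotProduct, Fin.sum_univ_two]

theorem mulVec_one_entry (B : Mat) (v : V) : (B *ᵥ v) 1 = B 1 0 * v 0 + B 1 1 * v 1 := by
  simp [Matrix.mulVec, dotProduct, Fin.sum_univ_two]

theorem vec_ext {v w : V} (h0 : v 0 = w 0) (h1 : v 1 = w 1) : v = w := by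
  funext i
  fin_cases i
  · exact h0
  · exact h1

theorem inv_mulVec_mulVec (g : Matˣ) (v : V) : ((g⁻¹ : Matˣ) : Mat) *ᵥ ((g : Mat) *ᵥ v) = v := by
  rw [Matrix.mulVec_mulVec, Units.inv_mul, Matrix.one_mulVec]

theorem mulVec_inv_mulVec (g : Matˣ) (v : V) : (g : Mat) *ᵥ (((g⁻¹ : Matˣ) : Mat) *ᵥ v) = v := by
  rw [Matrix.mulVec_mulVec, Units.mul_inv, Matrix.one_mulVec]

theorem mulVec_injective (g : Matˣ) {v w : V} (h : (g : Mat) *ᵥ v = (g : Mat) *ᵥ w) : v = w := by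
  rw [← inv_mulVec_mulVec g v, h, inv_mulVec_mulVec]

/-- Right multiplication of a vector by a quaternion. -/
def vmul (v : V) (c : ℍ[ℝ]) : V := fun i => v i * c

@[simp] theorem vmul_apply (v : V) (c : ℍ[ℝ]) (i : Fin 2) : vmul v c i = v i * c := rfl

theorem mulVec_vmul (B : Mat) (v : V) (c : ℍ[ℝ]) : B *ᵥ vmul v c = vmul (B *ᵥ v) c :=
  (matEnd B).map_smul (MulOpposite.op c) v

theorem vmul_mem {ℓ : HP1} (hv : v ∈ ℓ.submodule) (c : ℍ[ℝ]) : vmul v c ∈ ℓ.submodule :=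
  ℓ.submodule.smul_mem (MulOpposite.op c) hv

theorem rep_mem (ℓ : HP1) : ℓ.rep ∈ ℓ.submodule := by
  rw [Projectivization.submodule_eq]
  exact Submodule.mem_span_singleton_self _

theorem mem_submodule_iff : v ∈ ℓ.submodule ↔ ∃ c : ℍ[ℝ], v = vmul ℓ.rep c := by
  rw [Projectivization.submodule_eq, Submodule.mem_span_singleton]
  constructor
  · rintro ⟨a, rfl⟩
    exact ⟨a.unop, rfl⟩
  · rintro ⟨c, rfl⟩
    exact ⟨MulOpposite.op c, rfl⟩

theorem mem_iff_affine (h : ¬ ToInfinity g ℓ) :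
    v ∈ ℓ.submodule ↔ ((g : Mat) *ᵥ v) 0 = affineCoord g ℓ * ((g : Mat) *ᵥ v) 1 := by
  have h1 : ((g : Mat) *ᵥ ℓ.rep) 1 ≠ 0 := h
  rw [mem_submodule_iff]
  constructor
  · rintro ⟨c, rfl⟩
    rw [mulVec_vmul, vmul_apply, vmul_apply, affineCoord, mul_assoc, inv_mul_cancel_left₀ h1]
  · intro hv
    refine ⟨(((g : Mat) *ᵥ ℓ.rep) 1)⁻¹ * ((g : Mat) *ᵥ v) 1, mulVec_injective g ?_⟩
    rw [mulVec_vmul]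
    refine vec_ext ?_ ?_
    · rw [hv, vmul_apply, affineCoord, mul_assoc]
    · rw [vmul_apply, mul_inv_cancel_left₀ h1]

theorem mem_iff_infinity (h : ToInfinity g ℓ) : v ∈ ℓ.submodule ↔ ((g : Mat) *ᵥ v) 1 = 0 := by
  have h1 : ((g : Mat) *ᵥ ℓ.rep) 1 = 0 := h
  have h0 : ((g : Mat) *ᵥ ℓ.rep) 0 ≠ 0 := by
    intro h0
    refine ℓ.rep_nonzero (mulVec_injective g ?_)
    rw [Matrix.mulVec_zero]
    exact vec_ext h0 h1
  rw [mem_submodule_iff]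
  constructor
  · rintro ⟨c, rfl⟩
    rw [mulVec_vmul, vmul_apply, h1, zero_mul]
  · intro hv
    refine ⟨(((g : Mat) *ᵥ ℓ.rep) 0)⁻¹ * ((g : Mat) *ᵥ v) 0, mulVec_injective g ?_⟩
    rw [mulVec_vmul]
    refine vec_ext ?_ ?_
    · rw [vmul_apply, mul_inv_cancel_left₀ h0]
    · rw [hv, vmul_apply, h1, zero_mul]

/-- The point of `ℍP¹` that `g` maps to `∞`. -/
theorem exists_toInfinity (g : Matˣ) : ∃ ℓ : HP1, ToInfinity g ℓ ∧
    ((g⁻¹ : Matˣ) : Mat) *ᵥ ![1, 0] ∈ ℓ.submodule := by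
  have h0 : ((g⁻¹ : Matˣ) : Mat) *ᵥ (![1, 0] : V) ≠ 0 := by
    intro h
    have h1 := mulVec_inv_mulVec g ![1, 0]
    rw [h, Matrix.mulVec_zero] at h1
    simpa using congrFun h1 0
  refine ⟨Projectivization.mk _ _ h0, ?_, ?_⟩
  · have h1 := rep_mem (Projectivization.mk (ℍ[ℝ])ᵐᵒᵖ _ h0)
    rw [Projectivization.submodule_mk, Submodule.mem_span_singleton] at h1
    obtain ⟨c, hc⟩ := h1
    change ((g : Mat) *ᵥ (Projectivization.mk (ℍ[ℝ])ᵐᵒᵖ _ h0).rep) 1 = 0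
    rw [← hc]
    have h2 := mulVec_vmul (g : Mat) (((g⁻¹ : Matˣ) : Mat) *ᵥ (![1, 0] : V)) c.unop
    refine (congrFun h2 1).trans ?_
    rw [vmul_apply, mulVec_inv_mulVec]
    simp
  · rw [Projectivization.submodule_mk]
    exact Submodule.mem_span_singleton_self _

theorem normSq_rep_pos (ℓ : HP1) : 0 < ‖ℓ.rep 0‖ ^ 2 + ‖ℓ.rep 1‖ ^ 2 := by
  by_contra h
  have h0 : ℓ.rep 0 = 0 := by
    rw [← norm_eq_zero]; nlinarith [sq_nonneg ‖ℓ.rep 0‖, sq_nonneg ‖ℓ.rep 1‖]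
  have h1 : ℓ.rep 1 = 0 := by
    rw [← norm_eq_zero]; nlinarith [sq_nonneg ‖ℓ.rep 0‖, sq_nonneg ‖ℓ.rep 1‖]
  exact ℓ.rep_nonzero (vec_ext h0 h1)

theorem star_mul_self_eq_coe (q : ℍ[ℝ]) : star q * q = ((‖q‖ ^ 2 : ℝ) : ℍ[ℝ]) := by
  rw [Quaternion.star_mul_self, Quaternion.normSq_eq_norm_mul_self, sq]

theorem self_mul_star_eq_coe (q : ℍ[ℝ]) : q * star q = ((‖q‖ ^ 2 : ℝ) : ℍ[ℝ]) := by
  rw [Quaternion.self_mul_star, Quaternion.normSq_eq_norm_mul_self, sq]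

/-- The coefficient of `ℓ.rep` in the projection of `v`. -/
theorem lineProj_mulVec (ℓ : HP1) (v : V) :
    lineProj ℓ *ᵥ v = vmul ℓ.rep ((‖ℓ.rep 0‖ ^ 2 + ‖ℓ.rep 1‖ ^ 2)⁻¹ •
      (star (ℓ.rep 0) * v 0 + star (ℓ.rep 1) * v 1)) := by
  refine vec_ext ?_ ?_
  · rw [mulVec_zero_entry]
    simp [lineProj, mul_add, mul_assoc]
  · rw [mulVec_one_entry]
    simp [lineProj, mul_add, mul_assoc]

theorem lineProj_mulVec_mem (ℓ : HP1) (v : V) : lineProj ℓ *ᵥ v ∈ ℓ.submodule := by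
  rw [lineProj_mulVec]
  exact vmul_mem (rep_mem ℓ) _

theorem lineProj_mulVec_of_mem (hv : v ∈ ℓ.submodule) : lineProj ℓ *ᵥ v = v := by
  obtain ⟨c, rfl⟩ := mem_submodule_iff.1 hv
  rw [mulVec_vmul, lineProj_mulVec]
  have h : (‖ℓ.rep 0‖ ^ 2 + ‖ℓ.rep 1‖ ^ 2)⁻¹ •
      (star (ℓ.rep 0) * ℓ.rep 0 + star (ℓ.rep 1) * ℓ.rep 1) = 1 := by
    rw [star_mul_self_eq_coe, star_mul_self_eq_coe, ← Quaternion.coe_add, Quaternion.smul_coe,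
      inv_mul_cancel₀ (normSq_rep_pos ℓ).ne', Quaternion.coe_one]
  rw [h]
  funext i
  rw [vmul_apply, vmul_apply, mul_one, vmul_apply]

/-- The matrix `g P g*`, from which the affine coordinate can be read off. -/
theorem conj_lineProj_apply (g : Matˣ) (ℓ : HP1) (i j : Fin 2) :
    ((g : Mat) * lineProj ℓ * (g : Mat)ᴴ) i j = (‖ℓ.rep 0‖ ^ 2 + ‖ℓ.rep 1‖ ^ 2)⁻¹ •
      (((g : Mat) *ᵥ ℓ.rep) i * star (((g : Mat) *ᵥ ℓ.rep) j)) := by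
  have e : ∀ k, ((g : Mat) *ᵥ ℓ.rep) k = (g : Mat) k 0 * ℓ.rep 0 + (g : Mat) k 1 * ℓ.rep 1 := by
    intro k; simp [Matrix.mulVec, dotProduct, Fin.sum_univ_two]
  simp only [e, Matrix.mul_apply, Fin.sum_univ_two, lineProj, Matrix.of_apply,
    Matrix.conjTranspose_apply, mul_smul_comm, smul_mul_assoc, ← smul_add, star_add, star_mul]
  congr 1
  noncomm_ring

/-- The representative `ℓ.rep` is an arbitrary choice, not a smooth function of the line. The
entries of `g P g*` are smooth along `f`, so openness of the finite set and smoothness of the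
coordinate are derived from them. -/
theorem toInfinity_iff : ToInfinity g ℓ ↔ ((g : Mat) * lineProj ℓ * (g : Mat)ᴴ) 1 1 = 0 := by
  rw [conj_lineProj_apply, smul_eq_zero, or_iff_right (inv_ne_zero (normSq_rep_pos ℓ).ne'),
    self_mul_star_eq_coe]
  change ((g : Mat) *ᵥ ℓ.rep) 1 = 0 ↔ _
  constructor
  · intro h; rw [h]; simp
  · intro h
    have h2 : ‖((g : Mat) *ᵥ ℓ.rep) 1‖ ^ 2 = 0 := Quaternion.coe_injective h
    simpa using h2

theorem affineCoord_eq (h : ¬ ToInfinity g ℓ) :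
    affineCoord g ℓ = ((g : Mat) * lineProj ℓ * (g : Mat)ᴴ) 0 1 *
      (((g : Mat) * lineProj ℓ * (g : Mat)ᴴ) 1 1)⁻¹ := by
  have h1 : ((g : Mat) *ᵥ ℓ.rep) 1 ≠ 0 := h
  have hne : ((g : Mat) * lineProj ℓ * (g : Mat)ᴴ) 1 1 ≠ 0 := fun h2 => h (toInfinity_iff.2 h2)
  rw [eq_mul_inv_iff_mul_eq₀ hne, conj_lineProj_apply, conj_lineProj_apply, mul_smul_comm,
    affineCoord, mul_assoc, inv_mul_cancel_left₀ h1]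

end Lines

/-! ### Differential calculus for matrix valued functions. -/

section MatrixCalculus

variable {M : Type*} [TopologicalSpace M] [ChartedSpace ℂ M]

/-- Smoothness at a point of a matrix valued function. -/
def SmMatAt (B : M → Mat) (p : M) : Prop := ∀ i j, SmAt (fun q => B q i j) p

variable {B C : M → Mat} {p : M}

theorem SmMatAt.const (C : Mat) : SmMatAt (fun _ : M => C) p := fun _ _ => SmAt.const _

theorem SmMatAt.mul (hB : SmMatAt B p) (hC : SmMatAt C p) : SmMatAt (fun q => B q * C q) p := by
  intro i j
  simp only [Matrix.mul_apply, Fin.sum_univ_two]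
  exact ((hB i 0).mul (hC 0 j)).add ((hB i 1).mul (hC 1 j))

theorem dMat_mul (hB : SmMatAt B p) (hC : SmMatAt C p) (X : Tan p) :
    dMat (fun q => B q * C q) p X = dMat B p X * C p + B p * dMat C p X := by
  ext1 i j
  simp only [dMat, Matrix.of_apply, Matrix.mul_apply, Fin.sum_univ_two, Matrix.add_apply]
  rw [dQ_add ((hB i 0).mul (hC 0 j)) ((hB i 1).mul (hC 1 j)), dQ_mul (hB i 0) (hC 0 j),
    dQ_mul (hB i 1) (hC 1 j)]
  abel

theorem dMat_const (C : Mat) (X : Tan p) : dMat (fun _ : M => C) p X = 0 := by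
  ext1 i j
  exact dQ_const _ _

theorem dMat_const_mul (D : Mat) (hB : SmMatAt B p) (X : Tan p) :
    dMat (fun q => D * B q) p X = D * dMat B p X := by
  rw [dMat_mul (SmMatAt.const D) hB, dMat_const, zero_mul, zero_add]

theorem dMat_mul_const (D : Mat) (hB : SmMatAt B p) (X : Tan p) :
    dMat (fun q => B q * D) p X = dMat B p X * D := by
  rw [dMat_mul hB (SmMatAt.const D), dMat_const, mul_zero, add_zero]

theorem dMat_congr (h : B =ᶠ[nhds p] C) (X : Tan p) : dMat B p X = dMat C p X := by
  ext1 i j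
  exact dQ_congr (h.mono fun q hq => by simp only [hq]) X

theorem SmMatAt.congr (hB : SmMatAt B p) (h : C =ᶠ[nhds p] B) : SmMatAt C p := fun i j =>
  (hB i j).congr (h.mono fun q hq => by simp only [hq])

theorem dMat_add_vec (X Y : Tan p) : dMat B p (X + Y) = dMat B p X + dMat B p Y := by
  ext1 i j; exact dQ_add_vec _ _

theorem dMat_smul_vec (r : ℝ) (X : Tan p) : dMat B p (r • X) = r • dMat B p X := by
  ext1 i j; exact dQ_smul_vec _ _

theorem dMat_rot_rot (X : Tan p) : dMat B p (rot (rot X)) = -dMat B p X := by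
  ext1 i j; exact dQ_rot_rot _

theorem smoothMat_iff : SmoothMat B ↔ ∀ p, SmMatAt B p :=
  ⟨fun h p i j => h i j p, fun h i j p => h p i j⟩

end MatrixCalculus

end QSurf

namespace QSurf

variable {M : Type*} [TopologicalSpace M] [ChartedSpace ℂ M]

/-- The affine coordinate of the surface `g ∘ f`. -/
def coord (f : M → HP1) (g : Matˣ) (p : M) : ℍ[ℝ] := affineCoord g (f p)

/-- The points that `g ∘ f` does not map to `∞`. -/
def finiteSet (f : M → HP1) (g : Matˣ) : Set M := {p | ¬ ToInfinity g (f p)}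

/-! ### The conformal immersion in an affine coordinate. -/

section Coordinates

variable {f : M → HP1} {g : Matˣ} {p : M}

theorem smMatAt_conj (hf : IsConformalImmersion f) (p : M) :
    SmMatAt (fun q => (g : Mat) * lineProj (f q) * (g : Mat)ᴴ) p :=
  ((SmMatAt.const _).mul (smoothMat_iff.1 hf.smooth p)).mul (SmMatAt.const _)

theorem isOpen_finiteSet (hf : IsConformalImmersion f) : IsOpen (finiteSet f g) := by
  have h : finiteSet f g =
      (fun q => ((g : Mat) * lineProj (f q) * (g : Mat)ᴴ) 1 1) ⁻¹' {0}ᶜ := by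
    ext q
    exact not_congr toInfinity_iff
  rw [h]
  exact isOpen_compl_singleton.preimage
    (continuous_iff_continuousAt.2 fun q => (smMatAt_conj hf q 1 1).continuousAt)

theorem smAt_coord (hf : IsConformalImmersion f) (hp : p ∈ finiteSet f g) :
    SmAt (coord f g) p := by
  have h0 : ((g : Mat) * lineProj (f p) * (g : Mat)ᴴ) 1 1 ≠ 0 := fun h => hp (toInfinity_iff.2 h)
  refine ((smMatAt_conj (g := g) hf p 0 1).mul ((smMatAt_conj (g := g) hf p 1 1).inv h0)).congr ?_
  filter_upwards [(isOpen_finiteSet hf).mem_nhds hp] with q hq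
  exact affineCoord_eq hq

/-- The coordinate of `V/L` induced by `g`. -/
def theta (f : M → HP1) (g : Matˣ) (p : M) (v : V) : ℍ[ℝ] :=
  ((g : Mat) *ᵥ v) 0 - coord f g p * ((g : Mat) *ᵥ v) 1

theorem theta_eq_zero_iff (hp : p ∈ finiteSet f g) {v : V} :
    theta f g p v = 0 ↔ v ∈ (f p).submodule := by
  rw [mem_iff_affine hp, theta, sub_eq_zero]
  rfl

theorem theta_sub (v w : V) : theta f g p (v - w) = theta f g p v - theta f g p w := by
  simp only [theta, Matrix.mulVec_sub, Pi.sub_apply]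
  noncomm_ring

theorem theta_vmul (v : V) (c : ℍ[ℝ]) : theta f g p (vmul v c) = theta f g p v * c := by
  simp only [theta, mulVec_vmul, vmul_apply, sub_mul, mul_assoc]

theorem theta_eq_iff (hp : p ∈ finiteSet f g) {v w : V} :
    theta f g p v = theta f g p w ↔
      (f p).submodule.mkQ v = (f p).submodule.mkQ w := by
  rw [← sub_eq_zero, ← theta_sub, theta_eq_zero_iff hp, Submodule.mkQ_apply, Submodule.mkQ_apply,
    Submodule.Quotient.eq]

theorem theta_inv_mulVec (a b : ℍ[ℝ]) :
    theta f g p (((g⁻¹ : Matˣ) : Mat) *ᵥ ![a, b]) = a - coord f g p * b := by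
  simp only [theta, mulVec_inv_mulVec]
  rfl

theorem psi_mem (hp : p ∈ finiteSet f g) :
    ((g⁻¹ : Matˣ) : Mat) *ᵥ ![coord f g p, 1] ∈ (f p).submodule := by
  rw [← theta_eq_zero_iff hp, theta_inv_mulVec, mul_one, sub_self]

theorem mem_eq_vmul (hp : p ∈ finiteSet f g) {v : V} (hv : v ∈ (f p).submodule) :
    (g : Mat) *ᵥ v = vmul ![coord f g p, 1] (((g : Mat) *ᵥ v) 1) :=
  vec_ext ((mem_iff_affine hp).1 hv) (one_mul _).symm

/-- The derivative of `f` in the affine coordinate. -/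
theorem theta_dMat_lineProj (hf : IsConformalImmersion f) (hp : p ∈ finiteSet f g) (X : Tan p)
    {v : V} (hv : v ∈ (f p).submodule) :
    theta f g p (dMat (fun q => lineProj (f q)) p X *ᵥ v) =
      dQ (coord f g) p X * ((g : Mat) *ᵥ v) 1 := by
  have hP := smoothMat_iff.1 hf.smooth p
  have hgP : SmMatAt (fun q => (g : Mat) * lineProj (f q)) p := (SmMatAt.const _).mul hP
  -- The columns of `P` lie in `L`, so the first row of `g P` is `x` times the second; this is the
  -- Leibniz rule for that relation.
  have key : ∀ j, dQ (fun q => ((g : Mat) * lineProj (f q)) 0 j) p X =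
      dQ (coord f g) p X * ((g : Mat) * lineProj (f p)) 1 j +
        coord f g p * dQ (fun q => ((g : Mat) * lineProj (f q)) 1 j) p X := by
    intro j
    rw [← dQ_mul (smAt_coord hf hp) (hgP 1 j)]
    refine dQ_congr ?_ X
    filter_upwards [(isOpen_finiteSet hf).mem_nhds hp] with q hq
    have h := (mem_iff_affine hq).1 (lineProj_mulVec_mem (f q) (Pi.single j 1))
    rw [Matrix.mulVec_mulVec] at h
    simpa [coord] using h
  have key' : ∀ i j, dQ (fun q => ((g : Mat) * lineProj (f q)) i j) p X =
      ((g : Mat) * dMat (fun q => lineProj (f q)) p X) i j := by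
    intro i j
    rw [← dMat_const_mul _ hP]
    rfl
  have hPv : ((g : Mat) * lineProj (f p)) *ᵥ v = (g : Mat) *ᵥ v := by
    rw [← Matrix.mulVec_mulVec, lineProj_mulVec_of_mem hv]
  rw [theta, Matrix.mulVec_mulVec, mulVec_zero_entry, mulVec_one_entry, ← hPv, mulVec_one_entry,
    ← key', ← key', ← key', ← key', key, key]
  noncomm_ring

/-- An endomorphism of the line `L` multiplies the coefficient of `ψ = (x, 1)` by a quaternion, and
an endomorphism of `V/L`, identified with `ℍ` by `theta`, is a left multiplication. So `J` yields
the right normal and `J'` the left one. -/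
theorem exists_normals (hf : IsConformalImmersion f) (hp : p ∈ finiteSet f g) :
    ∃ N R : ℍ[ℝ], N * N = -1 ∧ R * R = -1 ∧ ∀ X : Tan p,
      dQ (coord f g) p (rot X) = N * dQ (coord f g) p X ∧
      dQ (coord f g) p (rot X) = -(dQ (coord f g) p X * R) := by
  obtain ⟨J, J', hJ, hJ', h⟩ := hf.conformal p
  set ψ : (f p).submodule := ⟨_, psi_mem hp⟩ with hψ
  have hψ1 : ((g : Mat) *ᵥ (ψ : V)) 1 = 1 := by
    rw [hψ, mulVec_inv_mulVec]; rfl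
  set j : ℍ[ℝ] := ((g : Mat) *ᵥ (J ψ : V)) 1 with hj
  have hJψ : J ψ = MulOpposite.op j • ψ := by
    apply Subtype.ext
    refine mulVec_injective g ?_
    rw [mem_eq_vmul hp (J ψ).2]
    change _ = (g : Mat) *ᵥ (vmul ψ j)
    rw [mulVec_vmul, mem_eq_vmul hp ψ.2, hψ1]
    exact vec_ext (by simp [hj]) (by simp [hj])
  have hjj : j * j = -1 := by
    have h1 : J (J ψ) = -ψ := LinearMap.congr_fun hJ ψ
    rw [hJψ, map_smul, hJψ] at h1
    have h2 : vmul (vmul (ψ : V) j) j = -(ψ : V) := congrArg Subtype.val h1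
    have h3 := congrArg (fun v => ((g : Mat) *ᵥ v) 1) h2
    simpa only [mulVec_vmul, vmul_apply, Matrix.mulVec_neg, Pi.neg_apply, hψ1, one_mul] using h3
  set χ : V := ((g⁻¹ : Matˣ) : Mat) *ᵥ ![1, 0] with hχ
  have hθχ : theta f g p χ = 1 := by rw [hχ, theta_inv_mulVec, mul_zero, sub_zero]
  obtain ⟨u, hu⟩ := Submodule.mkQ_surjective _ (J' ((f p).submodule.mkQ χ))
  have hJ'v : ∀ v w : V, J' ((f p).submodule.mkQ v) = (f p).submodule.mkQ w →
      theta f g p w = theta f g p u * theta f g p v := by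
    intro v w hw
    have h1 : (f p).submodule.mkQ v = (f p).submodule.mkQ (vmul χ (theta f g p v)) := by
      rw [← theta_eq_iff hp, theta_vmul, hθχ, one_mul]
    have h2 : (f p).submodule.mkQ (vmul χ (theta f g p v)) =
      MulOpposite.op (theta f g p v) • (f p).submodule.mkQ χ := rfl
    have h3 : (f p).submodule.mkQ (vmul u (theta f g p v)) =
      MulOpposite.op (theta f g p v) • (f p).submodule.mkQ u := rfl
    rw [h1, h2, map_smul, ← hu, ← h3, ← theta_eq_iff hp, theta_vmul] at hw
    exact hw.symm
  -- The sign in `R = -j` fits the convention `*dx = -dx R`, under which `S ψ = -ψ R`.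
  refine ⟨theta f g p u, -j, ?_, by rw [neg_mul_neg, hjj], fun X => ⟨?_, ?_⟩⟩
  · have h1 : J' (J' ((f p).submodule.mkQ χ)) = (f p).submodule.mkQ (-χ) := by
      rw [map_neg]; exact LinearMap.congr_fun hJ' _
    rw [← hu] at h1
    rw [← hJ'v _ _ h1, ← zero_sub, theta_sub, hθχ]
    simp [theta]
  · have h1 := LinearMap.congr_fun (h X).2 ψ
    have h2 := hJ'v (dMat (fun q => lineProj (f q)) p X *ᵥ ψ)
      (dMat (fun q => lineProj (f q)) p (rot X) *ᵥ ψ) h1.symm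
    rwa [theta_dMat_lineProj hf hp _ ψ.2, theta_dMat_lineProj hf hp _ ψ.2, hψ1, mul_one,
      mul_one] at h2
  · have h1 := LinearMap.congr_fun (h X).1 ψ
    have h2 : (f p).submodule.mkQ (dMat (fun q => lineProj (f q)) p (rot X) *ᵥ ψ) =
      (f p).submodule.mkQ (dMat (fun q => lineProj (f q)) p X *ᵥ (J ψ : V)) := h1
    rw [← theta_eq_iff hp, theta_dMat_lineProj hf hp _ ψ.2, theta_dMat_lineProj hf hp _ (J ψ).2,
      hψ1, mul_one, ← hj] at h2
    rw [h2, mul_neg, neg_neg]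

/-- If `dx` vanished on `X`, then also on `rot X` by `*dx = N dx`, hence on the whole tangent plane,
and `δ` would be zero. -/
theorem dQ_coord_ne_zero (hf : IsConformalImmersion f) (hp : p ∈ finiteSet f g) {X : Tan p}
    (hX : X ≠ 0) : dQ (coord f g) p X ≠ 0 := by
  intro h0
  obtain ⟨N, R, -, -, h⟩ := exists_normals hf hp
  obtain ⟨Y, hY⟩ := hf.delta_ne_zero p
  refine hY (LinearMap.ext fun v => ?_)
  obtain ⟨a, b, rfl⟩ := exists_eq_smul_add_smul_rot X Y hX
  change (f p).submodule.mkQ (dMat (fun q => lineProj (f q)) p (a • X + b • rot X) *ᵥ v) = 0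
  rw [← map_zero (f p).submodule.mkQ, ← theta_eq_iff hp, theta_dMat_lineProj hf hp _ v.2,
    dQ_add_vec, dQ_smul_vec, dQ_smul_vec, (h X).1, h0]
  simp [theta]

end Coordinates

end QSurf

/-! ### Structure equations and the matrix of the mean curvature sphere. -/

namespace QSurf

variable {M : Type*} [TopologicalSpace M] [ChartedSpace ℂ M]

/-- The mean curvature sphere in terms of the affine coordinate `x`, the left and right normals
`N`, `R` and the mean curvature `H`. -/
def frameMat (x N R H : ℍ[ℝ]) : Mat :=
  !![N - x * H, x * H * x - x * R - N * x; -H, H * x - R]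

/-- The structure equations of a conformal immersion `x` into `ℍ` on `U`, with left and right
normals `N`, `R` and mean curvature `H`. -/
structure Frame (U : Set M) (x N R H : M → ℍ[ℝ]) : Prop where
  isOpen : IsOpen U
  smx : ∀ p ∈ U, SmAt x p
  smN : ∀ p ∈ U, SmAt N p
  smR : ∀ p ∈ U, SmAt R p
  smH : ∀ p ∈ U, SmAt H p
  N_sq : ∀ p ∈ U, N p * N p = -1
  R_sq : ∀ p ∈ U, R p * R p = -1
  H_mul_N : ∀ p ∈ U, H p * N p = R p * H p
  left : ∀ p ∈ U, ∀ X : Tan p, dQ x p (rot X) = N p * dQ x p X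
  right : ∀ p ∈ U, ∀ X : Tan p, dQ x p (rot X) = -(dQ x p X * R p)
  ne_zero : ∀ p ∈ U, ∀ X : Tan p, X ≠ 0 → dQ x p X ≠ 0
  hopf : ∀ p ∈ U, ∀ X : Tan p,
    R p * dQ R p X + dQ R p (rot X) = 2 * (H p * dQ x p (rot X))

theorem mat_ext {B C : Mat} (h00 : B 0 0 = C 0 0) (h01 : B 0 1 = C 0 1) (h10 : B 1 0 = C 1 0)
    (h11 : B 1 1 = C 1 1) : B = C := by
  ext1 i j
  fin_cases i <;> fin_cases j
  exacts [h00, h01, h10, h11]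

section FrameMat

variable {x N R H : M → ℍ[ℝ]} {p : M}

theorem frameMat_mulVec (x N R H : ℍ[ℝ]) : frameMat x N R H *ᵥ ![x, 1] = vmul ![x, 1] (-R) := by
  refine vec_ext ?_ ?_
  · rw [mulVec_zero_entry]; simp [frameMat]; noncomm_ring
  · rw [mulVec_one_entry]; simp [frameMat]; noncomm_ring

theorem frameMat_mul_self {x N R H : ℍ[ℝ]} (hN : N * N = -1) (hR : R * R = -1)
    (hH : H * N = R * H) : frameMat x N R H * frameMat x N R H = -1 := by
  -- Conjugation by a unipotent matrix moves `ψ = (x, 1)` to `(0, 1)` and makes the matrix lower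
  -- triangular.
  have h : frameMat x N R H = !![1, x; 0, 1] * !![N, 0; -H, -R] * !![1, -x; 0, 1] := by
    rw [Matrix.mul_fin_two, Matrix.mul_fin_two]
    refine mat_ext ?_ ?_ ?_ ?_ <;> simp [frameMat] <;> noncomm_ring
  have h1 : (!![1, -x; 0, 1] : Mat) * !![1, x; 0, 1] = 1 := by
    rw [Matrix.mul_fin_two, Matrix.one_fin_two]; simp
  have h3 : (!![1, x; 0, 1] : Mat) * !![1, -x; 0, 1] = 1 := by
    rw [Matrix.mul_fin_two, Matrix.one_fin_two]; simp
  have h2 : (!![N, 0; -H, -R] : Mat) * !![N, 0; -H, -R] = -1 := by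
    rw [Matrix.mul_fin_two, Matrix.one_fin_two]
    refine mat_ext ?_ ?_ ?_ ?_ <;> simp [hN, hR, hH]
  calc frameMat x N R H * frameMat x N R H
      = !![1, x; 0, 1] * !![N, 0; -H, -R] * (!![1, -x; 0, 1] * !![1, x; 0, 1]) *
          !![N, 0; -H, -R] * !![1, -x; 0, 1] := by rw [h]; simp only [mul_assoc]
    _ = -1 := by
      rw [h1, mul_one, mul_assoc !![1, x; 0, 1], h2, mul_neg, mul_one, neg_mul, h3]

theorem smMatAt_frameMat (hx : SmAt x p) (hN : SmAt N p) (hR : SmAt R p) (hH : SmAt H p) :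
    SmMatAt (fun q => frameMat (x q) (N q) (R q) (H q)) p := by
  intro i j
  fin_cases i <;> fin_cases j
  · exact hN.sub (hx.mul hH)
  · exact (((hx.mul hH).mul hx).sub (hx.mul hR)).sub (hN.mul hx)
  · exact hH.neg
  · exact (hH.mul hx).sub hR

theorem dMat_frameMat (hx : SmAt x p) (hN : SmAt N p) (hR : SmAt R p) (hH : SmAt H p) (X : Tan p) :
    dMat (fun q => frameMat (x q) (N q) (R q) (H q)) p X =
      !![dQ N p X - (dQ x p X * H p + x p * dQ H p X),
        (dQ x p X * H p + x p * dQ H p X) * x p + x p * H p * dQ x p X -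
          (dQ x p X * R p + x p * dQ R p X) - (dQ N p X * x p + N p * dQ x p X);
        -dQ H p X, dQ H p X * x p + H p * dQ x p X - dQ R p X] := by
  ext1 i j
  fin_cases i <;> fin_cases j
  · change dQ (fun q => N q - x q * H q) p X = dQ N p X - (dQ x p X * H p + x p * dQ H p X)
    rw [dQ_sub hN (hx.mul hH), dQ_mul hx hH]
  · change dQ (fun q => x q * H q * x q - x q * R q - N q * x q) p X =
      (dQ x p X * H p + x p * dQ H p X) * x p + x p * H p * dQ x p X -
          (dQ x p X * R p + x p * dQ R p X) - (dQ N p X * x p + N p * dQ x p X)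
    rw [dQ_sub (((hx.mul hH).mul hx).sub (hx.mul hR)) (hN.mul hx),
      dQ_sub ((hx.mul hH).mul hx) (hx.mul hR), dQ_mul (hx.mul hH) hx, dQ_mul hx hH, dQ_mul hx hR,
      dQ_mul hN hx]
  · exact dQ_neg hH X
  · change dQ (fun q => H q * x q - R q) p X = dQ H p X * x p + H p * dQ x p X - dQ R p X
    rw [dQ_sub (hH.mul hx) hR, dQ_mul hH hx]

/-- The relation `N dx = -dx R` cancels the component transverse to `L`, so `∇S` maps `L` to `L`.
The remaining factor is `-b`, with `b = dR - H dx`. -/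
theorem dMat_frameMat_mulVec (hx : SmAt x p) (hN : SmAt N p) (hR : SmAt R p) (hH : SmAt H p)
    {X : Tan p} (h : N p * dQ x p X = -(dQ x p X * R p)) :
    dMat (fun q => frameMat (x q) (N q) (R q) (H q)) p X *ᵥ ![x p, 1] =
      vmul ![x p, 1] (H p * dQ x p X - dQ R p X) := by
  rw [dMat_frameMat hx hN hR hH]
  refine vec_ext ?_ ?_
  · rw [mulVec_zero_entry]
    simp
    linear_combination (norm := noncomm_ring) -h
  · rw [mulVec_one_entry]
    simp
    noncomm_ring

end FrameMat

/-- The conditions on the mean curvature sphere congruence, restricted to the points of `W`. -/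
structure MCSOn (f : M → HP1) (S : M → Mat) (W : Set M) : Prop where
  smooth : ∀ p ∈ W, SmMatAt S p
  sq : ∀ p ∈ W, S p * S p = -1
  maps : ∀ p ∈ W, (f p).submodule.map (matEnd (S p)) = (f p).submodule
  left : ∀ p ∈ W, ∀ X : Tan p, ∀ v ∈ (f p).submodule,
    dMat (fun q => lineProj (f q)) p (rot X) *ᵥ v -
      S p *ᵥ (dMat (fun q => lineProj (f q)) p X *ᵥ v) ∈ (f p).submodule
  right : ∀ p ∈ W, ∀ X : Tan p, ∀ v ∈ (f p).submodule,
    dMat (fun q => lineProj (f q)) p (rot X) *ᵥ v -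
      dMat (fun q => lineProj (f q)) p X *ᵥ (S p *ᵥ v) ∈ (f p).submodule
  hopf : ∀ p ∈ W, ∀ X : Tan p, ∀ v ∈ (f p).submodule, hopfQ S p X *ᵥ v = 0

theorem mcsOn_univ_iff {f : M → HP1} {S : M → Mat} :
    MCSOn f S Set.univ ↔ IsMeanCurvatureSphere f S :=
  ⟨fun h => ⟨smoothMat_iff.2 fun p => h.smooth p trivial, fun p => h.sq p trivial,
    fun p => h.maps p trivial, fun p => h.left p trivial, fun p => h.right p trivial,
    fun p => h.hopf p trivial⟩,
  fun h => ⟨fun p _ => smoothMat_iff.1 h.smooth p, fun p _ => h.sq p, fun p _ => h.maps p,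
    fun p _ => h.star_delta_left p, fun p _ => h.star_delta_right p,
    fun p _ => h.hopfQ_eq_zero p⟩⟩

theorem MCSOn.mono {f : M → HP1} {S : M → Mat} {W W' : Set M} (h : MCSOn f S W) (hW : W' ⊆ W) :
    MCSOn f S W' :=
  ⟨fun p hp => h.smooth p (hW hp), fun p hp => h.sq p (hW hp), fun p hp => h.maps p (hW hp),
    fun p hp => h.left p (hW hp), fun p hp => h.right p (hW hp), fun p hp => h.hopf p (hW hp)⟩

theorem hopfQ_congr {S S' : M → Mat} {p : M} (h : S =ᶠ[nhds p] S') (X : Tan p) :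
    hopfQ S p X = hopfQ S' p X := by
  rw [hopfQ, hopfQ, dMat_congr h, dMat_congr h, h.self_of_nhds]

theorem MCSOn.congr {f : M → HP1} {S S' : M → Mat} {W : Set M} (h : MCSOn f S W) (hW : IsOpen W)
    (hS : ∀ p ∈ W, S' p = S p) : MCSOn f S' W := by
  have hev : ∀ p ∈ W, S' =ᶠ[nhds p] S := fun p hp =>
    Filter.eventually_of_mem (hW.mem_nhds hp) hS
  refine ⟨fun p hp => (h.smooth p hp).congr (hev p hp), fun p hp => ?_, fun p hp => ?_,
    fun p hp => ?_, fun p hp => ?_, fun p hp X => ?_⟩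
  · rw [hS p hp]; exact h.sq p hp
  · rw [hS p hp]; exact h.maps p hp
  · rw [hS p hp]; exact h.left p hp
  · rw [hS p hp]; exact h.right p hp
  · rw [hopfQ_congr (hev p hp)]; exact h.hopf p hp X

/-! ### From the mean curvature sphere to the structure equations. -/

section FrameOfSphere

variable {f : M → HP1} {g : Matˣ} {S : M → Mat} {W : Set M} {p : M}

/-- The matrix of `S` in the frame `g`. -/
def conjMat (g : Matˣ) (S : M → Mat) (p : M) : Mat := (g : Mat) * S p * ((g⁻¹ : Matˣ) : Mat)

/-- The quaternionic mean curvature in the frame `g`. -/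
def meanH (g : Matˣ) (S : M → Mat) (p : M) : ℍ[ℝ] := -conjMat g S p 1 0

/-- The left normal in the frame `g`. -/
def normalN (f : M → HP1) (g : Matˣ) (S : M → Mat) (p : M) : ℍ[ℝ] :=
  conjMat g S p 0 0 - coord f g p * conjMat g S p 1 0

/-- The right normal in the frame `g`. -/
def normalR (f : M → HP1) (g : Matˣ) (S : M → Mat) (p : M) : ℍ[ℝ] :=
  -(conjMat g S p 1 0 * coord f g p + conjMat g S p 1 1)

theorem smMatAt_conjMat (hS : SmMatAt S p) : SmMatAt (conjMat g S) p :=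
  ((SmMatAt.const _).mul hS).mul (SmMatAt.const _)

theorem dMat_conjMat (hS : SmMatAt S p) (X : Tan p) :
    dMat (conjMat g S) p X = (g : Mat) * dMat S p X * ((g⁻¹ : Matˣ) : Mat) := by
  have h := dMat_mul_const ((g⁻¹ : Matˣ) : Mat) ((SmMatAt.const (g : Mat)).mul hS) X
  rw [dMat_const_mul _ hS] at h
  exact h

theorem conjMat_mulVec (v : V) : conjMat g S p *ᵥ ((g : Mat) *ᵥ v) = (g : Mat) *ᵥ (S p *ᵥ v) := by
  rw [conjMat, Matrix.mulVec_mulVec, Matrix.mulVec_mulVec, mul_assoc, Units.inv_mul, mul_one]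

/-- Three entries serve to define `N`, `R`, `H`; invariance of `L` under `S` determines the fourth.
-/
theorem conjMat_eq_frameMat (hS : MCSOn f S W) (hp : p ∈ W ∩ finiteSet f g) :
    conjMat g S p = frameMat (coord f g p) (normalN f g S p) (normalR f g S p) (meanH g S p) := by
  have h1 : S p *ᵥ (((g⁻¹ : Matˣ) : Mat) *ᵥ ![coord f g p, 1]) ∈ (f p).submodule := by
    have h2 := Submodule.mem_map_of_mem (f := matEnd (S p)) (psi_mem hp.2)
    rw [hS.maps p hp.1] at h2
    exact h2
  rw [mem_iff_affine hp.2, ← conjMat_mulVec, mulVec_inv_mulVec, mulVec_zero_entry,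
    mulVec_one_entry] at h1
  change _ = coord f g p * _ at h1
  have h3 : conjMat g S p 0 0 * coord f g p + conjMat g S p 0 1 =
      coord f g p * (conjMat g S p 1 0 * coord f g p + conjMat g S p 1 1) := by simpa using h1
  ext1 i j
  fin_cases i <;> fin_cases j
  · simp [frameMat, normalN, meanH]
  · simp [frameMat, normalN, normalR, meanH]
    linear_combination (norm := noncomm_ring) h3
  · simp [frameMat, meanH]
  · simp [frameMat, normalR, meanH]

theorem theta_mulVec (h : conjMat g S p =
      frameMat (coord f g p) (normalN f g S p) (normalR f g S p) (meanH g S p)) (v : V) :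
    theta f g p (S p *ᵥ v) = normalN f g S p * theta f g p v := by
  simp only [theta, ← conjMat_mulVec]
  rw [h, mulVec_zero_entry, mulVec_one_entry]
  simp [frameMat]
  noncomm_ring

theorem smAt_frame (hf : IsConformalImmersion f) (hS : MCSOn f S W) (hp : p ∈ W ∩ finiteSet f g) :
    SmAt (normalN f g S) p ∧ SmAt (normalR f g S) p ∧ SmAt (meanH g S) p := by
  have hm := smMatAt_conjMat (g := g) (hS.smooth p hp.1)
  have hx := smAt_coord hf hp.2
  exact ⟨(hm 0 0).sub (hx.mul (hm 1 0)), (((hm 1 0).mul hx).add (hm 1 1)).neg, (hm 1 0).neg⟩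

theorem hopfQ_conj (hS : SmMatAt S p) (X : Tan p) (v : V) :
    (g : Mat) *ᵥ (hopfQ S p X *ᵥ v) = (1 / 4 : ℝ) • (conjMat g S p *ᵥ
      (dMat (conjMat g S) p X *ᵥ ((g : Mat) *ᵥ v)) -
        dMat (conjMat g S) p (rot X) *ᵥ ((g : Mat) *ᵥ v)) := by
  have h : ∀ Y : Tan p, dMat (conjMat g S) p Y *ᵥ ((g : Mat) *ᵥ v) =
      (g : Mat) *ᵥ (dMat S p Y *ᵥ v) := by
    intro Y
    rw [dMat_conjMat hS, Matrix.mulVec_mulVec, Matrix.mulVec_mulVec, mul_assoc, Units.inv_mul,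
      mul_one]
  rw [h, h, conjMat_mulVec, hopfQ, Matrix.smul_mulVec, Matrix.sub_mulVec, ← Matrix.mulVec_mulVec,
    Matrix.mulVec_smul, Matrix.mulVec_sub]

/-- The mean curvature sphere congruence gives rise to a frame at the finite points. -/
theorem frame_of_mcsOn (hf : IsConformalImmersion f) (hW : IsOpen W) (hS : MCSOn f S W) :
    Frame (W ∩ finiteSet f g) (coord f g) (normalN f g S) (normalR f g S) (meanH g S) := by
  have hmulR : ∀ p ∈ W ∩ finiteSet f g, ∀ v ∈ (f p).submodule,
      ((g : Mat) *ᵥ (S p *ᵥ v)) 1 = -normalR f g S p * ((g : Mat) *ᵥ v) 1 := by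
    intro p hp v hv
    rw [← conjMat_mulVec, mem_eq_vmul hp.2 hv, mulVec_vmul, conjMat_eq_frameMat hS hp,
      frameMat_mulVec]
    simp
  have hψ1 : ∀ p : M, ((g : Mat) *ᵥ (((g⁻¹ : Matˣ) : Mat) *ᵥ ![coord f g p, 1])) 1 = 1 := by
    intro p; rw [mulVec_inv_mulVec]; rfl
  have hleft : ∀ p ∈ W ∩ finiteSet f g, ∀ X : Tan p,
      dQ (coord f g) p (rot X) = normalN f g S p * dQ (coord f g) p X := by
    intro p hp X
    have h := hS.left p hp.1 X _ (psi_mem hp.2)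
    rw [← theta_eq_zero_iff hp.2, theta_sub, theta_mulVec (conjMat_eq_frameMat hS hp),
      theta_dMat_lineProj hf hp.2 _ (psi_mem hp.2), theta_dMat_lineProj hf hp.2 _ (psi_mem hp.2),
      hψ1, mul_one, mul_one, sub_eq_zero] at h
    exact h
  have hright : ∀ p ∈ W ∩ finiteSet f g, ∀ X : Tan p,
      dQ (coord f g) p (rot X) = -(dQ (coord f g) p X * normalR f g S p) := by
    intro p hp X
    have h := hS.right p hp.1 X _ (psi_mem hp.2)
    have h2 : S p *ᵥ (((g⁻¹ : Matˣ) : Mat) *ᵥ ![coord f g p, 1]) ∈ (f p).submodule := by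
      have h2 := Submodule.mem_map_of_mem (f := matEnd (S p)) (psi_mem hp.2)
      rw [hS.maps p hp.1] at h2
      exact h2
    rw [← theta_eq_zero_iff hp.2, theta_sub, theta_dMat_lineProj hf hp.2 _ (psi_mem hp.2),
      theta_dMat_lineProj hf hp.2 _ h2, hmulR p hp _ (psi_mem hp.2), hψ1, mul_one, mul_one,
      sub_eq_zero, mul_neg] at h
    exact h
  have hsq : ∀ p ∈ W ∩ finiteSet f g, frameMat (coord f g p) (normalN f g S p)
      (normalR f g S p) (meanH g S p) * frameMat (coord f g p) (normalN f g S p)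
      (normalR f g S p) (meanH g S p) = -1 := by
    intro p hp
    rw [← conjMat_eq_frameMat hS hp]
    calc conjMat g S p * conjMat g S p
        = (g : Mat) * S p * (((g⁻¹ : Matˣ) : Mat) * (g : Mat)) * S p * ((g⁻¹ : Matˣ) : Mat) := by
          simp only [conjMat, mul_assoc]
      _ = -1 := by
          rw [Units.inv_mul, mul_one, mul_assoc (g : Mat), hS.sq p hp.1, mul_neg, mul_one,
            neg_mul, Units.mul_inv]
  have hR : ∀ p ∈ W ∩ finiteSet f g, normalR f g S p * normalR f g S p = -1 := by
    intro p hp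
    have h := congrArg (fun B : Mat => (B *ᵥ ![coord f g p, 1]) 1) (hsq p hp)
    simp only [← Matrix.mulVec_mulVec, frameMat_mulVec, mulVec_vmul, Matrix.neg_mulVec,
      Matrix.one_mulVec] at h
    simpa using h
  refine ⟨hW.inter (isOpen_finiteSet hf), fun p hp => smAt_coord hf hp.2,
    fun p hp => (smAt_frame hf hS hp).1, fun p hp => (smAt_frame hf hS hp).2.1,
    fun p hp => (smAt_frame hf hS hp).2.2, fun p hp => ?_, hR,
    fun p hp => ?_, hleft, hright, fun p hp X hX => dQ_coord_ne_zero hf hp.2 hX,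
    fun p hp X => ?_⟩
  -- Subtracting `x` times the `(1, 0)` entry of `S² = -1` from the `(0, 0)` entry isolates `N²`.
  · have h00 := congrFun (congrFun (hsq p hp) 0) 0
    have h10 := congrFun (congrFun (hsq p hp) 1) 0
    simp [frameMat, Matrix.mul_apply, Fin.sum_univ_two] at h00 h10
    linear_combination (norm := noncomm_ring) h00 - coord f g p * h10
  · have h10 := congrFun (congrFun (hsq p hp) 1) 0
    simp [frameMat, Matrix.mul_apply, Fin.sum_univ_two] at h10
    linear_combination (norm := noncomm_ring) -h10
  · have hm := conjMat_eq_frameMat hS hp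
    have hev : conjMat g S =ᶠ[nhds p] fun q => frameMat (coord f g q) (normalN f g S q)
        (normalR f g S q) (meanH g S q) :=
      Filter.eventually_of_mem ((hW.inter (isOpen_finiteSet hf)).mem_nhds hp)
        fun q hq => conjMat_eq_frameMat hS hq
    have h := congrArg (fun v => (g : Mat) *ᵥ v) (hS.hopf p hp.1 X _ (psi_mem hp.2))
    obtain ⟨sN, sR, sH⟩ := smAt_frame hf hS hp
    simp only [Matrix.mulVec_zero] at h
    rw [hopfQ_conj (hS.smooth p hp.1), smul_eq_zero_iff_right (by norm_num), mulVec_inv_mulVec,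
      dMat_congr hev, dMat_congr hev, hm,
      dMat_frameMat_mulVec (smAt_coord hf hp.2) sN sR sH (by rw [← hleft p hp, hright p hp]),
      dMat_frameMat_mulVec (smAt_coord hf hp.2) sN sR sH (by rw [← hleft p hp, hright p hp]),
      mulVec_vmul, frameMat_mulVec] at h
    -- On the basis vector `(x, 1)` of `L`, the condition `Q|_L = 0` is one quaternionic equation,
    -- seen in the second coordinate.
    have h1 := congrFun h 1
    have hHN : meanH g S p * normalN f g S p = normalR f g S p * meanH g S p := by
      have h10 := congrFun (congrFun (hsq p hp) 1) 0
      simp [frameMat, Matrix.mul_apply, Fin.sum_univ_two] at h10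
      linear_combination (norm := noncomm_ring) -h10
    simp at h1
    linear_combination (norm := noncomm_ring) h1 - hHN * dQ (coord f g) p X -
      meanH g S p * hleft p hp X

end FrameOfSphere

/-! ### From the structure equations back to the mean curvature sphere. -/

section SphereOfFrame

variable {f : M → HP1} {g : Matˣ} {U : Set M} {N R H : M → ℍ[ℝ]}

/-- The complex structure with prescribed matrix in the frame `g`. -/
def sphereOf (f : M → HP1) (g : Matˣ) (N R H : M → ℍ[ℝ]) (p : M) : Mat :=
  ((g⁻¹ : Matˣ) : Mat) * frameMat (coord f g p) (N p) (R p) (H p) * (g : Mat)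

theorem conjMat_sphereOf : conjMat g (sphereOf f g N R H) =
    fun p => frameMat (coord f g p) (N p) (R p) (H p) := by
  funext p
  calc conjMat g (sphereOf f g N R H) p = ((g : Mat) * ((g⁻¹ : Matˣ) : Mat)) *
        frameMat (coord f g p) (N p) (R p) (H p) * ((g : Mat) * ((g⁻¹ : Matˣ) : Mat)) := by
        simp only [conjMat, sphereOf, mul_assoc]
    _ = _ := by rw [Units.mul_inv, one_mul, mul_one]

theorem meanH_sphereOf (p : M) : meanH g (sphereOf f g N R H) p = H p := by
  simp [meanH, conjMat_sphereOf, frameMat]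

theorem normalN_sphereOf (p : M) : normalN f g (sphereOf f g N R H) p = N p := by
  simp [normalN, conjMat_sphereOf, frameMat]

theorem normalR_sphereOf (p : M) : normalR f g (sphereOf f g N R H) p = R p := by
  simp [normalR, conjMat_sphereOf, frameMat]

theorem mcsOn_sphereOf (hf : IsConformalImmersion f) (hU : U ⊆ finiteSet f g)
    (hF : Frame U (coord f g) N R H) : MCSOn f (sphereOf f g N R H) U := by
  have hm : ∀ p, conjMat g (sphereOf f g N R H) p = frameMat (coord f g p) (N p) (R p) (H p) :=
    fun p => congrFun conjMat_sphereOf p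
  have hm' : ∀ p, conjMat g (sphereOf f g N R H) p = frameMat (coord f g p)
      (normalN f g (sphereOf f g N R H) p) (normalR f g (sphereOf f g N R H) p)
      (meanH g (sphereOf f g N R H) p) := by
    intro p
    rw [hm, normalN_sphereOf, normalR_sphereOf, meanH_sphereOf]
  have hsm : ∀ p ∈ U, SmMatAt (sphereOf f g N R H) p := fun p hp =>
    ((SmMatAt.const _).mul (smMatAt_frameMat (hF.smx p hp) (hF.smN p hp) (hF.smR p hp)
      (hF.smH p hp))).mul (SmMatAt.const _)
  have hsq : ∀ p ∈ U, sphereOf f g N R H p * sphereOf f g N R H p = -1 := by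
    intro p hp
    calc sphereOf f g N R H p * sphereOf f g N R H p = ((g⁻¹ : Matˣ) : Mat) *
          (frameMat (coord f g p) (N p) (R p) (H p) * ((g : Mat) * ((g⁻¹ : Matˣ) : Mat)) *
            frameMat (coord f g p) (N p) (R p) (H p)) * (g : Mat) := by
          simp only [sphereOf, mul_assoc]
      _ = -1 := by
        rw [Units.mul_inv, mul_one, frameMat_mul_self (hF.N_sq p hp) (hF.R_sq p hp)
          (hF.H_mul_N p hp), mul_neg, mul_one, neg_mul, Units.inv_mul]
  have hmem : ∀ p ∈ U, ∀ v ∈ (f p).submodule, sphereOf f g N R H p *ᵥ v ∈ (f p).submodule := by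
    intro p hp v hv
    rw [← theta_eq_zero_iff (hU hp), theta_mulVec (hm' p), (theta_eq_zero_iff (hU hp)).2 hv,
      mul_zero]
  refine ⟨hsm, hsq, fun p hp => le_antisymm ?_ ?_, fun p hp X v hv => ?_, fun p hp X v hv => ?_,
    fun p hp X v hv => ?_⟩
  · rintro _ ⟨v, hv, rfl⟩
    exact hmem p hp v hv
  · intro v hv
    refine ⟨-(sphereOf f g N R H p *ᵥ v), neg_mem (hmem p hp v hv), ?_⟩
    change sphereOf f g N R H p *ᵥ (-(sphereOf f g N R H p *ᵥ v)) = v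
    rw [Matrix.mulVec_neg, Matrix.mulVec_mulVec, hsq p hp, Matrix.neg_mulVec, Matrix.one_mulVec,
      neg_neg]
  · rw [← theta_eq_zero_iff (hU hp), theta_sub, theta_mulVec (hm' p), normalN_sphereOf,
      theta_dMat_lineProj hf (hU hp) _ hv, theta_dMat_lineProj hf (hU hp) _ hv, hF.left p hp,
      mul_assoc, sub_self]
  · rw [← theta_eq_zero_iff (hU hp), theta_sub, theta_dMat_lineProj hf (hU hp) _ hv,
      theta_dMat_lineProj hf (hU hp) _ (hmem p hp v hv), ← conjMat_mulVec,
      mem_eq_vmul (hU hp) hv, mulVec_vmul, hm, frameMat_mulVec, hF.right p hp]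
    simp [mul_assoc]
  · refine mulVec_injective g ?_
    have hlr : ∀ Y : Tan p, N p * dQ (coord f g) p Y = -(dQ (coord f g) p Y * R p) := fun Y => by
      rw [← hF.left p hp, hF.right p hp]
    rw [hopfQ_conj (hsm p hp), conjMat_sphereOf, mem_eq_vmul (hU hp) hv, mulVec_vmul, mulVec_vmul,
      mulVec_vmul,
      dMat_frameMat_mulVec (hF.smx p hp) (hF.smN p hp) (hF.smR p hp) (hF.smH p hp) (hlr X),
      dMat_frameMat_mulVec (hF.smx p hp) (hF.smN p hp) (hF.smR p hp) (hF.smH p hp) (hlr (rot X)),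
      mulVec_vmul, frameMat_mulVec, Matrix.mulVec_zero]
    have key : -R p * (H p * dQ (coord f g) p X - dQ R p X) =
        H p * dQ (coord f g) p (rot X) - dQ R p (rot X) := by
      have h1 := hF.hopf p hp X
      have h2 := hF.H_mul_N p hp
      have h3 := hF.left p hp X
      linear_combination (norm := noncomm_ring) h1 + h2 * dQ (coord f g) p X + H p * h3
    have key2 : ∀ a b c d : ℍ[ℝ], a * b = c → vmul (vmul (vmul ![coord f g p, 1] a) b) d -
        vmul (vmul ![coord f g p, 1] c) d = 0 := by
      intro a b c d h
      rw [sub_eq_zero]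
      funext i
      simp only [vmul_apply, mul_assoc, ← h]
    rw [key2 _ _ _ _ key, smul_zero]

end SphereOfFrame

end QSurf

/-! ### The Laplacian identity and its consequences for the normals. -/

namespace QSurf

variable {M : Type*} [TopologicalSpace M] [ChartedSpace ℂ M]

theorem two_ne_zero_quaternion : (2 : ℍ[ℝ]) ≠ 0 := by
  have : CharZero ℍ[ℝ] := charZero_of_injective_algebraMap (algebraMap ℝ ℍ[ℝ]).injective
  exact two_ne_zero

theorem rot_ne_zero {p : M} {X : Tan p} (hX : X ≠ 0) : rot X ≠ 0 := by
  intro h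
  apply hX
  rw [← neg_eq_zero, ← rot_rot, h]
  exact mul_zero Complex.I

theorem exists_tan_ne_zero (p : M) : ∃ X : Tan p, X ≠ 0 := ⟨(1 : ℂ), one_ne_zero (α := ℂ)⟩

theorem self_mul_dQ {R : M → ℍ[ℝ]} {p : M} (hR : SmAt R p) (h : ∀ᶠ q in nhds p, R q * R q = -1)
    (X : Tan p) : dQ R p X * R p = -(R p * dQ R p X) := by
  have h1 := dQ_congr (F := fun q => R q * R q) (G := fun _ => -1) h X
  rw [dQ_mul hR hR, dQ_const] at h1
  exact eq_neg_of_add_eq_zero_left h1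

variable [IsManifold 𝓘(ℂ, ℂ) ω M]

theorem exists_chartVec_eq {e : OpenPartialHomeomorph M ℂ} (he : e ∈ atlas ℂ M) {q : M}
    (hq : q ∈ e.source) (X : Tan q) : ∃ v : ℂ, chartVec e v q = X := by
  have h := (mdifferentiable_of_mem_atlas_real he).symm.mfderiv_surjective (e.map_source hq)
  obtain ⟨v, hv⟩ := h (show ℂ from X)
  exact ⟨v, hv⟩

/-- The two ways of writing the Laplacian of a conformal map. -/
theorem laplacian_identity {U : Set M} (hU : IsOpen U) {x N R : M → ℍ[ℝ]}
    (hx : ∀ p ∈ U, SmAt x p) (hN : ∀ p ∈ U, SmAt N p) (hR : ∀ p ∈ U, SmAt R p)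
    (hl : ∀ p ∈ U, ∀ X : Tan p, dQ x p (rot X) = N p * dQ x p X)
    (hr : ∀ p ∈ U, ∀ X : Tan p, dQ x p (rot X) = -(dQ x p X * R p))
    {p : M} (hp : p ∈ U) (X : Tan p) :
    dQ N p X * dQ x p (rot X) - dQ N p (rot X) * dQ x p X =
      dQ x p X * dQ R p (rot X) - dQ x p (rot X) * dQ R p X := by
  have he := chart_mem_atlas ℂ p
  have hs := mem_chart_source ℂ p
  set e := chartAt ℂ p
  obtain ⟨v, rfl⟩ := exists_chartVec_eq he hs X
  have hxe : ∀ᶠ q in nhds p, SmAt x q := Filter.eventually_of_mem (hU.mem_nhds hp) hx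
  have hnear : ∀ᶠ q in nhds p, q ∈ U ∩ e.source :=
    (hU.inter e.open_source).mem_nhds ⟨hp, hs⟩
  set w := Complex.I * v with hw
  have ha := SmAt.dQ_chartVec he hs hxe v
  have hb := SmAt.dQ_chartVec he hs hxe w
  have hcomm := dQ_dQ_chartVec_comm he hs hxe v w
  have hab : ∀ q ∈ U ∩ e.source, chartVec e w q = rot (chartVec e v q) := fun q hq =>
    chartVec_I_mul he hq.2 v
  -- With subscripts for derivatives along `v` and `w = iv`, `h1 + h2` expresses `x_vv + x_ww`
  -- through `N` and `h3 + h4` expresses it through `R`. The mixed second derivatives cancel by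
  -- `hcomm`.
  have h1 := dQ_congr (F := fun q => dQ x q (chartVec e w q))
    (G := fun q => N q * dQ x q (chartVec e v q))
    (hnear.mono fun q hq => by simp only [hab q hq, hl q hq.1]) (chartVec e w p)
  have h2 := dQ_congr (F := fun q => dQ x q (chartVec e v q))
    (G := fun q => -(N q * dQ x q (chartVec e w q)))
    (hnear.mono fun q hq => by
      simp only [hab q hq, ← hl q hq.1, dQ_rot_rot, neg_neg]) (chartVec e v p)
  have h3 := dQ_congr (F := fun q => dQ x q (chartVec e w q))
    (G := fun q => -(dQ x q (chartVec e v q) * R q))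
    (hnear.mono fun q hq => by simp only [hab q hq, ← hr q hq.1]) (chartVec e w p)
  have h4 := dQ_congr (F := fun q => dQ x q (chartVec e v q))
    (G := fun q => dQ x q (chartVec e w q) * R q)
    (hnear.mono fun q hq => by
      have h := hr q hq.1 (rot (chartVec e v q))
      rw [dQ_rot_rot, neg_inj] at h
      simp only [hab q hq, h]) (chartVec e v p)
  rw [dQ_mul (hN p hp) ha] at h1
  rw [dQ_neg ((hN p hp).mul hb), dQ_mul (hN p hp) hb] at h2
  rw [dQ_neg (ha.mul (hR p hp)), dQ_mul ha (hR p hp)] at h3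
  rw [dQ_mul hb (hR p hp)] at h4
  rw [← hab p ⟨hp, hs⟩]
  rw [hcomm] at h1 h3
  linear_combination (norm := noncomm_ring) h1 + h2 - h3 - h4

section FrameIdentities

variable {U : Set M} {x N R H : M → ℍ[ℝ]} {p : M}

theorem Frame.N_mul_dx (hF : Frame U x N R H) (hp : p ∈ U) (X : Tan p) :
    N p * dQ x p X = -(dQ x p X * R p) := by
  rw [← hF.left p hp, hF.right p hp]

theorem Frame.dR_mul_R (hF : Frame U x N R H) (hp : p ∈ U) (X : Tan p) :
    dQ R p X * R p = -(R p * dQ R p X) :=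
  self_mul_dQ (hF.smR p hp) (Filter.eventually_of_mem (hF.isOpen.mem_nhds hp) hF.R_sq) X

theorem Frame.dN_mul_N (hF : Frame U x N R H) (hp : p ∈ U) (X : Tan p) :
    dQ N p X * N p = -(N p * dQ N p X) :=
  self_mul_dQ (hF.smN p hp) (Filter.eventually_of_mem (hF.isOpen.mem_nhds hp) hF.N_sq) X

/-- The Laplacian identity carries the equation `hopf` for the right normal over to the left normal.
-/
theorem Frame.hopf_left (hF : Frame U x N R H) (hp : p ∈ U) (X : Tan p) :
    N p * dQ N p X + dQ N p (rot X) = 2 * (N p * dQ x p X * H p) := by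
  by_cases hX : X = 0
  · have h0 : ∀ F : M → ℍ[ℝ], dQ F p (0 : Tan p) = 0 := fun F => map_zero _
    have h1 : rot (0 : Tan p) = 0 := mul_zero Complex.I
    rw [hX, h1]
    simp [h0]
  have hL := laplacian_identity hF.isOpen hF.smx hF.smN hF.smR hF.left hF.right hp X
  have ha := hF.ne_zero p hp X hX
  have hh := hF.hopf p hp X
  have hl := hF.left p hp X
  have hr := hF.right p hp X
  refine mul_right_cancel₀ ha ?_
  have h1 := hF.N_mul_dx hp X
  have h2 := hF.dN_mul_N hp X
  have h3 := hF.H_mul_N p hp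
  have e1 : dQ N p X * dQ x p (rot X) = -(N p * dQ N p X) * dQ x p X := by
    rw [hl, ← mul_assoc, h2]
  have e2 : dQ x p (rot X) * dQ R p X = -(dQ x p X * (R p * dQ R p X)) := by
    rw [hr, neg_mul, mul_assoc]
  have e3 : dQ x p X * (R p * dQ R p X + dQ R p (rot X)) =
      2 * (dQ x p X * (R p * H p * dQ x p X)) := by
    rw [hh, hl, ← mul_assoc (H p), h3]
    noncomm_ring
  have e4 : dQ x p X * (R p * H p * dQ x p X) = -(N p * dQ x p X * H p * dQ x p X) := by
    rw [h1]; noncomm_ring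
  linear_combination (norm := noncomm_ring) e1 - hL + e2 - e3 - 2 * e4

/-- The normals are quotients of values of `dx`. Since `R` is then known near `p`, so is `dR`, and
`hopf` determines `H`. -/
theorem Frame.unique {N' R' H' : M → ℍ[ℝ]} (hF : Frame U x N R H) (hF' : Frame U x N' R' H')
    (hp : p ∈ U) : N p = N' p ∧ R p = R' p ∧ H p = H' p := by
  have hR : ∀ q ∈ U, R q = R' q := by
    intro q hq
    obtain ⟨X, hX⟩ := exists_tan_ne_zero q
    refine mul_left_cancel₀ (hF.ne_zero q hq X hX) ?_
    rw [← neg_inj, ← hF.right q hq, hF'.right q hq]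
  obtain ⟨X, hX⟩ := exists_tan_ne_zero p
  refine ⟨mul_right_cancel₀ (hF.ne_zero p hp X hX) ?_, hR p hp, ?_⟩
  · rw [← hF.left p hp, hF'.left p hp]
  · have hev : R =ᶠ[nhds p] R' := Filter.eventually_of_mem (hF.isOpen.mem_nhds hp) hR
    have h := hF.hopf p hp X
    rw [dQ_congr hev, dQ_congr hev, hR p hp, hF'.hopf p hp X] at h
    have h2 := two_ne_zero_quaternion
    exact (mul_right_cancel₀ (hF.ne_zero p hp _ (rot_ne_zero hX)) (mul_left_cancel₀ h2 h)).symm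

end FrameIdentities

/-! ### Existence and uniqueness of the mean curvature sphere. -/

section Existence

variable {f : M → HP1} {g : Matˣ}

/-- The Möbius transformation that exchanges `0` and `∞`. -/
def swapUnit : Matˣ :=
  ⟨!![0, 1; 1, 0], !![0, 1; 1, 0], by rw [Matrix.mul_fin_two, Matrix.one_fin_two]; simp,
    by rw [Matrix.mul_fin_two, Matrix.one_fin_two]; simp⟩

theorem mem_finiteSet_one_or_swap (f : M → HP1) (p : M) :
    p ∈ finiteSet f 1 ∨ p ∈ finiteSet f swapUnit := by
  by_contra h
  rw [not_or] at h
  have h1 : ((1 : Mat) *ᵥ (f p).rep) 1 = 0 := not_not.1 h.1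
  have h2 : ((!![0, 1; 1, 0] : Mat) *ᵥ (f p).rep) 1 = 0 := not_not.1 h.2
  rw [Matrix.one_mulVec] at h1
  rw [mulVec_one_entry] at h2
  refine (f p).rep_nonzero (vec_ext ?_ h1)
  simpa using h2

theorem MCSOn.unique (hf : IsConformalImmersion f) {S S' : M → Mat} {W : Set M} (hW : IsOpen W)
    (hS : MCSOn f S W) (hS' : MCSOn f S' W) {p : M} (hp : p ∈ W) : S p = S' p := by
  have key : ∀ g : Matˣ, p ∈ finiteSet f g → S p = S' p := by
    intro g hg
    obtain ⟨hN, hR, hH⟩ := (frame_of_mcsOn (g := g) hf hW hS).unique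
      (frame_of_mcsOn (g := g) hf hW hS') ⟨hp, hg⟩
    have h : conjMat g S p = conjMat g S' p := by
      rw [conjMat_eq_frameMat hS ⟨hp, hg⟩, conjMat_eq_frameMat hS' ⟨hp, hg⟩, hN, hR, hH]
    exact g.isUnit.mul_left_cancel ((g⁻¹).isUnit.mul_right_cancel h)
  exact (mem_finiteSet_one_or_swap f p).elim (key 1) (key swapUnit)

/-- Conformality provides `N` and `R` pointwise; they are smooth as quotients of `dx` along
coordinate fields. `H` is defined by the equation for the left normal, and the Laplacian identity
converts this into `hopf`. -/
theorem exists_frame (hf : IsConformalImmersion f) (g : Matˣ) :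
    ∃ N R H : M → ℍ[ℝ], Frame (finiteSet f g) (coord f g) N R H := by
  have hopen := isOpen_finiteSet (g := g) hf
  have hsx : ∀ p ∈ finiteSet f g, SmAt (coord f g) p := fun p hp => smAt_coord hf hp
  have hne : ∀ p ∈ finiteSet f g, ∀ X : Tan p, X ≠ 0 → dQ (coord f g) p X ≠ 0 :=
    fun p hp X hX => dQ_coord_ne_zero hf hp hX
  have hNR := fun p : finiteSet f g => exists_normals hf p.2
  choose N' R' hN2' hR2' hlr' using hNR
  classical
  set N : M → ℍ[ℝ] := fun p => if h : p ∈ finiteSet f g then N' ⟨p, h⟩ else 0 with hNdef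
  set R : M → ℍ[ℝ] := fun p => if h : p ∈ finiteSet f g then R' ⟨p, h⟩ else 0 with hRdef
  have hNe : ∀ (p : M) (hp : p ∈ finiteSet f g), N p = N' ⟨p, hp⟩ := fun p hp => dif_pos hp
  have hRe : ∀ (p : M) (hp : p ∈ finiteSet f g), R p = R' ⟨p, hp⟩ := fun p hp => dif_pos hp
  have hN2 : ∀ p ∈ finiteSet f g, N p * N p = -1 := fun p hp => by rw [hNe p hp, hN2']
  have hR2 : ∀ p ∈ finiteSet f g, R p * R p = -1 := fun p hp => by rw [hRe p hp, hR2']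
  have hl : ∀ p ∈ finiteSet f g, ∀ X : Tan p,
      dQ (coord f g) p (rot X) = N p * dQ (coord f g) p X := fun p hp X => by
    rw [hNe p hp]; exact (hlr' ⟨p, hp⟩ X).1
  have hr : ∀ p ∈ finiteSet f g, ∀ X : Tan p,
      dQ (coord f g) p (rot X) = -(dQ (coord f g) p X * R p) := fun p hp X => by
    rw [hRe p hp]; exact (hlr' ⟨p, hp⟩ X).2
  clear_value N R
  have hxe : ∀ p ∈ finiteSet f g, ∀ᶠ q in nhds p, SmAt (coord f g) q := fun p hp =>
    Filter.eventually_of_mem (hopen.mem_nhds hp) hsx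
  have hnear : ∀ p ∈ finiteSet f g, ∀ᶠ q in nhds p,
      q ∈ finiteSet f g ∩ (chartAt ℂ p).source := fun p hp =>
    (hopen.inter (chartAt ℂ p).open_source).mem_nhds ⟨hp, mem_chart_source ℂ p⟩
  have hcv : ∀ p : M, ∀ q ∈ (chartAt ℂ p).source, chartVec (chartAt ℂ p) 1 q ≠ 0 ∧
      chartVec (chartAt ℂ p) Complex.I q = rot (chartVec (chartAt ℂ p) 1 q) := fun p q hq =>
    ⟨chartVec_ne_zero (chart_mem_atlas ℂ p) hq one_ne_zero, by
      rw [← chartVec_I_mul (chart_mem_atlas ℂ p) hq, mul_one]⟩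
  have hsa : ∀ p ∈ finiteSet f g, ∀ v,
      SmAt (fun q => dQ (coord f g) q (chartVec (chartAt ℂ p) v q)) p := fun p hp v =>
    SmAt.dQ_chartVec (chart_mem_atlas ℂ p) (mem_chart_source ℂ p) (hxe p hp) v
  have hane : ∀ p ∈ finiteSet f g, dQ (coord f g) p (chartVec (chartAt ℂ p) 1 p) ≠ 0 :=
    fun p hp => hne p hp _ (hcv p p (mem_chart_source ℂ p)).1
  have hsN : ∀ p ∈ finiteSet f g, SmAt N p := by
    intro p hp
    refine ((hsa p hp Complex.I).mul ((hsa p hp 1).inv (hane p hp))).congr ?_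
    filter_upwards [hnear p hp] with q hq
    rw [eq_mul_inv_iff_mul_eq₀ (hne q hq.1 _ (hcv p q hq.2).1), (hcv p q hq.2).2, hl q hq.1]
  have hsR : ∀ p ∈ finiteSet f g, SmAt R p := by
    intro p hp
    refine (((hsa p hp 1).inv (hane p hp)).mul (hsa p hp Complex.I)).neg.congr ?_
    filter_upwards [hnear p hp] with q hq
    rw [← neg_eq_iff_eq_neg, eq_inv_mul_iff_mul_eq₀ (hne q hq.1 _ (hcv p q hq.2).1),
      (hcv p q hq.2).2, hr q hq.1, mul_neg]
  have hNe : ∀ p ∈ finiteSet f g, ∀ᶠ q in nhds p, SmAt N q := fun p hp =>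
    Filter.eventually_of_mem (hopen.mem_nhds hp) hsN
  have h2 := two_ne_zero_quaternion
  have hNne : ∀ p ∈ finiteSet f g, N p ≠ 0 := by
    intro p hp h0
    have := hN2 p hp
    rw [h0, mul_zero] at this
    exact zero_ne_one (neg_eq_zero.1 this.symm).symm
  -- Passing from `X` to `rot X` multiplies both sides by `N` on the left, so the `H` found for one
  -- direction serves for all.
  have hH : ∀ p ∈ finiteSet f g, ∃ H : ℍ[ℝ], ∀ X : Tan p,
      N p * dQ N p X + dQ N p (rot X) = 2 * (N p * dQ (coord f g) p X * H) := by
    intro p hp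
    obtain ⟨X, hX⟩ := exists_tan_ne_zero p
    have ha : 2 * (N p * dQ (coord f g) p X) ≠ 0 :=
      mul_ne_zero h2 (mul_ne_zero (hNne p hp) (hne p hp X hX))
    refine ⟨(2 * (N p * dQ (coord f g) p X))⁻¹ * (N p * dQ N p X + dQ N p (rot X)), fun Y => ?_⟩
    generalize hHdef : (2 * (N p * dQ (coord f g) p X))⁻¹ *
      (N p * dQ N p X + dQ N p (rot X)) = H
    have h1 : N p * dQ N p X + dQ N p (rot X) = 2 * (N p * dQ (coord f g) p X * H) := by
      rw [← hHdef, ← mul_assoc, mul_inv_cancel_left₀ ha]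
    have h3 : N p * dQ N p (rot X) - dQ N p X = 2 * (N p * (N p * dQ (coord f g) p X) * H) := by
      linear_combination (norm := noncomm_ring) N p * h1 - hN2 p hp * dQ N p X
    obtain ⟨a, b, rfl⟩ := exists_eq_smul_add_smul_rot X Y hX
    simp only [rot_add, rot_smul, dQ_add_vec, dQ_smul_vec, dQ_rot_rot, hl p hp, mul_add, add_mul,
      mul_smul_comm, smul_mul_assoc]
    rw [← h1, ← h3]
    module
  choose! H hH using hH
  have hsH : ∀ p ∈ finiteSet f g, SmAt H p := by
    intro p hp
    have hb := fun v => SmAt.dQ_chartVec (chart_mem_atlas ℂ p) (mem_chart_source ℂ p) (hNe p hp) v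
    refine ((((SmAt.const 2).mul ((hsN p hp).mul (hsa p hp 1))).inv (mul_ne_zero h2
      (mul_ne_zero (hNne p hp) (hane p hp)))).mul
        (((hsN p hp).mul (hb 1)).add (hb Complex.I))).congr ?_
    filter_upwards [hnear p hp] with q hq
    rw [eq_inv_mul_iff_mul_eq₀ (mul_ne_zero h2 (mul_ne_zero (hNne q hq.1)
      (hne q hq.1 _ (hcv p q hq.2).1))), (hcv p q hq.2).2, hH q hq.1, mul_assoc]
  -- `N dN + *dN` anticommutes with `N`, which gives `N dx H N = dx H`. Replacing `N dx` by `-dx R`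
  -- and cancelling `dx` leaves a relation between `H`, `N` and `R`.
  have hHN : ∀ p ∈ finiteSet f g, H p * N p = R p * H p := by
    intro p hp
    obtain ⟨X, hX⟩ := exists_tan_ne_zero p
    have ha := hne p hp X hX
    have hdN : ∀ Y : Tan p, dQ N p Y * N p = -(N p * dQ N p Y) := fun Y =>
      self_mul_dQ (hsN p hp) (Filter.eventually_of_mem (hopen.mem_nhds hp) hN2) Y
    have e1 := hH p hp X
    have e2 : N p * dQ (coord f g) p X = -(dQ (coord f g) p X * R p) := by
      rw [← hl p hp, hr p hp]
    have e3 : (N p * dQ N p X + dQ N p (rot X)) * N p =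
        -(N p * (N p * dQ N p X + dQ N p (rot X))) := by
      linear_combination (norm := noncomm_ring) N p * hdN X + hdN (rot X)
    rw [e1] at e3
    have e4 : N p * dQ (coord f g) p X * H p * N p = dQ (coord f g) p X * H p := by
      refine mul_left_cancel₀ h2 ?_
      linear_combination (norm := noncomm_ring) e3 - 2 * hN2 p hp * dQ (coord f g) p X * H p
    rw [e2] at e4
    have e5 : -(R p * H p * N p) = H p := by
      refine mul_left_cancel₀ ha ?_
      linear_combination (norm := noncomm_ring) e4
    linear_combination (norm := noncomm_ring) R p * e5 + hR2 p hp * H p * N p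
  refine ⟨N, R, H, hopen, hsx, hsN, hsR, hsH, hN2, hR2, hHN, hl, hr, hne, fun p hp X => ?_⟩
  by_cases hX : X = 0
  · have h0 : ∀ F : M → ℍ[ℝ], dQ F p (0 : Tan p) = 0 := fun F => map_zero _
    have h1 : rot (0 : Tan p) = 0 := mul_zero Complex.I
    rw [hX, h1]
    simp [h0]
  have hL := laplacian_identity hopen hsx hsN hsR hl hr hp X
  have hdN : ∀ Y : Tan p, dQ N p Y * N p = -(N p * dQ N p Y) := fun Y =>
    self_mul_dQ (hsN p hp) (Filter.eventually_of_mem (hopen.mem_nhds hp) hN2) Y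
  refine mul_left_cancel₀ (hne p hp X hX) ?_
  have e1 : dQ N p X * dQ (coord f g) p (rot X) = -(N p * dQ N p X) * dQ (coord f g) p X := by
    rw [hl p hp, ← mul_assoc, hdN]
  have e2 : dQ (coord f g) p (rot X) * dQ R p X =
      -(dQ (coord f g) p X * (R p * dQ R p X)) := by
    rw [hr p hp, neg_mul, mul_assoc]
  have e3 := hH p hp X
  have e4 : N p * dQ (coord f g) p X = -(dQ (coord f g) p X * R p) := by
    rw [← hl p hp, hr p hp]
  rw [e4] at e3
  rw [hl p hp X] at *
  rw [← mul_assoc (H p), hHN p hp]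
  linear_combination (norm := noncomm_ring) e1 - hL + e2 - e3 * dQ (coord f g) p X

/-- Every conformal immersion has a mean curvature sphere congruence. -/
theorem exists_meanCurvatureSphere (hf : IsConformalImmersion f) :
    ∃ S : M → Mat, IsMeanCurvatureSphere f S := by
  obtain ⟨N₁, R₁, H₁, h₁⟩ := exists_frame hf 1
  obtain ⟨N₂, R₂, H₂, h₂⟩ := exists_frame hf swapUnit
  have m₁ := mcsOn_sphereOf hf le_rfl h₁
  have m₂ := mcsOn_sphereOf hf le_rfl h₂
  classical
  set S : M → Mat := fun p => if p ∈ finiteSet f 1 then sphereOf f 1 N₁ R₁ H₁ p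
    else sphereOf f swapUnit N₂ R₂ H₂ p with hS
  have k₁ : MCSOn f S (finiteSet f 1) :=
    m₁.congr h₁.isOpen fun p hp => if_pos hp
  have k₂ : MCSOn f S (finiteSet f swapUnit) := by
    refine m₂.congr h₂.isOpen fun p hp => ?_
    by_cases h : p ∈ finiteSet f 1
    · rw [hS]
      simp only [if_pos h]
      exact MCSOn.unique hf (h₁.isOpen.inter h₂.isOpen) (m₁.mono Set.inter_subset_left)
        (m₂.mono Set.inter_subset_right) ⟨h, hp⟩
    · exact if_neg h
  refine ⟨S, mcsOn_univ_iff.1 ⟨fun p _ => ?_, fun p _ => ?_, fun p _ => ?_, fun p _ => ?_,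
    fun p _ => ?_, fun p _ => ?_⟩⟩
  · exact (mem_finiteSet_one_or_swap f p).elim (k₁.smooth p) (k₂.smooth p)
  · exact (mem_finiteSet_one_or_swap f p).elim (k₁.sq p) (k₂.sq p)
  · exact (mem_finiteSet_one_or_swap f p).elim (k₁.maps p) (k₂.maps p)
  · exact (mem_finiteSet_one_or_swap f p).elim (k₁.left p) (k₂.left p)
  · exact (mem_finiteSet_one_or_swap f p).elim (k₁.right p) (k₂.right p)
  · exact (mem_finiteSet_one_or_swap f p).elim (k₁.hopf p) (k₂.hopf p)

end Existence

end QSurf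

/-! ### The form `2*A + η`, its kernel, smoothness and closedness. -/

namespace QSurf

variable {M : Type*} [TopologicalSpace M] [ChartedSpace ℂ M]

theorem hopfA_add (S : M → Mat) {p : M} (X Y : Tan p) :
    hopfA S p (X + Y) = hopfA S p X + hopfA S p Y := by
  simp only [hopfA, rot_add, dMat_add_vec, mul_add, ← smul_add]
  congr 1
  abel

theorem hopfA_smul (S : M → Mat) {p : M} (r : ℝ) (X : Tan p) :
    hopfA S p (r • X) = r • hopfA S p X := by
  simp only [hopfA, rot_smul, dMat_smul_vec, mul_smul_comm, ← smul_add]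
  rw [smul_comm]

/-- The form `2*A + η`. -/
def totalForm (S : M → Mat) (η : Form M) (p : M) (X : Tan p) : Mat :=
  (2 : ℝ) • hopfA S p (rot X) + η p X

theorem acirc_rot (S : M → Mat) (η : Form M) {p : M} (X : Tan p) :
    Acirc S η p (rot X) = (1 / 2 : ℝ) • totalForm S η p X := by
  rw [Acirc, totalForm, rot_rot, map_neg, smul_add, smul_smul]
  norm_num

theorem acirc_eq (S : M → Mat) (η : Form M) {p : M} (X : Tan p) :
    Acirc S η p X = (1 / 2 : ℝ) • totalForm S η p (-rot X) := by
  rw [← acirc_rot]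
  congr 1
  rw [← neg_one_smul ℝ (rot X), rot_smul, rot_rot, neg_one_smul, neg_neg]

/-- A nonzero matrix killing a vector of `ℓ` has kernel exactly `ℓ`, and zeros of `A_∘` impose
nothing. The condition becomes linear, holds at all points, and can be extended by continuity from a
dense set. -/
theorem kernelIsConstant_iff {g : Matˣ} {ℓ : HP1} (hℓ : ToInfinity g ℓ) {S : M → Mat}
    {η : Form M} : KernelIsConstant S η ℓ ↔
      ∀ (p : M) (X : Tan p), totalForm S η p X *ᵥ (((g⁻¹ : Matˣ) : Mat) *ᵥ ![1, 0]) = 0 := by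
  constructor
  · intro h p X
    by_cases h0 : ∃ X : Tan p, Acirc S η p X ≠ 0
    · have h1 : (((g⁻¹ : Matˣ) : Mat) *ᵥ ![1, 0] : V) ∈ ℓ.submodule := by
        rw [mem_iff_infinity hℓ, mulVec_inv_mulVec]; rfl
      have h2 := ((h p h0) _).1 h1 (rot X)
      rw [acirc_rot, Matrix.smul_mulVec] at h2
      exact (smul_eq_zero_iff_right (by norm_num)).1 h2
    · push Not at h0
      have h2 := h0 (rot X)
      rw [acirc_rot] at h2
      rw [(smul_eq_zero_iff_right (by norm_num)).1 h2, Matrix.zero_mulVec]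
  · intro h p h0 v
    have hA : ∀ X : Tan p, Acirc S η p X *ᵥ (((g⁻¹ : Matˣ) : Mat) *ᵥ ![1, 0]) = 0 := by
      intro X
      rw [acirc_eq, Matrix.smul_mulVec, h, smul_zero]
    rw [mem_iff_infinity hℓ]
    constructor
    · intro hv X
      have h1 : v = vmul (((g⁻¹ : Matˣ) : Mat) *ᵥ ![1, 0]) (((g : Mat) *ᵥ v) 0) := by
        refine mulVec_injective g ?_
        rw [mulVec_vmul, mulVec_inv_mulVec]
        exact vec_ext (one_mul _).symm (hv.trans (zero_mul _).symm)
      rw [h1, mulVec_vmul, hA]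
      funext i
      exact zero_mul _
    · intro hv
      -- If `v ∉ ℓ`, then `v` together with the vector that `g` maps to `(1, 0)` is a basis of `ℍ²`
      -- killed by `A_∘`.
      by_contra hne
      obtain ⟨X, hX⟩ := h0
      apply hX
      have h1 := hA X
      have h2 := hv X
      rw [← inv_mulVec_mulVec g v] at h2
      rw [Matrix.mulVec_mulVec] at h1 h2
      have hB : Acirc S η p X * ((g⁻¹ : Matˣ) : Mat) = 0 := by
        generalize Acirc S η p X * ((g⁻¹ : Matˣ) : Mat) = B at h1 h2
        have a0 := congrFun h1 0
        have a1 := congrFun h1 1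
        have b0 := congrFun h2 0
        have b1 := congrFun h2 1
        rw [mulVec_zero_entry] at a0 b0
        rw [mulVec_one_entry] at a1 b1
        simp only [Matrix.cons_val_zero, Matrix.cons_val_one, mul_one, mul_zero, add_zero,
          Pi.zero_apply] at a0 a1
        rw [a0, zero_mul, zero_add] at b0
        rw [a1, zero_mul, zero_add] at b1
        exact mat_ext a0 ((mul_eq_zero.1 b0).resolve_right hne) a1
          ((mul_eq_zero.1 b1).resolve_right hne)
      calc Acirc S η p X = Acirc S η p X * ((g⁻¹ : Matˣ) : Mat) * (g : Mat) := by
            rw [mul_assoc, Units.inv_mul, mul_one]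
        _ = 0 := by rw [hB, zero_mul]

variable [IsManifold 𝓘(ℂ, ℂ) ω M]

/-- The coefficient of a form along a coordinate vector field. -/
def along (τ : (p : M) → Tan p → Mat) (e : OpenPartialHomeomorph M ℂ) (v : ℂ) (q : M) : Mat :=
  τ q (chartVec e v q)

theorem smoothForm_iff {τ : (p : M) → Tan p → Mat} : SmoothForm τ ↔
    ∀ e ∈ atlas ℂ M, ∀ v, ∀ q ∈ e.source, SmMatAt (along τ e v) q := by
  have key : ∀ (e : OpenPartialHomeomorph M ℂ) (v : ℂ) (i j : Fin 2), ∀ z ∈ e.target,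
      (fun z => inChart e τ v z i j) =ᶠ[nhds z] fun z => along τ e v (e.symm z) i j :=
    fun e v i j z hz => Filter.eventually_of_mem (e.open_target.mem_nhds hz)
      fun w hw => by simp only [inChart_eq e τ v hw, along]
  constructor
  · intro h e he v q hq i j
    refine SmAt.of_comp_symm he hq ?_
    exact ((h e he v i j).contDiffAt (e.open_target.mem_nhds (e.map_source hq))).congr_of_eventuallyEq
      (key e v i j _ (e.map_source hq)).symm
  · intro h e he v i j z hz
    exact ((SmAt.comp_symm he hz (h e he v _ (e.map_target hz) i j)).congr_of_eventuallyEq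
      (key e v i j z hz)).contDiffWithinAt

theorem closedForm_iff {τ : (p : M) → Tan p → Mat} (hτ : SmoothForm τ) : ClosedForm τ ↔
    ∀ e ∈ atlas ℂ M, ∀ q ∈ e.source, dMat (along τ e Complex.I) q (chartVec e 1 q) =
      dMat (along τ e 1) q (chartVec e Complex.I q) := by
  rw [smoothForm_iff] at hτ
  have key : ∀ e ∈ atlas ℂ M, ∀ (v w : ℂ) (i j : Fin 2), ∀ z ∈ e.target,
      fderiv ℝ (fun z => inChart e τ v z i j) z w =
        dMat (along τ e v) (e.symm z) (chartVec e w (e.symm z)) i j := by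
    intro e he v w i j z hz
    have h1 : (fun z => inChart e τ v z i j) =ᶠ[nhds z] fun z => along τ e v (e.symm z) i j :=
      Filter.eventually_of_mem (e.open_target.mem_nhds hz)
        fun w hw => by simp only [inChart_eq e τ v hw, along]
    rw [h1.fderiv_eq]
    exact (dQ_chartVec he hz (hτ e he v _ (e.map_target hz) i j) w).symm
  constructor
  · intro h e he q hq
    ext1 i j
    have h1 := h e he (e q) (e.map_source hq) i j
    rwa [key e he _ _ i j _ (e.map_source hq), key e he _ _ i j _ (e.map_source hq),
      e.left_inv hq] at h1
  · intro h e he z hz i j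
    rw [key e he _ _ i j z hz, key e he _ _ i j z hz, h e he _ (e.map_target hz)]

theorem smMatAt_along_hopfA {S : M → Mat} (hS : SmoothMat S) {e : OpenPartialHomeomorph M ℂ}
    (he : e ∈ atlas ℂ M) (v : ℂ) {q : M} (hq : q ∈ e.source) :
    SmMatAt (along (fun p X => (2 : ℝ) • hopfA S p (rot X)) e v) q := by
  rw [smoothMat_iff] at hS
  have hd : ∀ w, SmMatAt (fun x => dMat S x (chartVec e w x)) q := fun w i j =>
    SmAt.dQ_chartVec he hq (Filter.Eventually.of_forall fun x => hS x i j) w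
  have h1 := (hS q).mul (hd (Complex.I * v))
  intro i j
  refine ((((h1 i j).sub (hd v i j)).smul (1 / 4)).smul 2).congr ?_
  filter_upwards [e.open_source.mem_nhds hq] with x hx
  rw [along, hopfA, dMat_rot_rot, ← chartVec_I_mul he hx, ← sub_eq_add_neg]
  rfl

theorem smoothForm_totalForm {S : M → Mat} (hS : SmoothMat S) {η : Form M}
    (hη : SmoothForm fun p X => η p X) : SmoothForm (totalForm S η) := by
  rw [smoothForm_iff] at hη ⊢
  intro e he v q hq i j
  exact (smMatAt_along_hopfA hS he v hq i j).add (hη e he v q hq i j)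

/-- The form with matrix `((0, x b), (0, b))`, `b = dR - H dx`, in the frame `g`. -/
def kernelForm (g : Matˣ) (x R H : M → ℍ[ℝ]) (p : M) (X : Tan p) : Mat :=
  ((g⁻¹ : Matˣ) : Mat) * !![0, x p * (dQ R p X - H p * dQ x p X); 0, dQ R p X - H p * dQ x p X] *
    (g : Mat)

/-! ### The only candidate for `2*A + η` with kernel `g⁻¹ ∞`. -/

section KernelForm

variable {g : Matˣ} {U : Set M} {x N R H : M → ℍ[ℝ]} {p : M}

/-- Split `dR` into the parts satisfying `*τ = R τ` and `*τ = -R τ`. By `hopf` the first part is `H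
dx`, so `b = dR - H dx` is the second. -/
theorem Frame.b_rot (hF : Frame U x N R H) (hp : p ∈ U) (X : Tan p) :
    dQ R p (rot X) - H p * dQ x p (rot X) = -(R p * (dQ R p X - H p * dQ x p X)) := by
  linear_combination (norm := noncomm_ring) hF.hopf p hp X + H p * hF.left p hp X +
    hF.H_mul_N p hp * dQ x p X

theorem Frame.smAt_b (hF : Frame U x N R H) {e : OpenPartialHomeomorph M ℂ} (he : e ∈ atlas ℂ M)
    (hp : p ∈ U) (hpe : p ∈ e.source) (v : ℂ) :
    SmAt (fun q => dQ R q (chartVec e v q) - H q * dQ x q (chartVec e v q)) p := by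
  have h : ∀ {F : M → ℍ[ℝ]}, (∀ q ∈ U, SmAt F q) → ∀ᶠ q in nhds p, SmAt F q := fun h =>
    Filter.eventually_of_mem (hF.isOpen.mem_nhds hp) h
  exact (SmAt.dQ_chartVec he hpe (h hF.smR) v).sub
    ((hF.smH p hp).mul (SmAt.dQ_chartVec he hpe (h hF.smx) v))

/-- This is `db = -dH ∧ dx` in coordinates; the second derivatives of `R` and `x` cancel by
symmetry. -/
theorem Frame.dQ_b (hF : Frame U x N R H) {e : OpenPartialHomeomorph M ℂ} (he : e ∈ atlas ℂ M)
    (hp : p ∈ U) (hpe : p ∈ e.source) :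
    dQ (fun q => dQ R q (chartVec e Complex.I q) - H q * dQ x q (chartVec e Complex.I q)) p
        (chartVec e 1 p) -
      dQ (fun q => dQ R q (chartVec e 1 q) - H q * dQ x q (chartVec e 1 q)) p
        (chartVec e Complex.I p) =
    dQ H p (chartVec e Complex.I p) * dQ x p (chartVec e 1 p) -
      dQ H p (chartVec e 1 p) * dQ x p (chartVec e Complex.I p) := by
  have h : ∀ {F : M → ℍ[ℝ]}, (∀ q ∈ U, SmAt F q) → ∀ᶠ q in nhds p, SmAt F q := fun h =>
    Filter.eventually_of_mem (hF.isOpen.mem_nhds hp) h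
  have hR := SmAt.dQ_chartVec he hpe (h hF.smR)
  have hx := SmAt.dQ_chartVec he hpe (h hF.smx)
  rw [dQ_sub (hR _) ((hF.smH p hp).mul (hx _)), dQ_sub (hR _) ((hF.smH p hp).mul (hx _)),
    dQ_mul (hF.smH p hp) (hx _), dQ_mul (hF.smH p hp) (hx _),
    dQ_dQ_chartVec_comm he hpe (h hF.smR) Complex.I 1,
    dQ_dQ_chartVec_comm he hpe (h hF.smx) Complex.I 1]
  noncomm_ring

theorem chartVec_I {e : OpenPartialHomeomorph M ℂ} (he : e ∈ atlas ℂ M) (hp : p ∈ e.source) :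
    chartVec e Complex.I p = rot (chartVec e 1 p) := by
  rw [← chartVec_I_mul he hp, mul_one]

theorem Frame.smMatAt_kernelForm (hF : Frame U x N R H) {e : OpenPartialHomeomorph M ℂ}
    (he : e ∈ atlas ℂ M) (hp : p ∈ U) (hpe : p ∈ e.source) (v : ℂ) :
    SmMatAt (fun q => (!![0, x q * (dQ R q (chartVec e v q) - H q * dQ x q (chartVec e v q)); 0,
      dQ R q (chartVec e v q) - H q * dQ x q (chartVec e v q)] : Mat)) p := by
  have hb := hF.smAt_b he hp hpe v
  intro i j
  fin_cases i <;> fin_cases j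
  · exact SmAt.const 0
  · exact (hF.smx p hp).mul hb
  · exact SmAt.const 0
  · exact hb

/-- The form is closed where `dH ∧ dx = 0`. -/
theorem Frame.kernelForm_closed (hF : Frame U x N R H)
    (hH : ∀ p ∈ U, ∀ X : Tan p, dQ H p X * dQ x p (rot X) = dQ H p (rot X) * dQ x p X)
    {e : OpenPartialHomeomorph M ℂ} (he : e ∈ atlas ℂ M) (hp : p ∈ U) (hpe : p ∈ e.source) :
    dMat (along (kernelForm g x R H) e Complex.I) p (chartVec e 1 p) =
      dMat (along (kernelForm g x R H) e 1) p (chartVec e Complex.I p) := by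
  have hb := hF.dQ_b he hp hpe
  rw [chartVec_I he hpe, ← hH p hp, sub_self, sub_eq_zero, ← chartVec_I he hpe] at hb
  have hs := fun v => hF.smMatAt_kernelForm he hp hpe v
  have hdb := fun v => hF.smAt_b he hp hpe v
  have hd : ∀ v X, dMat (along (kernelForm g x R H) e v) p X = ((g⁻¹ : Matˣ) : Mat) *
      dMat (fun q => (!![0, x q * (dQ R q (chartVec e v q) - H q * dQ x q (chartVec e v q)); 0,
        dQ R q (chartVec e v q) - H q * dQ x q (chartVec e v q)] : Mat)) p X * (g : Mat) := by
    intro v X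
    have h := dMat_mul_const (g : Mat) ((SmMatAt.const ((g⁻¹ : Matˣ) : Mat)).mul (hs v)) X
    rw [dMat_const_mul _ (hs v)] at h
    exact h
  rw [hd, hd]
  congr 2
  have h0 : ∀ Y Z : Tan p, dQ (fun _ : M => (0 : ℍ[ℝ])) p Y = dQ (fun _ : M => 0) p Z :=
    fun Y Z => (dQ_const 0 Y).trans (dQ_const 0 Z).symm
  refine mat_ext (h0 _ _) ?_ (h0 _ _) hb
  change dQ (fun q => x q * _) p _ = dQ (fun q => x q * _) p _
  -- `d(x b) = dx ∧ b + x db`, and `dx ∧ b = 0` because `*dx = -dx R` and `*b = -R b`.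
  rw [dQ_mul (hF.smx p hp) (hdb _), dQ_mul (hF.smx p hp) (hdb _), hb, chartVec_I he hpe,
    hF.b_rot hp, hF.right p hp]
  noncomm_ring

theorem kernelForm_mulVec (g : Matˣ) (x R H : M → ℍ[ℝ]) (X : Tan p) (v : V) :
    (g : Mat) *ᵥ (kernelForm g x R H p X *ᵥ v) =
      vmul ![x p, 1] ((dQ R p X - H p * dQ x p X) * ((g : Mat) *ᵥ v) 1) := by
  rw [kernelForm, mul_assoc, ← Matrix.mulVec_mulVec, mulVec_inv_mulVec, ← Matrix.mulVec_mulVec]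
  refine vec_ext ?_ ?_
  · rw [mulVec_zero_entry]; simp [mul_assoc]
  · rw [mulVec_one_entry]; simp

/-- The vectors `(1, 0)` and `(x, 1)` are a basis of `ℍ²`, so a matrix is determined by its values
on them. -/
theorem eq_kernelForm {B : Mat} {X : Tan p} (h1 : B *ᵥ (((g⁻¹ : Matˣ) : Mat) *ᵥ ![1, 0]) = 0)
    (h2 : (g : Mat) *ᵥ (B *ᵥ (((g⁻¹ : Matˣ) : Mat) *ᵥ ![x p, 1])) =
      vmul ![x p, 1] (dQ R p X - H p * dQ x p X)) : B = kernelForm g x R H p X := by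
  have hC : (g : Mat) * B * ((g⁻¹ : Matˣ) : Mat) =
      !![0, x p * (dQ R p X - H p * dQ x p X); 0, dQ R p X - H p * dQ x p X] := by
    have a := congrArg (fun v => (g : Mat) *ᵥ v) h1
    simp only [Matrix.mulVec_mulVec, Matrix.mulVec_zero, ← mul_assoc] at a h2
    generalize (g : Mat) * B * ((g⁻¹ : Matˣ) : Mat) = C at a h2
    have a0 := congrFun a 0
    have a1 := congrFun a 1
    have b0 := congrFun h2 0
    have b1 := congrFun h2 1
    rw [mulVec_zero_entry] at a0 b0
    rw [mulVec_one_entry] at a1 b1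
    simp only [Matrix.cons_val_zero, Matrix.cons_val_one, mul_one, mul_zero, add_zero,
      Pi.zero_apply, vmul_apply, one_mul] at a0 a1 b0 b1
    rw [a0, zero_mul, zero_add] at b0
    rw [a1, zero_mul, zero_add] at b1
    exact mat_ext a0 b0 a1 b1
  calc B = ((g⁻¹ : Matˣ) : Mat) * ((g : Mat) * B * ((g⁻¹ : Matˣ) : Mat)) * (g : Mat) := by
        rw [mul_assoc _ _ (g : Mat), mul_assoc _ _ (g : Mat), Units.inv_mul, mul_one, ← mul_assoc,
          Units.inv_mul, one_mul]
    _ = _ := by rw [hC]; rfl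

end KernelForm

/-! ### Lagrange multipliers and the equation `dH ∧ dx = 0`. -/

section Multiplier

variable {f : M → HP1} {g : Matˣ} {S : M → Mat} {p : M}

theorem IsMeanCurvatureSphere.frame (hf : IsConformalImmersion f) (hS : IsMeanCurvatureSphere f S)
    (g : Matˣ) :
    Frame (finiteSet f g) (coord f g) (normalN f g S) (normalR f g S) (meanH g S) := by
  have h := frame_of_mcsOn (g := g) hf isOpen_univ (mcsOn_univ_iff.2 hS)
  rwa [Set.univ_inter] at h

theorem IsMeanCurvatureSphere.conjMat_eq (hS : IsMeanCurvatureSphere f S)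
    (hp : p ∈ finiteSet f g) : conjMat g S p =
      frameMat (coord f g p) (normalN f g S p) (normalR f g S p) (meanH g S p) :=
  conjMat_eq_frameMat (mcsOn_univ_iff.2 hS) ⟨trivial, hp⟩

theorem IsMeanCurvatureSphere.conjMat_eventuallyEq (hf : IsConformalImmersion f)
    (hS : IsMeanCurvatureSphere f S) (hp : p ∈ finiteSet f g) :
    conjMat g S =ᶠ[nhds p] fun q => frameMat (coord f g q) (normalN f g S q)
      (normalR f g S q) (meanH g S q) :=
  Filter.eventually_of_mem ((isOpen_finiteSet hf).mem_nhds hp) fun _ hq => hS.conjMat_eq hq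

theorem hopfA_conj (hS : SmMatAt S p) (X : Tan p) (v : V) :
    (g : Mat) *ᵥ (hopfA S p X *ᵥ v) = (1 / 4 : ℝ) • (conjMat g S p *ᵥ
      (dMat (conjMat g S) p X *ᵥ ((g : Mat) *ᵥ v)) +
        dMat (conjMat g S) p (rot X) *ᵥ ((g : Mat) *ᵥ v)) := by
  have h : ∀ Y : Tan p, dMat (conjMat g S) p Y *ᵥ ((g : Mat) *ᵥ v) =
      (g : Mat) *ᵥ (dMat S p Y *ᵥ v) := by
    intro Y
    rw [dMat_conjMat hS, Matrix.mulVec_mulVec, Matrix.mulVec_mulVec, mul_assoc, Units.inv_mul,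
      mul_one]
  rw [h, h, conjMat_mulVec, hopfA, Matrix.smul_mulVec, Matrix.add_mulVec, ← Matrix.mulVec_mulVec,
    Matrix.mulVec_smul, Matrix.mulVec_add]

theorem IsMeanCurvatureSphere.dMat_mulVec (hf : IsConformalImmersion f)
    (hS : IsMeanCurvatureSphere f S) (hp : p ∈ finiteSet f g) (X : Tan p) :
    dMat (conjMat g S) p X *ᵥ ![coord f g p, 1] = vmul ![coord f g p, 1]
      (meanH g S p * dQ (coord f g) p X - dQ (normalR f g S) p X) := by
  have hF := hS.frame hf g
  rw [dMat_congr (hS.conjMat_eventuallyEq hf hp)]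
  exact dMat_frameMat_mulVec (hF.smx p hp) (hF.smN p hp) (hF.smR p hp) (hF.smH p hp)
    (hF.N_mul_dx hp X)

/-- The restriction of `2*A` to `L`. -/
theorem hopfA_mulVec_psi (hf : IsConformalImmersion f) (hS : IsMeanCurvatureSphere f S)
    (hp : p ∈ finiteSet f g) (X : Tan p) :
    (g : Mat) *ᵥ (((2 : ℝ) • hopfA S p (rot X)) *ᵥ
      (((g⁻¹ : Matˣ) : Mat) *ᵥ ![coord f g p, 1])) =
        vmul ![coord f g p, 1] (dQ (normalR f g S) p X - meanH g S p * dQ (coord f g) p X) := by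
  have hF := hS.frame hf g
  rw [Matrix.smul_mulVec, Matrix.mulVec_smul, hopfA_conj (smoothMat_iff.1 hS.smooth p),
    mulVec_inv_mulVec, dMat_rot_rot, Matrix.neg_mulVec, hS.dMat_mulVec hf hp,
    hS.dMat_mulVec hf hp, mulVec_vmul, hS.conjMat_eq hp, frameMat_mulVec, smul_smul]
  have h1 := hF.b_rot hp X
  have h2 : meanH g S p * dQ (coord f g) p (rot X) - dQ (normalR f g S) p (rot X) =
      normalR f g S p * (dQ (normalR f g S) p X - meanH g S p * dQ (coord f g) p X) := by
    rw [← neg_sub, h1, neg_neg]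
  have h3 := hF.R_sq p hp
  rw [h2]
  have h4 : ∀ a b c : ℍ[ℝ], a * a = -1 →
      vmul (vmul ![coord f g p, 1] (-a)) (a * (b - c)) + -vmul ![coord f g p, 1] (c - b) =
        (2 : ℝ) • vmul ![coord f g p, 1] (b - c) := by
    intro a b c ha
    funext i
    simp only [Pi.add_apply, Pi.neg_apply, vmul_apply, Pi.smul_apply, two_smul]
    linear_combination (norm := noncomm_ring)
      -((![coord f g p, 1] : V) i * ha * (b - c))
  rw [h4 _ _ _ h3, smul_smul]
  norm_num

theorem totalForm_mulVec_psi (hf : IsConformalImmersion f) (hS : IsMeanCurvatureSphere f S)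
    {η : Form M} (hη : ∀ (p : M) (X : Tan p), ∀ v ∈ (f p).submodule, η p X *ᵥ v = 0)
    (hp : p ∈ finiteSet f g) (X : Tan p) :
    (g : Mat) *ᵥ (totalForm S η p X *ᵥ (((g⁻¹ : Matˣ) : Mat) *ᵥ ![coord f g p, 1])) =
        vmul ![coord f g p, 1] (dQ (normalR f g S) p X - meanH g S p * dQ (coord f g) p X) := by
  rw [totalForm, Matrix.add_mulVec, hη p X _ (psi_mem hp), add_zero, hopfA_mulVec_psi hf hS hp]

/-- On `L` the multiplier does not contribute; on the kernel line the total form vanishes. Hence the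
form depends on the immersion and the kernel alone. -/
theorem totalForm_eq_kernelForm (hf : IsConformalImmersion f) (hS : IsMeanCurvatureSphere f S)
    {η : Form M} (hη : ∀ (p : M) (X : Tan p), ∀ v ∈ (f p).submodule, η p X *ᵥ v = 0)
    (hp : p ∈ finiteSet f g) {X : Tan p}
    (hk : totalForm S η p X *ᵥ (((g⁻¹ : Matˣ) : Mat) *ᵥ ![1, 0]) = 0) :
    totalForm S η p X = kernelForm g (coord f g) (normalR f g S) (meanH g S) p X :=
  eq_kernelForm hk (totalForm_mulVec_psi hf hS hη hp X)

/-- If the kernel of `A_∘` is constantly equal to `g⁻¹ ∞`, then `dH ∧ dx = 0`. -/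
theorem dH_wedge_dx_of_multiplier (hf : IsConformalImmersion f) (hS : IsMeanCurvatureSphere f S)
    {η : Form M} (hη : IsLagrangeMultiplier f S η)
    (hk : ∀ (p : M) (X : Tan p), totalForm S η p X *ᵥ (((g⁻¹ : Matˣ) : Mat) *ᵥ ![1, 0]) = 0)
    (hp : p ∈ finiteSet f g) (X : Tan p) :
    dQ (meanH g S) p X * dQ (coord f g) p (rot X) =
      dQ (meanH g S) p (rot X) * dQ (coord f g) p X := by
  have hF := hS.frame hf g
  have hsm := smoothForm_totalForm hS.smooth hη.smooth
  have he := chart_mem_atlas ℂ p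
  have hpe := mem_chart_source ℂ p
  set e := chartAt ℂ p
  have hcl := (closedForm_iff hsm).1 hη.closed e he p hpe
  rw [smoothForm_iff] at hsm
  -- The `(1, 1)` entry of the total form in the frame `g` is `b`, so closedness gives `db = 0`.
  have key : ∀ v : ℂ, (fun q => dQ (normalR f g S) q (chartVec e v q) -
      meanH g S q * dQ (coord f g) q (chartVec e v q)) =ᶠ[nhds p]
        fun q => ((g : Mat) * along (totalForm S η) e v q * ((g⁻¹ : Matˣ) : Mat)) 1 1 := by
    intro v
    filter_upwards [hF.isOpen.mem_nhds hp] with q hq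
    rw [along, totalForm_eq_kernelForm hf hS hη.le_ker hq (hk q _), kernelForm, ← mul_assoc,
      ← mul_assoc, Units.mul_inv, one_mul, mul_assoc, Units.mul_inv, mul_one]
    rfl
  have hd : ∀ v Y, dQ (fun q => ((g : Mat) * along (totalForm S η) e v q *
      ((g⁻¹ : Matˣ) : Mat)) 1 1) p Y =
        ((g : Mat) * dMat (along (totalForm S η) e v) p Y * ((g⁻¹ : Matˣ) : Mat)) 1 1 := by
    intro v Y
    have h := dMat_mul_const ((g⁻¹ : Matˣ) : Mat)
      ((SmMatAt.const (g : Mat)).mul (hsm e he v p hpe)) Y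
    rw [dMat_const_mul _ (hsm e he v p hpe)] at h
    rw [← h]
    rfl
  have hb := hF.dQ_b he hp hpe
  rw [dQ_congr (key Complex.I), dQ_congr (key 1), hd, hd] at hb
  change dMat (along (totalForm S η) e Complex.I) p _ =
    dMat (along (totalForm S η) e 1) p _ at hcl
  rw [hcl, sub_self] at hb
  have hX1 : chartVec e 1 p ≠ 0 := chartVec_ne_zero he hpe one_ne_zero
  have hw : dQ (meanH g S) p (chartVec e 1 p) * dQ (coord f g) p (rot (chartVec e 1 p)) =
      dQ (meanH g S) p (rot (chartVec e 1 p)) * dQ (coord f g) p (chartVec e 1 p) := by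
    rw [chartVec_I he hpe] at hb
    exact (sub_eq_zero.1 hb.symm).symm
  obtain ⟨a, b, rfl⟩ := exists_eq_smul_add_smul_rot (chartVec e 1 p) X hX1
  simp only [rot_add, rot_smul, dQ_add_vec, dQ_smul_vec, dQ_rot_rot, add_mul, mul_add,
    smul_mul_assoc, mul_smul_comm, hw, mul_neg, neg_mul]
  module

/-- `A` takes values in `L`: the component of `S ∇S + *∇S` in `V/L` is governed by `N dN + *dN - 2 N
dx H`, which vanishes by `hopf_left`. This is needed for the difference of `kernelForm` and `2*A` to
be an admissible multiplier. -/
theorem theta_hopfA (hf : IsConformalImmersion f) (hS : IsMeanCurvatureSphere f S)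
    (hp : p ∈ finiteSet f g) (X : Tan p) (v : V) : theta f g p (hopfA S p X *ᵥ v) = 0 := by
  have hF := hS.frame hf g
  have hd := fun Y => dMat_frameMat (hF.smx p hp) (hF.smN p hp) (hF.smR p hp) (hF.smH p hp) Y
  have hrow : ∀ (Y : Tan p) (w : V), (dMat (conjMat g S) p Y *ᵥ w) 0 -
      coord f g p * (dMat (conjMat g S) p Y *ᵥ w) 1 =
        (dQ (normalN f g S) p Y - dQ (coord f g) p Y * meanH g S p) *
          (w 0 - coord f g p * w 1) := by
    intro Y w
    rw [dMat_congr (hS.conjMat_eventuallyEq hf hp), hd, mulVec_zero_entry, mulVec_one_entry]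
    have h := hF.N_mul_dx hp Y
    simp
    linear_combination (norm := noncomm_ring) -h * w 1
  have hrow' : ∀ w : V, (conjMat g S p *ᵥ w) 0 - coord f g p * (conjMat g S p *ᵥ w) 1 =
      normalN f g S p * (w 0 - coord f g p * w 1) := by
    intro w
    rw [hS.conjMat_eq hp, mulVec_zero_entry, mulVec_one_entry]
    simp [frameMat]
    noncomm_ring
  rw [theta, hopfA_conj (smoothMat_iff.1 hS.smooth p)]
  simp only [Pi.smul_apply, Pi.add_apply, mul_smul_comm, ← smul_sub]
  rw [smul_eq_zero_iff_right (by norm_num)]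
  set w := (g : Mat) *ᵥ v
  have h1 := hrow' (dMat (conjMat g S) p X *ᵥ w)
  have h2 := hrow X w
  have h3 := hrow (rot X) w
  have h4 := hF.hopf_left hp X
  have h5 := hF.left p hp X
  linear_combination (norm := noncomm_ring) h1 + normalN f g S p * h2 + h3 +
    h4 * (w 0 - coord f g p * w 1) - h5 * meanH g S p * (w 0 - coord f g p * w 1)

theorem kernelForm_add (x R H : M → ℍ[ℝ]) (X Y : Tan p) : kernelForm g x R H p (X + Y) =
    kernelForm g x R H p X + kernelForm g x R H p Y := by
  rw [kernelForm, kernelForm, kernelForm, ← add_mul, ← mul_add]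
  congr 2
  refine mat_ext ?_ ?_ ?_ ?_ <;> simp [dQ_add_vec] <;> noncomm_ring

theorem kernelForm_smul (x R H : M → ℍ[ℝ]) (r : ℝ) (X : Tan p) : kernelForm g x R H p (r • X) =
    r • kernelForm g x R H p X := by
  rw [kernelForm, kernelForm, ← smul_mul_assoc, ← mul_smul_comm]
  congr 2
  refine mat_ext ?_ ?_ ?_ ?_ <;> simp [dQ_smul_vec, smul_sub, mul_sub]

/-- Take `η` to be `kernelForm` minus `2*A`. Both forms take values in `L` and they agree on `L`, so
`η` has the required type; closedness of the total form is `dH ∧ dx = 0`. -/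
theorem exists_multiplier (hf : IsConformalImmersion f) (hS : IsMeanCurvatureSphere f S)
    (hfin : ∀ p, p ∈ finiteSet f g)
    (hH : ∀ (p : M) (X : Tan p), dQ (meanH g S) p X * dQ (coord f g) p (rot X) =
      dQ (meanH g S) p (rot X) * dQ (coord f g) p X) :
    ∃ η : Form M, IsLagrangeMultiplier f S η ∧
      ∀ (p : M) (X : Tan p), totalForm S η p X *ᵥ (((g⁻¹ : Matˣ) : Mat) *ᵥ ![1, 0]) = 0 := by
  have hF := hS.frame hf g
  set C := kernelForm g (coord f g) (normalR f g S) (meanH g S) with hC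
  let η : Form M := fun p =>
    { toFun := fun X => C p X - (2 : ℝ) • hopfA S p (rot X)
      map_add' := fun X Y => by
        simp only [hC, kernelForm_add, rot_add, hopfA_add, smul_add]; abel
      map_smul' := fun r X => by
        simp only [hC, kernelForm_smul, rot_smul, hopfA_smul, smul_sub, RingHom.id_apply]
        rw [smul_comm] }
  have hηe : ∀ (p : M) (X : Tan p), η p X = C p X - (2 : ℝ) • hopfA S p (rot X) :=
    fun _ _ => rfl
  have htot : totalForm S η = C := by
    funext p X
    rw [totalForm, hηe]; abel
  have hCs : SmoothForm C := by
    rw [smoothForm_iff]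
    intro e he v q hq
    exact ((SmMatAt.const _).mul (hF.smMatAt_kernelForm he (hfin q) hq v)).mul (SmMatAt.const _)
  refine ⟨η, ⟨?_, fun p X v => ?_, fun p X v hv => ?_, ?_⟩, fun p X => ?_⟩
  · rw [smoothForm_iff] at hCs ⊢
    intro e he v q hq i j
    exact (hCs e he v q hq i j).sub (smMatAt_along_hopfA hS.smooth he v hq i j)
  · rw [hηe, ← theta_eq_zero_iff (hfin p), Matrix.sub_mulVec, theta_sub]
    have h1 : theta f g p (C p X *ᵥ v) = 0 := by
      rw [theta, kernelForm_mulVec]; simp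
    have h2 : ((2 : ℝ) • hopfA S p (rot X)) *ᵥ v = vmul (hopfA S p (rot X) *ᵥ v) 2 := by
      rw [Matrix.smul_mulVec]
      funext i
      simp [two_smul, mul_two]
    rw [h1, h2, theta_vmul, theta_hopfA hf hS (hfin p), zero_mul, sub_zero]
  · refine mulVec_injective g ?_
    have hv2 : v = vmul (((g⁻¹ : Matˣ) : Mat) *ᵥ ![coord f g p, 1]) (((g : Mat) *ᵥ v) 1) := by
      refine mulVec_injective g ?_
      rw [mulVec_vmul, mulVec_inv_mulVec, ← mem_eq_vmul (hfin p) hv]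
    rw [hηe, Matrix.sub_mulVec, Matrix.mulVec_sub, hv2, mulVec_vmul, mulVec_vmul, mulVec_vmul,
      mulVec_vmul, hopfA_mulVec_psi hf hS (hfin p), kernelForm_mulVec, mulVec_inv_mulVec]
    simp
  · change ClosedForm (totalForm S η)
    rw [htot, closedForm_iff hCs]
    intro e he q hq
    exact hF.kernelForm_closed (fun p _ X => hH p X) he (hfin q) hq
  · rw [htot]
    refine mulVec_injective g ?_
    rw [kernelForm_mulVec, mulVec_inv_mulVec]
    funext i
    simp

end Multiplier

end QSurf

namespace QSurf

/-! ### Imaginary units, commutation and orthogonality in `ℍ`. -/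

section QuaternionAlgebra

theorem star_eq_neg_of_sq {R : ℍ[ℝ]} (hR : R * R = -1) : star R = -R := by
  have h1 : ‖R‖ * ‖R‖ = 1 := by rw [← norm_mul, hR, norm_neg, norm_one]
  have h2 : star R * R = 1 := by
    rw [Quaternion.star_mul_self, Quaternion.normSq_eq_norm_mul_self, h1, Quaternion.coe_one]
  calc star R = -(star R * (R * R)) := by rw [hR, mul_neg, mul_one, neg_neg]
    _ = -R := by rw [← mul_assoc, h2, one_mul]

theorem norm_eq_one_of_sq {R : ℍ[ℝ]} (hR : R * R = -1) : ‖R‖ = 1 := by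
  have h1 : ‖R‖ * ‖R‖ = 1 := by rw [← norm_mul, hR, norm_neg, norm_one]
  nlinarith [norm_nonneg R]

theorem ne_zero_of_sq {R : ℍ[ℝ]} (hR : R * R = -1) : R ≠ 0 := by
  rintro rfl
  rw [mul_zero] at hR
  exact one_ne_zero (neg_eq_zero.1 hR.symm)

theorem re_eq_zero_iff_star {a : ℍ[ℝ]} : a.re = 0 ↔ star a = -a := Quaternion.star_eq_neg.symm

theorem coe_comm' (r : ℝ) (a : ℍ[ℝ]) : (r : ℍ[ℝ]) * a = a * r := Quaternion.coe_commutes r a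

/-- The commutant of an imaginary unit. -/
theorem exists_eq_add_mul_of_commute {c R : ℍ[ℝ]} (hR : R * R = -1) (h : c * R = R * c) :
    ∃ p q : ℝ, c = p + q * R := by
  have hs := star_eq_neg_of_sq hR
  set v : ℍ[ℝ] := c - (c.re : ℍ[ℝ]) with hv
  have hvs : star v = -v := by
    rw [← re_eq_zero_iff_star, hv]; simp
  have hvR : v * R = R * v := by
    rw [hv, sub_mul, mul_sub, h, coe_comm']
  have h1 : star (v * R) = v * R := by rw [star_mul, hs, hvs, neg_mul_neg, hvR]
  rw [Quaternion.star_eq_self] at h1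
  refine ⟨c.re, -(v * R).re, ?_⟩
  have h2 : v = -(v * R) * R := by rw [neg_mul, mul_assoc, hR, mul_neg, mul_one, neg_neg]
  have h3 : c = c.re + v := by rw [hv]; abel
  rw [h1] at h2
  rw [Quaternion.coe_neg, ← h2, ← h3]

theorem two_mul_eq_zero_quaternion {a : ℍ[ℝ]} (h : a + a = 0) : a = 0 := by
  rw [← two_mul] at h
  exact (mul_eq_zero.1 h).resolve_left two_ne_zero_quaternion

/-- A real multiple of the imaginary unit `R` is imaginary, so it is real only if it is zero. This
turns `dH ∧ dx = 0` into constancy of a real mean curvature. -/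
theorem eq_zero_of_mul_unit {d d' R : ℍ[ℝ]} (hR : R * R = -1) (hd : star d = d)
    (hd' : star d' = d') (h : d * R = d') : d = 0 := by
  rw [← h, star_mul, hd, star_eq_neg_of_sq hR, neg_mul] at hd'
  have h3 : R * d = d * R := by rw [Quaternion.star_eq_self.1 hd, coe_comm']
  rw [h3] at hd'
  exact (mul_eq_zero.1 (two_mul_eq_zero_quaternion (neg_eq_iff_add_eq_zero.1 hd'))).resolve_right
    (ne_zero_of_sq hR)

/-- A quaternion that commutes with two anticommuting units is real. -/
theorem eq_coe_of_commute {c R a : ℍ[ℝ]} (hR : R * R = -1) (ha : a ≠ 0) (haR : a * R = -(R * a))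
    (h : c * R = R * c) (h' : a * c = c * a) : c = (c.re : ℍ[ℝ]) := by
  obtain ⟨p, q, hc⟩ := exists_eq_add_mul_of_commute hR h
  have h1 : (q : ℍ[ℝ]) * R * a = 0 := by
    apply two_mul_eq_zero_quaternion
    rw [hc] at h'
    have e1 := coe_comm' p a
    have e2 := coe_comm' q a
    linear_combination (norm := noncomm_ring) -h' - e1 - e2 * R + (q : ℍ[ℝ]) * haR
  have hR0 := ne_zero_of_sq hR
  have hq := (mul_eq_zero.1 ((mul_eq_zero.1 h1).resolve_right ha)).resolve_right hR0
  rw [hc, hq, zero_mul, add_zero, Quaternion.re_coe]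

theorem anticommute_of_inner {a n : ℍ[ℝ]} (ha : star a = -a) (hn : star n = -n)
    (h : inner ℝ a n = 0) : a * n = -(n * a) := by
  rw [Quaternion.inner_def, hn, mul_neg, re_eq_zero_iff_star, star_neg, star_mul, ha, hn,
    neg_mul_neg, neg_neg] at h
  rw [← h]

theorem inner_of_anticommute {a n : ℍ[ℝ]} (ha : star a = -a) (hn : star n = -n)
    (h : a * n = -(n * a)) : inner ℝ a n = 0 := by
  rw [Quaternion.inner_def, hn, mul_neg, re_eq_zero_iff_star, star_neg, star_mul, ha, hn,
    neg_mul_neg, neg_neg, h]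

/-- A unit normal in an oriented three-dimensional space is unique up to sign. -/
theorem normal_unique {a R n : ℍ[ℝ]} (hR : R * R = -1) (ha : a ≠ 0) (haR : a * R = -(R * a))
    (has : star a = -a) (hn : star n = -n) (hn1 : ‖n‖ = 1) (h1 : inner ℝ a n = 0)
    (h2 : inner ℝ (R * a) n = 0) : ∃ t : ℝ, t * t = 1 ∧ n = t * R := by
  have hs := star_eq_neg_of_sq hR
  have e1 := anticommute_of_inner has hn h1
  have e2 := anticommute_of_inner (by rw [star_mul, has, hs, neg_mul_neg, haR]) hn h2
  -- Anticommuting with both `a` and `R a`, the vector `n` commutes with `R`; being imaginary, it is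
  -- a real multiple of `R`.
  have e3 : n * R = R * n := by
    refine mul_right_cancel₀ ha ?_
    linear_combination (norm := noncomm_ring) e2 - R * e1
  obtain ⟨p, q, hpq⟩ := exists_eq_add_mul_of_commute hR e3
  have hRre := re_eq_zero_iff_star.2 hs
  have hp : p = 0 := by
    have h := re_eq_zero_iff_star.2 hn
    rw [hpq] at h
    simpa [hRre] using h
  rw [hp, Quaternion.coe_zero, zero_add] at hpq
  refine ⟨q, ?_, hpq⟩
  have h := hn1
  rw [hpq, norm_mul, norm_eq_one_of_sq hR, mul_one, Quaternion.norm_coe, Real.norm_eq_abs] at h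
  rw [← abs_mul_abs_self, h, mul_one]

end QuaternionAlgebra

variable {M : Type*} [TopologicalSpace M] [ChartedSpace ℂ M] [IsManifold 𝓘(ℂ, ℂ) ω M]

/-- The trace of the second fundamental form in the direction of the left normal. -/
theorem Frame.mean_left {U : Set M} {x N R H : M → ℍ[ℝ]} (hF : Frame U x N R H) {p : M}
    (hp : p ∈ U) (X : Tan p) :
    inner ℝ (dQ x p X) (dQ N p X) + inner ℝ (dQ x p (rot X)) (dQ N p (rot X)) =
      2 * (H p).re * ‖dQ x p X‖ ^ 2 := by
  have hs := star_eq_neg_of_sq (hF.N_sq p hp)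
  have h1 := hF.hopf_left hp X
  have h2 := hF.N_sq p hp
  have hre : ∀ a b : ℍ[ℝ], (a * b).re = (b * a).re := by
    intro a b; simp; ring
  have e1 : dQ N p X - N p * dQ N p (rot X) = 2 * (dQ x p X * H p) := by
    linear_combination (norm := noncomm_ring) -(N p * h1) + h2 * dQ N p X -
      2 * h2 * dQ x p X * H p
  have e2 : star (dQ N p X) + star (dQ N p (rot X)) * N p =
      star (dQ N p X - N p * dQ N p (rot X)) := by
    rw [star_sub, star_mul, hs]; noncomm_ring
  have e3 : (star (H p) * (star (dQ x p X) * dQ x p X)).re = (H p).re * ‖dQ x p X‖ ^ 2 := by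
    rw [star_mul_self_eq_coe, Quaternion.mul_coe_eq_smul, Quaternion.re_smul, Quaternion.re_star,
      smul_eq_mul, mul_comm]
  rw [Quaternion.inner_def, Quaternion.inner_def, hF.left p hp, mul_assoc, hre (N p),
    mul_assoc, ← Quaternion.re_add, ← mul_add, e2, e1, two_mul, star_add, star_mul, mul_add,
    Quaternion.re_add, hre, mul_assoc, e3]
  ring

/-! ### Density and connectedness arguments. -/

section Global

variable {f : M → HP1} {g : Matˣ}

/-- Carries identities known where the affine coordinate is finite over to the points mapped to `∞`.
-/
theorem eq_zero_of_dense {E : Type*} [TopologicalSpace E] [Zero E] [T1Space E] {U : Set M}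
    (hU : Dense U) {F : M → E} {q : M} (hF : ContinuousAt F q)
    (h : ∀ᶠ x in nhds q, x ∈ U → F x = 0) : F q = 0 := by
  by_contra hne
  obtain ⟨V, hV, hVo, hqV⟩ := eventually_nhds_iff.1
    (h.and (hF.eventually (isOpen_compl_singleton.mem_nhds (show F q ∈ ({0} : Set E)ᶜ from hne))))
  obtain ⟨x, hxV, hxU⟩ := hU.inter_open_nonempty V hVo ⟨q, hqV⟩
  exact (hV x hxV).2 ((hV x hxV).1 hxU)

theorem toInfinity_unique {ℓ ℓ' : HP1} (h : ToInfinity g ℓ) (h' : ToInfinity g ℓ') : ℓ = ℓ' := by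
  refine Projectivization.submodule_injective (Submodule.ext fun v => ?_)
  rw [mem_iff_infinity h, mem_iff_infinity h']

/-- Only one line is mapped to `∞`, and an immersion is not constant on any neighbourhood. -/
theorem dense_finiteSet (hf : IsConformalImmersion f) : Dense (finiteSet f g) := by
  intro p
  by_contra hp
  rw [mem_closure_iff_nhds] at hp
  push Not at hp
  obtain ⟨V, hV, hVe⟩ := hp
  have hpV : ∀ q ∈ V, ToInfinity g (f q) := by
    intro q hq
    by_contra h
    have : q ∈ V ∩ finiteSet f g := ⟨hq, h⟩
    rw [hVe] at this
    exact this
  have hconst : ∀ g' : Matˣ, coord f g' =ᶠ[nhds p] fun _ => coord f g' p := by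
    intro g'
    filter_upwards [hV] with q hq
    rw [coord, coord, toInfinity_unique (hpV q hq) (hpV p (mem_of_mem_nhds hV))]
  obtain ⟨X, hX⟩ := exists_tan_ne_zero p
  have key : ∀ g' : Matˣ, p ∉ finiteSet f g' := by
    intro g' hg'
    apply dQ_coord_ne_zero hf hg' hX
    rw [dQ_congr (hconst g'), dQ_const]
  exact (mem_finiteSet_one_or_swap f p).elim (key _) (key _)

theorem isLocallyConstant_of_dQ_eq_zero {F : M → ℍ[ℝ]} (hF : ∀ p, SmAt F p)
    (h : ∀ (p : M) (X : Tan p), dQ F p X = 0) : IsLocallyConstant F := by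
  rw [IsLocallyConstant.iff_eventually_eq]
  intro p
  have he := chart_mem_atlas ℂ p
  have hpe := mem_chart_source ℂ p
  set e := chartAt ℂ p
  obtain ⟨r, hr, hball⟩ := Metric.isOpen_iff.1 e.open_target (e p) (e.map_source hpe)
  have hd : DifferentiableOn ℝ (fun w => F (e.symm w)) (Metric.ball (e p) r) := fun z hz =>
    (((hF _).comp_symm he (hball hz)).differentiableAt (by simp)).differentiableWithinAt
  have h0 : Set.EqOn (fderiv ℝ (fun w => F (e.symm w))) 0 (Metric.ball (e p) r) := by
    intro z hz
    ext1 v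
    rw [← dQ_chartVec he (hball hz) (hF _) v, h]
    rfl
  filter_upwards [e.open_source.mem_nhds hpe, (e.continuousAt hpe).preimage_mem_nhds
    (Metric.ball_mem_nhds _ hr)] with q hq hqb
  have h1 := Metric.isOpen_ball.is_const_of_fderiv_eq_zero (convex_ball _ _).isPreconnected hd h0
    hqb (Metric.mem_ball_self hr)
  simpa only [e.left_inv hq, e.left_inv hpe] using h1

theorem eq_const_of_dQ_eq_zero [PreconnectedSpace M] {F : M → ℍ[ℝ]} (hF : ∀ p, SmAt F p)
    (h : ∀ (p : M) (X : Tan p), dQ F p X = 0) (p q : M) : F p = F q :=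
  (isLocallyConstant_of_dQ_eq_zero hF h).apply_eq_of_preconnectedSpace p q

/-- A function whose differential vanishes on a dense set is constant. -/
theorem dQ_eq_zero_of_dense {U : Set M} (hU : Dense U) {F : M → ℍ[ℝ]} (hF : ∀ p, SmAt F p)
    (h : ∀ p ∈ U, ∀ X : Tan p, dQ F p X = 0) (p : M) (X : Tan p) : dQ F p X = 0 := by
  obtain ⟨v, rfl⟩ := exists_chartVec_eq (chart_mem_atlas ℂ p) (mem_chart_source ℂ p) X
  exact eq_zero_of_dense (F := fun q => dQ F q (chartVec (chartAt ℂ p) v q)) hU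
    (SmAt.dQ_chartVec (chart_mem_atlas ℂ p) (mem_chart_source ℂ p)
      (Filter.Eventually.of_forall hF) v).continuousAt
    (Filter.Eventually.of_forall fun x hx => h x hx _)

/-- A unit normal is determined only up to sign, and the sign may differ between components of the
finite set. So only the square of the mean curvature is controlled there; continuity on the
connected surface then fixes the sign. -/
theorem eq_const_of_sq_eq_const [PreconnectedSpace M] {F : M → ℝ} (hF : Continuous F) {c : ℝ}
    (h : ∀ p, F p ^ 2 = c ^ 2) (p q : M) : F p = F q := by
  by_cases hc : c = 0
  · have h0 : ∀ p, F p = 0 := fun p => by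
      have := h p
      rw [hc] at this
      simpa using this
    rw [h0, h0]
  · rcases isPreconnected_univ.eq_or_eq_neg_of_sq_eq hF.continuousOn
      (continuous_const (y := c)).continuousOn (fun p _ => h p) (fun _ => hc) with h1 | h1
    · rw [h1 (Set.mem_univ p), h1 (Set.mem_univ q)]
    · rw [h1 (Set.mem_univ p), h1 (Set.mem_univ q)]
      rfl

end Global

/-- The quotient `T = n m⁻¹` is smooth, real valued and satisfies `T² = 1`. Differentiation gives `2
T dT = 0`, so the sign is locally constant. -/
theorem exists_sign {U : Set M} (hU : IsOpen U) {p : M} (hp : p ∈ U) {n m : M → ℍ[ℝ]}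
    (hn : SmAt n p) (hm : SmAt m p) (hm0 : ∀ q ∈ U, m q ≠ 0)
    (h : ∀ q ∈ U, ∃ t : ℝ, t * t = 1 ∧ n q = t * m q) :
    ∃ t : ℝ, t * t = 1 ∧ ∀ X : Tan p, dQ n p X = t • dQ m p X := by
  set T : M → ℍ[ℝ] := fun q => n q * (m q)⁻¹ with hT
  have hsT : SmAt T p := hn.mul (hm.inv (hm0 p hp))
  have hTt : ∀ q ∈ U, ∀ t : ℝ, n q = t * m q → T q = t := by
    intro q hq t ht
    simp only [hT]
    rw [ht, mul_assoc, mul_inv_cancel₀ (hm0 q hq), mul_one]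
  obtain ⟨t, ht, hnt⟩ := h p hp
  have hTp := hTt p hp t hnt
  have hT2 : ∀ q ∈ U, T q * T q = 1 := by
    intro q hq
    obtain ⟨s, hs, hns⟩ := h q hq
    rw [hTt q hq s hns, ← Quaternion.coe_mul, hs, Quaternion.coe_one]
  have hnT : ∀ q ∈ U, n q = T q * m q := by
    intro q hq
    obtain ⟨s, hs, hns⟩ := h q hq
    rw [hTt q hq s hns, hns]
  have hdT : ∀ X : Tan p, dQ T p X = 0 := by
    intro X
    have h1 := dQ_congr (F := fun q => T q * T q) (G := fun _ => 1)
      (Filter.eventually_of_mem (hU.mem_nhds hp) hT2) X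
    rw [dQ_mul hsT hsT, dQ_const, hTp, ← coe_comm'] at h1
    have h2 := two_mul_eq_zero_quaternion h1
    refine (mul_eq_zero.1 h2).resolve_left fun h0 => ?_
    have : t = 0 := Quaternion.coe_injective h0
    rw [this, mul_zero] at ht
    exact zero_ne_one ht
  refine ⟨t, ht, fun X => ?_⟩
  rw [dQ_congr (F := n) (G := fun q => T q * m q)
    (Filter.eventually_of_mem (hU.mem_nhds hp) hnT), dQ_mul hsT hm, hdT,
    hTp, zero_mul, zero_add, Quaternion.coe_mul_eq_smul]

theorem sq_eq_of_sign {t a h : ℝ} (ht : t * t = 1) (h3 : t * a = -h) : a ^ 2 = h ^ 2 := by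
  calc a ^ 2 = (t * t) * a ^ 2 := by rw [ht, one_mul]
    _ = (t * a) ^ 2 := by ring
    _ = h ^ 2 := by rw [h3, neg_sq]

/-! ### Surfaces in `Im ℍ = ℝ³`: `H` is real and is the mean curvature. -/

section Imaginary

variable {U : Set M} {x N R H : M → ℍ[ℝ]} {p : M}

theorem Frame.star_dx_of_im (hF : Frame U x N R H) (him : ∀ p ∈ U, star (x p) = -x p) (hp : p ∈ U)
    (X : Tan p) : star (dQ x p X) = -dQ x p X := by
  rw [← dQ_star (hF.smx p hp), ← dQ_neg (hF.smx p hp)]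
  exact dQ_congr (Filter.eventually_of_mem (hF.isOpen.mem_nhds hp) him) X

/-- Conjugating `*dx = N dx`, with `dx`, `*dx` and `N` imaginary, gives `*dx = -dx N`; compare with
`*dx = -dx R`. -/
theorem Frame.N_eq_R_of_im (hF : Frame U x N R H) (him : ∀ p ∈ U, star (x p) = -x p) (hp : p ∈ U) :
    N p = R p := by
  obtain ⟨X, hX⟩ := exists_tan_ne_zero p
  refine mul_left_cancel₀ (hF.ne_zero p hp X hX) ?_
  have h1 := hF.star_dx_of_im him hp (rot X)
  have h2 := hF.right p hp X
  rw [hF.left p hp X, star_mul, hF.star_dx_of_im him hp, star_eq_neg_of_sq (hF.N_sq p hp),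
    neg_mul_neg] at h1
  rw [h1, ← hF.left p hp, h2, neg_neg]

theorem Frame.anticommute_of_im (hF : Frame U x N R H) (him : ∀ p ∈ U, star (x p) = -x p)
    (hp : p ∈ U) (X : Tan p) : dQ x p X * N p = -(N p * dQ x p X) := by
  rw [hF.N_mul_dx hp, neg_neg, hF.N_eq_R_of_im him hp]

/-- Since `N = R`, the two Hopf equations have equal left sides and make `H` commute with `dx`; it
also commutes with `R`. These two anticommute, so `H` is real. -/
theorem Frame.H_real_of_im (hF : Frame U x N R H) (him : ∀ p ∈ U, star (x p) = -x p) (hp : p ∈ U) :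
    H p = ((H p).re : ℍ[ℝ]) := by
  obtain ⟨X, hX⟩ := exists_tan_ne_zero p
  have hNR := hF.N_eq_R_of_im him hp
  have hev : N =ᶠ[nhds p] R :=
    Filter.eventually_of_mem (hF.isOpen.mem_nhds hp) fun q hq => hF.N_eq_R_of_im him hq
  have h1 := hF.hopf_left hp X
  have h2 := hF.hopf p hp X
  have h3 := hF.H_mul_N p hp
  rw [dQ_congr hev, dQ_congr hev, hNR, h2, hF.left p hp, hNR] at h1
  rw [hNR] at h3
  have hR := hF.R_sq p hp
  have hR0 := ne_zero_of_sq hR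
  have h5 := hF.anticommute_of_im him hp X
  rw [hNR] at h5
  refine eq_coe_of_commute hR (hF.ne_zero p hp X hX) h5 h3 ?_
  refine mul_left_cancel₀ hR0 ?_
  have h6 := mul_left_cancel₀ two_ne_zero_quaternion h1
  rw [← mul_assoc, ← h6, ← mul_assoc, h3, mul_assoc]

theorem Frame.dH_eq_zero_of_im (hF : Frame U x N R H) (him : ∀ p ∈ U, star (x p) = -x p)
    (hp : p ∈ U) {X : Tan p}
    (h : dQ H p X * dQ x p (rot X) = dQ H p (rot X) * dQ x p X) : dQ H p X = 0 := by
  by_cases hX : X = 0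
  · rw [hX]; exact map_zero _
  have hsH : ∀ Y : Tan p, star (dQ H p Y) = dQ H p Y := by
    intro Y
    rw [← dQ_star (hF.smH p hp)]
    refine dQ_congr (Filter.eventually_of_mem (hF.isOpen.mem_nhds hp) fun q hq => ?_) Y
    exact Quaternion.star_eq_self.2 (hF.H_real_of_im him hq)
  have h1 : dQ H p X * N p = dQ H p (rot X) := by
    refine mul_right_cancel₀ (hF.ne_zero p hp X hX) ?_
    rw [mul_assoc, ← hF.left p hp, h]
  exact eq_zero_of_mul_unit (hF.N_sq p hp) (hsH X) (hsH (rot X)) h1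

/-- The mean curvature with respect to an arbitrary unit normal. -/
theorem Frame.sq_re_H_of_cmc (hF : Frame U x N R H) (him : ∀ p ∈ U, star (x p) = -x p)
    {n : M → ℍ[ℝ]} {h : ℝ} (hn : ∀ p ∈ U, (n p).re = 0)
    (hc : HasConstantMeanCurvatureAlong U x n h) (hp : p ∈ U) : (H p).re ^ 2 = h ^ 2 := by
  have key : ∀ q ∈ U, ∃ t : ℝ, t * t = 1 ∧ n q = t * N q := by
    intro q hq
    obtain ⟨X, hX⟩ := exists_tan_ne_zero q
    refine normal_unique (hF.N_sq q hq) (hF.ne_zero q hq X hX) (hF.anticommute_of_im him hq X)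
      (hF.star_dx_of_im him hq X) (re_eq_zero_iff_star.1 (hn q hq)) (hc.unit q hq)
      (hc.normal q hq X) ?_
    rw [← hF.left q hq]
    exact hc.normal q hq _
  have hN0 : ∀ q ∈ U, N q ≠ 0 := fun q hq => ne_zero_of_sq (hF.N_sq q hq)
  obtain ⟨t, ht, hdn⟩ := exists_sign hF.isOpen hp (hc.smooth.contMDiffAt (hF.isOpen.mem_nhds hp))
    (hF.smN p hp) hN0 key
  obtain ⟨X, hX⟩ := exists_tan_ne_zero p
  have h1 := hc.mean p hp X
  rw [hdn, hdn, inner_smul_right, inner_smul_right, ← mul_add, hF.mean_left hp] at h1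
  have h2 : 0 < ‖dQ x p X‖ ^ 2 := pow_pos (norm_pos_iff.2 (hF.ne_zero p hp X hX)) 2
  have h3 : t * (H p).re = -h := by
    refine mul_right_cancel₀ h2.ne' ?_
    linarith
  exact sq_eq_of_sign ht h3

end Imaginary

end QSurf

namespace QSurf

variable {M : Type*} [TopologicalSpace M] [ChartedSpace ℂ M] [IsManifold 𝓘(ℂ, ℂ) ω M]

/-! ### Surfaces in `S³`: `k = H x - R` is real and is the mean curvature. -/

section Spherical

variable {U : Set M} {x N R H : M → ℍ[ℝ]} {p : M}

theorem inner_mul_left_of_unit {a b c : ℍ[ℝ]} (ha : star a * a = 1) :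
    inner ℝ (a * b) (a * c) = inner ℝ b c := by
  have hre : ∀ a b : ℍ[ℝ], (a * b).re = (b * a).re := by
    intro a b; simp; ring
  rw [Quaternion.inner_def, Quaternion.inner_def, star_mul, mul_assoc, hre, mul_assoc, mul_assoc,
    ha, mul_one]

theorem norm_eq_one_of_star_mul {a : ℍ[ℝ]} (ha : star a * a = 1) : ‖a‖ = 1 := by
  rw [Quaternion.star_mul_self, Quaternion.normSq_eq_norm_mul_self] at ha
  nlinarith [norm_nonneg a, Quaternion.coe_injective ha]

theorem mul_star_of_star_mul {a : ℍ[ℝ]} (ha : star a * a = 1) : a * star a = 1 := by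
  rw [self_mul_star_eq_coe, ← star_mul_self_eq_coe, ha]

/-- The pull back of the Maurer-Cartan form by a surface in the 3-sphere. -/
theorem Frame.dx_eq_of_sphere (hsp : ∀ p ∈ U, star (x p) * x p = 1) (hp : p ∈ U) (X : Tan p) :
    dQ x p X = x p * (star (x p) * dQ x p X) := by
  rw [← mul_assoc, mul_star_of_star_mul (hsp p hp), one_mul]

theorem Frame.alpha_ne_zero (hF : Frame U x N R H) (hsp : ∀ p ∈ U, star (x p) * x p = 1)
    (hp : p ∈ U) {X : Tan p} (hX : X ≠ 0) : star (x p) * dQ x p X ≠ 0 := by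
  intro h
  apply hF.ne_zero p hp X hX
  rw [Frame.dx_eq_of_sphere hsp hp, h, mul_zero]

theorem Frame.star_alpha (hF : Frame U x N R H) (hsp : ∀ p ∈ U, star (x p) * x p = 1)
    (hp : p ∈ U) (X : Tan p) : star (star (x p) * dQ x p X) = -(star (x p) * dQ x p X) := by
  have h := dQ_congr (F := fun q => star (x q) * x q) (G := fun _ => 1)
    (Filter.eventually_of_mem (hF.isOpen.mem_nhds hp) hsp) X
  rw [dQ_mul (hF.smx p hp).star (hF.smx p hp), dQ_const, dQ_star (hF.smx p hp)] at h
  rw [star_mul, star_star]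
  exact eq_neg_of_add_eq_zero_left h

theorem Frame.alpha_mul_R (hF : Frame U x N R H) (hsp : ∀ p ∈ U, star (x p) * x p = 1)
    (hp : p ∈ U) (X : Tan p) :
    star (x p) * dQ x p X * R p = -(R p * (star (x p) * dQ x p X)) := by
  have h := hF.star_alpha hsp hp (rot X)
  rw [hF.right p hp, mul_neg, ← mul_assoc, star_neg, neg_neg, star_mul, hF.star_alpha hsp hp,
    star_eq_neg_of_sq (hF.R_sq p hp), neg_mul_neg] at h
  exact h.symm

theorem Frame.alpha_rot (hF : Frame U x N R H) (hsp : ∀ p ∈ U, star (x p) * x p = 1)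
    (hp : p ∈ U) (X : Tan p) :
    star (x p) * dQ x p (rot X) = R p * (star (x p) * dQ x p X) := by
  rw [hF.right p hp, mul_neg, ← mul_assoc, hF.alpha_mul_R hsp hp, neg_neg]

/-- The form `α = x̄ dx` is imaginary and anticommutes with `R`. Insert `dx = x α` into `N dx = -dx
R` and cancel `α`. -/
theorem Frame.N_mul_x (hF : Frame U x N R H) (hsp : ∀ p ∈ U, star (x p) * x p = 1)
    (hp : p ∈ U) : N p * x p = x p * R p := by
  obtain ⟨X, hX⟩ := exists_tan_ne_zero p
  refine mul_right_cancel₀ (hF.alpha_ne_zero hsp hp hX) ?_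
  have h1 := hF.N_mul_dx hp X
  have h2 := hF.alpha_mul_R hsp hp X
  have h3 := Frame.dx_eq_of_sphere hsp hp X
  calc N p * x p * (star (x p) * dQ x p X) = N p * dQ x p X := by rw [mul_assoc, ← h3]
    _ = -(x p * (star (x p) * dQ x p X) * R p) := by rw [h1, ← h3]
    _ = x p * R p * (star (x p) * dQ x p X) := by
      rw [mul_assoc, h2, mul_neg, neg_neg, mul_assoc]

/-- In the 3-sphere the quaternionic mean curvature is `H = (k + R) x̄` with `k` real. -/
theorem Frame.H_mul_x (hF : Frame U x N R H) (hsp : ∀ p ∈ U, star (x p) * x p = 1)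
    (hp : p ∈ U) : H p * x p - R p = ((H p * x p - R p).re : ℍ[ℝ]) := by
  obtain ⟨X, hX⟩ := exists_tan_ne_zero p
  have hR := hF.R_sq p hp
  have hα := hF.alpha_ne_zero hsp hp hX
  have hαR := hF.alpha_mul_R hsp hp X
  have hNx := hF.N_mul_x hsp hp
  have hHN := hF.H_mul_N p hp
  have hdN : ∀ Y : Tan p, dQ N p Y * x p + N p * dQ x p Y = dQ x p Y * R p + x p * dQ R p Y := by
    intro Y
    rw [← dQ_mul (hF.smN p hp) (hF.smx p hp), ← dQ_mul (hF.smx p hp) (hF.smR p hp)]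
    exact dQ_congr (Filter.eventually_of_mem (hF.isOpen.mem_nhds hp)
      fun q hq => hF.N_mul_x hsp hq) Y
  have hc : H p * x p * R p = R p * (H p * x p) := by
    rw [mul_assoc, ← hNx, ← mul_assoc, hHN, mul_assoc]
  have h1 := hF.hopf_left hp X
  have h2 := hF.hopf p hp X
  have hl := hF.left p hp X
  have hr := hF.right p hp X
  have hlr := hF.N_mul_dx hp X
  have h3 := hdN X
  have h4 := hdN (rot X)
  have hx0 : x p ≠ 0 := fun h => by
    have := hsp p hp
    rw [h, mul_zero] at this
    exact zero_ne_one this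
  have hdx := Frame.dx_eq_of_sphere hsp hp X
  have hdxr := Frame.dx_eq_of_sphere hsp hp (rot X)
  rw [hF.alpha_rot hsp hp] at hdxr
  generalize star (x p) * dQ x p X = α at *
  have hN := hF.N_sq p hp
  have e1 : 2 * (N p * dQ x p X * (H p * x p)) = 4 * dQ x p X +
      2 * (x p * (H p * dQ x p (rot X))) := by
    have f1 : N p * (x p * dQ R p X) = x p * (R p * dQ R p X) := by
      rw [← mul_assoc, hNx, mul_assoc]
    have f2 : N p * (dQ x p X * R p) = dQ x p X := by
      rw [← mul_assoc, hlr, neg_mul, mul_assoc, hR, mul_neg, mul_one, neg_neg]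
    have f3 : dQ x p (rot X) * R p = dQ x p X := by
      rw [hr, neg_mul, mul_assoc, hR, mul_neg, mul_one, neg_neg]
    have f4 : N p * dQ x p (rot X) = -dQ x p X := by
      rw [hl, ← mul_assoc, hN, neg_one_mul]
    have f5 : N p * (N p * dQ x p X) = -dQ x p X := by rw [← mul_assoc, hN, neg_one_mul]
    linear_combination (norm := noncomm_ring) -h1 * x p + N p * h3 + h4 + f1 + f2 + f3 - f4 - f5 +
      x p * h2
  have e2 : α * (H p * x p) = -(2 * (R p * α)) + H p * x p * α := by
    refine mul_left_cancel₀ (ne_zero_of_sq hR) (mul_left_cancel₀ hx0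
      (mul_left_cancel₀ two_ne_zero_quaternion ?_))
    rw [hlr, hdxr, hdx] at e1
    linear_combination (norm := noncomm_ring) e1 + 2 * x p * hαR * H p * x p +
      4 * x p * hR * α + 2 * x p * hc * α
  -- As in `Im ℍ`, the argument is that `k` commutes with the anticommuting pair `α`, `R`.
  have e3 : α * (H p * x p - R p) = (H p * x p - R p) * α := by
    linear_combination (norm := noncomm_ring) e2 - hαR
  have e4 : (H p * x p - R p) * R p = R p * (H p * x p - R p) := by
    linear_combination (norm := noncomm_ring) hc
  exact eq_coe_of_commute hR hα hαR e4 e3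

theorem Frame.smAt_k (hF : Frame U x N R H) (hp : p ∈ U) :
    SmAt (fun q => H q * x q - R q) p :=
  ((hF.smH p hp).mul (hF.smx p hp)).sub (hF.smR p hp)

theorem Frame.dH_mul_x (hF : Frame U x N R H) (hp : p ∈ U) (X : Tan p) :
    dQ H p X * x p = dQ (fun q => H q * x q - R q) p X + (dQ R p X - H p * dQ x p X) := by
  rw [dQ_sub ((hF.smH p hp).mul (hF.smx p hp)) (hF.smR p hp),
    dQ_mul (hF.smH p hp) (hF.smx p hp)]
  abel

theorem Frame.b_mul_R (hF : Frame U x N R H) (hp : p ∈ U) (X : Tan p) :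
    (dQ R p X - H p * dQ x p X) * R p = -(R p * (dQ R p X - H p * dQ x p X)) := by
  have h1 := hF.dR_mul_R hp X
  have h2 := hF.N_mul_dx hp X
  have h3 := hF.H_mul_N p hp
  linear_combination (norm := noncomm_ring) h1 - H p * h2 + h3 * dQ x p X

/-- Substitute `dH x = dk + b`. The contribution of `b` is `(b R + R b) α`, which vanishes because
`b` anticommutes with `R`. -/
theorem Frame.wedge_sphere (hF : Frame U x N R H) (hsp : ∀ p ∈ U, star (x p) * x p = 1)
    (hp : p ∈ U) (X : Tan p) :
    dQ H p X * dQ x p (rot X) - dQ H p (rot X) * dQ x p X =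
      (dQ (fun q => H q * x q - R q) p X * R p - dQ (fun q => H q * x q - R q) p (rot X)) *
        (star (x p) * dQ x p X) := by
  have h1 := hF.dH_mul_x hp X
  have h2 := hF.dH_mul_x hp (rot X)
  have h3 := Frame.dx_eq_of_sphere hsp hp X
  have h4 := Frame.dx_eq_of_sphere hsp hp (rot X)
  rw [hF.alpha_rot hsp hp] at h4
  have h5 := hF.b_mul_R hp X
  have h6 := hF.b_rot hp X
  calc dQ H p X * dQ x p (rot X) - dQ H p (rot X) * dQ x p X
      = dQ H p X * x p * (R p * (star (x p) * dQ x p X)) -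
          dQ H p (rot X) * x p * (star (x p) * dQ x p X) := by
        rw [h4, mul_assoc (dQ H p X), mul_assoc (dQ H p (rot X)), ← h3]
    _ = _ := by
        rw [h1, h2, h6]
        linear_combination (norm := noncomm_ring) h5 * (star (x p) * dQ x p X)

theorem Frame.star_dk (hF : Frame U x N R H) (hsp : ∀ p ∈ U, star (x p) * x p = 1)
    (hp : p ∈ U) (X : Tan p) : star (dQ (fun q => H q * x q - R q) p X) =
      dQ (fun q => H q * x q - R q) p X := by
  rw [← dQ_star (hF.smAt_k hp)]
  exact dQ_congr (Filter.eventually_of_mem (hF.isOpen.mem_nhds hp) fun q hq =>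
    Quaternion.star_eq_self.2 (hF.H_mul_x hsp hq)) X

theorem Frame.dk_eq_zero (hF : Frame U x N R H) (hsp : ∀ p ∈ U, star (x p) * x p = 1)
    (hp : p ∈ U) (X : Tan p)
    (h : dQ H p X * dQ x p (rot X) = dQ H p (rot X) * dQ x p X) :
    dQ (fun q => H q * x q - R q) p X = 0 := by
  by_cases hX : X = 0
  · rw [hX]; exact map_zero _
  have h1 := hF.wedge_sphere hsp hp X
  rw [h, sub_self] at h1
  have h2 := (mul_eq_zero.1 h1.symm).resolve_right (hF.alpha_ne_zero hsp hp hX)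
  exact eq_zero_of_mul_unit (hF.R_sq p hp) (hF.star_dk hsp hp X) (hF.star_dk hsp hp (rot X))
    (sub_eq_zero.1 h2)

/-- The trace of the second fundamental form of a surface in the 3-sphere. -/
theorem Frame.mean_sphere (hF : Frame U x N R H) (hsp : ∀ p ∈ U, star (x p) * x p = 1)
    (hp : p ∈ U) (X : Tan p) :
    inner ℝ (dQ x p X) (dQ (fun q => x q * R q) p X) +
      inner ℝ (dQ x p (rot X)) (dQ (fun q => x q * R q) p (rot X)) =
      2 * (H p * x p - R p).re * ‖dQ x p X‖ ^ 2 := by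
  have hx := hsp p hp
  have hR := hF.R_sq p hp
  have hRs := star_eq_neg_of_sq hR
  have hre : ∀ a b : ℍ[ℝ], (a * b).re = (b * a).re := by
    intro a b; simp; ring
  have hdx := Frame.dx_eq_of_sphere hsp hp X
  have hdxr := Frame.dx_eq_of_sphere hsp hp (rot X)
  rw [hF.alpha_rot hsp hp] at hdxr
  have hHx := hF.H_mul_x hsp hp
  have hdn : ∀ Y : Tan p, dQ (fun q => x q * R q) p Y = dQ x p Y * R p + x p * dQ R p Y := fun Y =>
    dQ_mul (hF.smx p hp) (hF.smR p hp) Y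
  have hnorm : ‖dQ x p X‖ = ‖star (x p) * dQ x p X‖ := by
    rw [norm_mul, Quaternion.norm_star, norm_eq_one_of_star_mul hx, one_mul]
  have hαR := hF.alpha_mul_R hsp hp X
  have hh := hF.hopf p hp X
  have hHN := hF.H_mul_N p hp
  have hl := hF.left p hp X
  rw [hdn, hdn, hnorm]
  have e0 : H p * dQ x p X = H p * x p * (star (x p) * dQ x p X) := by
    rw [mul_assoc, ← hdx]
  generalize hαdef : star (x p) * dQ x p X = α at *
  set k := (H p * x p - R p).re
  have e1 : dQ R p X - R p * dQ R p (rot X) = 2 * ((k + R p) * α) := by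
    have e2 : H p * x p = k + R p := by rw [← hHx]; abel
    rw [← e2, ← e0]
    linear_combination (norm := noncomm_ring) hR * dQ R p X - R p * hh - 2 * R p * H p * hl -
      2 * R p * hHN * dQ x p X - 2 * hR * H p * dQ x p X
  have e3 : dQ x p X * R p + x p * dQ R p X = x p * (α * R p + dQ R p X) := by
    rw [hdx]; noncomm_ring
  have e4 : dQ x p (rot X) * R p + x p * dQ R p (rot X) = x p * (α + dQ R p (rot X)) := by
    rw [hdxr]
    linear_combination (norm := noncomm_ring) x p * R p * hαR - x p * hR * α
  rw [e3, e4, hdx, hdxr, inner_mul_left_of_unit hx, inner_mul_left_of_unit hx, inner_add_right,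
    inner_add_right]
  have e5 : inner ℝ α (α * R p) = -inner ℝ (R p * α) α := by
    rw [hαR, inner_neg_right, real_inner_comm]
  have e6 : inner ℝ (R p * α) (dQ R p (rot X)) = -inner ℝ α (R p * dQ R p (rot X)) := by
    rw [Quaternion.inner_def, Quaternion.inner_def, star_mul, hRs, mul_neg, mul_neg,
      Quaternion.re_neg, neg_neg, mul_assoc, hre (R p), mul_assoc]
  have e7 : inner ℝ α (R p * α) = 0 := by
    rw [Quaternion.inner_def, star_mul, hRs, mul_neg, mul_neg, ← mul_assoc, self_mul_star_eq_coe,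
      Quaternion.coe_mul_eq_smul, Quaternion.re_neg, Quaternion.re_smul,
      re_eq_zero_iff_star.2 hRs, smul_zero, neg_zero]
  have e8 : inner ℝ α (dQ R p X) - inner ℝ α (R p * dQ R p (rot X)) = 2 * k * ‖α‖ ^ 2 := by
    rw [← inner_sub_right, e1, two_mul, add_mul, inner_add_right, inner_add_right, e7,
      Quaternion.coe_mul_eq_smul, inner_smul_right, real_inner_self_eq_norm_sq]
    ring
  linarith

theorem Frame.sq_k_of_cmc (hF : Frame U x N R H) (hsp : ∀ p ∈ U, star (x p) * x p = 1)
    {n : M → ℍ[ℝ]} {h : ℝ} (hn : ∀ p ∈ U, inner ℝ (x p) (n p) = 0)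
    (hc : HasConstantMeanCurvatureAlong U x n h) (hp : p ∈ U) :
    (H p * x p - R p).re ^ 2 = h ^ 2 := by
  have hx1 : ∀ q ∈ U, ‖x q‖ = 1 := fun q hq => norm_eq_one_of_star_mul (hsp q hq)
  have hxx : ∀ q ∈ U, ∀ a, x q * (star (x q) * a) = a := fun q hq a => by
    rw [← mul_assoc, mul_star_of_star_mul (hsp q hq), one_mul]
  have key : ∀ q ∈ U, ∃ t : ℝ, t * t = 1 ∧ n q = t * (x q * R q) := by
    intro q hq
    obtain ⟨X, hX⟩ := exists_tan_ne_zero q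
    have h1 : ∀ Y : Tan q, inner ℝ (star (x q) * dQ x q Y) (star (x q) * n q) = 0 := by
      intro Y
      rw [← inner_mul_left_of_unit (hsp q hq), hxx q hq, hxx q hq]
      exact hc.normal q hq Y
    -- Left translation by `x̄` is an isometry taking `x` to `1`, so the tangent space of `S³`
    -- becomes `Im ℍ` and the tangent plane of the surface is spanned by `α` and `R α`.
    obtain ⟨t, ht, hnt⟩ := normal_unique (n := star (x q) * n q) (hF.R_sq q hq)
      (hF.alpha_ne_zero hsp hq hX)
      (hF.alpha_mul_R hsp hq X) (hF.star_alpha hsp hq X)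
      (by
        rw [← re_eq_zero_iff_star]
        have h2 := hn q hq
        rw [← mul_one (x q), ← hxx q hq (n q), inner_mul_left_of_unit (hsp q hq),
          Quaternion.inner_def, one_mul, Quaternion.re_star] at h2
        exact h2)
      (by rw [norm_mul, Quaternion.norm_star, hx1 q hq, one_mul, hc.unit q hq]) (h1 X)
      (by rw [← hF.alpha_rot hsp hq]; exact h1 _)
    refine ⟨t, ht, ?_⟩
    rw [← hxx q hq (n q), hnt, ← mul_assoc, ← coe_comm', mul_assoc]
  have hm0 : ∀ q ∈ U, x q * R q ≠ 0 := fun q hq =>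
    mul_ne_zero (by rw [← norm_ne_zero_iff, hx1 q hq]; exact one_ne_zero)
      (ne_zero_of_sq (hF.R_sq q hq))
  obtain ⟨t, ht, hdn⟩ := exists_sign hF.isOpen hp (hc.smooth.contMDiffAt (hF.isOpen.mem_nhds hp))
    ((hF.smx p hp).mul (hF.smR p hp)) hm0 key
  obtain ⟨X, hX⟩ := exists_tan_ne_zero p
  have h1 := hc.mean p hp X
  rw [hdn, hdn, inner_smul_right, inner_smul_right, ← mul_add, hF.mean_sphere hsp hp] at h1
  have h2 : 0 < ‖dQ x p X‖ ^ 2 := pow_pos (norm_pos_iff.2 (hF.ne_zero p hp X hX)) 2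
  have h3 : t * (H p * x p - R p).re = -h := by
    refine mul_right_cancel₀ h2.ne' ?_
    linarith
  exact sq_eq_of_sign ht h3

end Spherical

end QSurf

/-! ### Multipliers and constant mean curvature, including points at infinity. -/

namespace QSurf

variable {M : Type*} [TopologicalSpace M] [ChartedSpace ℂ M] [IsManifold 𝓘(ℂ, ℂ) ω M]

theorem mulVec_eq_zero_of_dense {τ : (p : M) → Tan p → Mat} (hτ : SmoothForm τ) {U : Set M}
    (hU : Dense U) {w : V} (h : ∀ p ∈ U, ∀ X : Tan p, τ p X *ᵥ w = 0) (p : M) (X : Tan p) :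
    τ p X *ᵥ w = 0 := by
  obtain ⟨v, rfl⟩ := exists_chartVec_eq (chart_mem_atlas ℂ p) (mem_chart_source ℂ p) X
  rw [smoothForm_iff] at hτ
  have hs := hτ _ (chart_mem_atlas ℂ p) v p (mem_chart_source ℂ p)
  have key : ∀ i, (τ p (chartVec (chartAt ℂ p) v p) *ᵥ w) i = 0 := fun i =>
    eq_zero_of_dense (F := fun q => (along τ (chartAt ℂ p) v q *ᵥ w) i) hU (by
      fin_cases i
      · simp only [Fin.zero_eta, mulVec_zero_entry]
        exact (((hs 0 0).mul (SmAt.const _)).add ((hs 0 1).mul (SmAt.const _))).continuousAt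
      · simp only [Fin.mk_one, mulVec_one_entry]
        exact (((hs 1 0).mul (SmAt.const _)).add ((hs 1 1).mul (SmAt.const _))).continuousAt)
      (Filter.Eventually.of_forall fun q hq => congrFun (h q hq _) i)
  exact funext key

theorem closedForm_of_dense {τ : (p : M) → Tan p → Mat} (hτ : SmoothForm τ) {U : Set M}
    (hU : Dense U)
    (h : ∀ e ∈ atlas ℂ M, ∀ q ∈ e.source, q ∈ U →
      dMat (along τ e Complex.I) q (chartVec e 1 q) =
        dMat (along τ e 1) q (chartVec e Complex.I q)) : ClosedForm τ := by
  rw [closedForm_iff hτ]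
  rw [smoothForm_iff] at hτ
  intro e he q hq
  ext1 i j
  have hs : ∀ v w, SmAt (fun x => dQ (fun y => along τ e v y i j) x (chartVec e w x)) q :=
    fun v w => SmAt.dQ_chartVec he hq
      (Filter.eventually_of_mem (e.open_source.mem_nhds hq) fun x hx => hτ e he v x hx i j) w
  exact sub_eq_zero.1 (eq_zero_of_dense
    (F := fun x => dMat (along τ e Complex.I) x (chartVec e 1 x) i j -
      dMat (along τ e 1) x (chartVec e Complex.I x) i j) hU
    ((hs _ _).sub (hs _ _)).continuousAt
    (Filter.eventually_of_mem (e.open_source.mem_nhds hq) fun x hx hxU => by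
      rw [h e he x hx hxU, sub_self]))

section Multiplier

variable {f : M → HP1} {g : Matˣ} {S : M → Mat} {η : Form M}

theorem smAt_meanH (hS : IsMeanCurvatureSphere f S) (p : M) : SmAt (meanH g S) p :=
  (smMatAt_conjMat (smoothMat_iff.1 hS.smooth p) 1 0).neg

/-- `H` is a matrix entry of `S`, hence smooth also where `x` is infinite. There `S` preserves the
line that `g` maps to the span of `(1, 0)`, which kills this entry. -/
theorem meanH_eq_zero_of_toInfinity (hS : IsMeanCurvatureSphere f S) {p : M}
    (hp : ToInfinity g (f p)) : meanH g S p = 0 := by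
  have h1 : (((g⁻¹ : Matˣ) : Mat) *ᵥ ![1, 0] : V) ∈ (f p).submodule := by
    rw [mem_iff_infinity hp, mulVec_inv_mulVec]; rfl
  have h2 := Submodule.mem_map_of_mem (f := matEnd (S p)) h1
  rw [hS.maps p] at h2
  have h3 := (mem_iff_infinity hp).1 h2
  change ((g : Mat) *ᵥ (S p *ᵥ _)) 1 = 0 at h3
  rw [← conjMat_mulVec, mulVec_inv_mulVec, mulVec_one_entry] at h3
  simpa [meanH] using h3

/-- If `H = 0`, then `0` is a Lagrange multiplier. -/
theorem multiplier_zero_of_meanH_eq_zero (hf : IsConformalImmersion f)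
    (hS : IsMeanCurvatureSphere f S) (hH : ∀ p, meanH g S p = 0) :
    IsLagrangeMultiplier f S (fun _ => 0) ∧ ∀ (p : M) (X : Tan p),
      totalForm S (fun _ => 0) p X *ᵥ (((g⁻¹ : Matˣ) : Mat) *ᵥ ![1, 0]) = 0 := by
  have hF := hS.frame hf g
  have hm : ∀ p, conjMat g S p 1 0 = 0 := fun p => neg_eq_zero.1 (hH p)
  have hdm : ∀ (p : M) (X : Tan p), dMat (conjMat g S) p X 1 0 = 0 := fun p X => by
    have h := dQ_congr (F := fun q => conjMat g S q 1 0) (G := fun _ => 0) (p := p)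
      (Filter.Eventually.of_forall hm) X
    rw [dQ_const] at h
    exact h
  have hdH : ∀ (p : M) (X : Tan p), dQ (meanH g S) p X = 0 := fun p X => by
    rw [dQ_congr (G := fun _ => 0) (Filter.Eventually.of_forall hH), dQ_const]
  have hsm0 : SmoothForm fun (p : M) (X : Tan p) => (0 : Tan p →ₗ[ℝ] Mat) X :=
    fun e he v i j => contDiffOn_const (c := (0 : ℍ[ℝ]))
  have hsm := smoothForm_totalForm hS.smooth hsm0
  have hker : ∀ (p : M) (X : Tan p),
      totalForm S (fun _ => 0) p X *ᵥ (((g⁻¹ : Matˣ) : Mat) *ᵥ ![1, 0]) = 0 := by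
    refine mulVec_eq_zero_of_dense hsm (dense_finiteSet (g := g) hf) fun p hp X => ?_
    -- With `H = 0` the matrices of `S` and `∇S` are upper triangular, so `A` sends `(1, 0)` to a
    -- vector with second coordinate zero. Its values also lie in `L`, where such a vector is zero.
    have h1 : ((g : Mat) *ᵥ (hopfA S p (rot X) *ᵥ (((g⁻¹ : Matˣ) : Mat) *ᵥ ![1, 0]))) 1 = 0 := by
      rw [hopfA_conj (smoothMat_iff.1 hS.smooth p), mulVec_inv_mulVec, Pi.smul_apply,
        Pi.add_apply, mulVec_one_entry, mulVec_one_entry, mulVec_one_entry, hm, hdm, hdm]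
      simp
    have h2 := theta_hopfA hf hS hp (rot X) (((g⁻¹ : Matˣ) : Mat) *ᵥ ![1, 0])
    rw [theta, h1, mul_zero, sub_zero] at h2
    refine mulVec_injective g ?_
    rw [totalForm, LinearMap.zero_apply, add_zero, Matrix.smul_mulVec, Matrix.mulVec_smul,
      Matrix.mulVec_zero, vec_ext (v := (g : Mat) *ᵥ (hopfA S p (rot X) *ᵥ _)) (w := 0) h2 h1,
      smul_zero]
  refine ⟨⟨hsm0, fun p X v => ?_, fun p X v _ => ?_, ?_⟩, hker⟩
  · rw [LinearMap.zero_apply, Matrix.zero_mulVec]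
    exact Submodule.zero_mem _
  · rw [LinearMap.zero_apply, Matrix.zero_mulVec]
  · refine closedForm_of_dense hsm (dense_finiteSet (g := g) hf) fun e he q hq hqU => ?_
    have hC : ∀ x ∈ finiteSet f g, ∀ X : Tan x, totalForm S (fun _ => 0) x X =
        kernelForm g (coord f g) (normalR f g S) (meanH g S) x X := fun x hx X =>
      totalForm_eq_kernelForm (η := fun _ => 0) hf hS (fun p X v _ => by
        rw [LinearMap.zero_apply, Matrix.zero_mulVec]) hx (hker x X)
    have h : ∀ v, along (totalForm S fun _ => 0) e v =ᶠ[nhds q]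
        along (kernelForm g (coord f g) (normalR f g S) (meanH g S)) e v := fun v =>
      Filter.eventually_of_mem ((isOpen_finiteSet hf).mem_nhds hqU) fun x hx =>
        hC x hx _
    change dMat (along (totalForm S fun _ => 0) e Complex.I) q _ =
      dMat (along (totalForm S fun _ => 0) e 1) q _
    rw [dMat_congr (h _), dMat_congr (h _)]
    exact hF.kernelForm_closed (fun p _ X => by rw [hdH, hdH, zero_mul, zero_mul]) he hqU hq

variable [ConnectedSpace M]

theorem dQ_meanH_eq_zero (hf : IsConformalImmersion f) (hS : IsMeanCurvatureSphere f S)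
    (hη : IsLagrangeMultiplier f S η)
    (hk : ∀ (p : M) (X : Tan p), totalForm S η p X *ᵥ (((g⁻¹ : Matˣ) : Mat) *ᵥ ![1, 0]) = 0)
    (him : ∀ p ∈ finiteSet f g, (coord f g p).re = 0) (p : M) (X : Tan p) :
    dQ (meanH g S) p X = 0 :=
  dQ_eq_zero_of_dense (dense_finiteSet (g := g) hf) (smAt_meanH hS) (fun _ hp X =>
    (hS.frame hf g).dH_eq_zero_of_im (fun q hq => re_eq_zero_iff_star.1 (him q hq)) hp
      (dH_wedge_dx_of_multiplier hf hS hη hk hp X)) p X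

theorem isCMCEuclidean_of_multiplier (hf : IsConformalImmersion f)
    (hS : IsMeanCurvatureSphere f S) (hη : IsLagrangeMultiplier f S η)
    (hk : ∀ (p : M) (X : Tan p), totalForm S η p X *ᵥ (((g⁻¹ : Matˣ) : Mat) *ᵥ ![1, 0]) = 0)
    (him : ∀ p ∈ finiteSet f g, (coord f g p).re = 0) : IsCMCEuclidean f := by
  have hF := hS.frame hf g
  have him' : ∀ q ∈ finiteSet f g, star (coord f g q) = -coord f g q :=
    fun q hq => re_eq_zero_iff_star.1 (him q hq)
  obtain ⟨p₀⟩ : Nonempty M := inferInstance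
  have hc := eq_const_of_dQ_eq_zero (smAt_meanH hS) (dQ_meanH_eq_zero hf hS hη hk him) p₀
  have hsN := fun p hp => star_eq_neg_of_sq (hF.N_sq p hp)
  refine ⟨g, him, normalN f g S, -(meanH g S p₀).re,
    fun p hp => re_eq_zero_iff_star.2 (hsN p hp),
    fun p hp => (hF.smN p hp).contMDiffWithinAt, fun p hp => norm_eq_one_of_sq (hF.N_sq p hp),
    fun p hp X => inner_of_anticommute (hF.star_dx_of_im him' hp X) (hsN p hp)
      (hF.anticommute_of_im him' hp X), fun p hp X => ?_⟩
  refine (hF.mean_left hp X).trans ?_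
  rw [hc p]
  simp only [neg_mul_neg]
  rfl

/-- Constant mean curvature makes `H` constant. Either `∞` is never reached and `kernelForm` is
globally defined, or `H` vanishes at one point, hence everywhere, and the zero multiplier works. -/
theorem IsCMCEuclidean.exists_multiplier (hf : IsConformalImmersion f) (h : IsCMCEuclidean f)
    (hS : IsMeanCurvatureSphere f S) :
    ∃ (g : Matˣ) (η : Form M), IsLagrangeMultiplier f S η ∧
      (∀ (p : M) (X : Tan p), totalForm S η p X *ᵥ (((g⁻¹ : Matˣ) : Mat) *ᵥ ![1, 0]) = 0) ∧
      ∀ p ∈ finiteSet f g, (coord f g p).re = 0 := by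
  obtain ⟨g, him, n, h, hn, hc⟩ := h
  have hF := hS.frame hf g
  have hd := dense_finiteSet (g := g) hf
  have him' : ∀ q ∈ finiteSet f g, star (coord f g q) = -coord f g q :=
    fun q hq => re_eq_zero_iff_star.1 (him q hq)
  have hcont : Continuous (meanH g S) :=
    continuous_iff_continuousAt.2 fun p => (smAt_meanH hS p).continuousAt
  have hcre : Continuous fun p => (meanH g S p).re := Quaternion.continuous_re.comp hcont
  have hreal : ∀ p, meanH g S p = ((meanH g S p).re : ℍ[ℝ]) := fun p =>
    sub_eq_zero.1 (eq_zero_of_dense (F := fun q => meanH g S q - ((meanH g S q).re : ℍ[ℝ])) hd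
      (hcont.sub (Quaternion.continuous_coe.comp hcre)).continuousAt
      (Filter.Eventually.of_forall fun q hq => sub_eq_zero.2 (hF.H_real_of_im him' hq)))
  have hsq : ∀ p, (meanH g S p).re ^ 2 = h ^ 2 := fun p =>
    sub_eq_zero.1 (eq_zero_of_dense (F := fun q => (meanH g S q).re ^ 2 - h ^ 2) hd
      ((hcre.pow 2).sub continuous_const).continuousAt
      (Filter.Eventually.of_forall fun q hq => sub_eq_zero.2 (hF.sq_re_H_of_cmc him' hn hc hq)))
  have hconst : ∀ p q, meanH g S p = meanH g S q := fun p q => by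
    rw [hreal p, hreal q, eq_const_of_sq_eq_const hcre hsq p q]
  refine ⟨g, ?_⟩
  by_cases hfin : ∀ p, p ∈ finiteSet f g
  · have hdH : ∀ (p : M) (X : Tan p), dQ (meanH g S) p X = 0 := fun p X => by
      rw [dQ_congr (G := fun _ => meanH g S p) (Filter.Eventually.of_forall fun q => hconst q p),
        dQ_const]
    obtain ⟨η, hη, hk⟩ := QSurf.exists_multiplier hf hS hfin
      fun p X => by rw [hdH, hdH, zero_mul, zero_mul]
    exact ⟨η, hη, hk, him⟩
  · push Not at hfin
    obtain ⟨p, hp⟩ := hfin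
    have h0 : ∀ q, meanH g S q = 0 := fun q =>
      (hconst q p).trans (meanH_eq_zero_of_toInfinity hS (not_not.1 hp))
    obtain ⟨h1, h2⟩ := multiplier_zero_of_meanH_eq_zero hf hS h0
    exact ⟨_, h1, h2, him⟩

theorem isCMCSpherical_of_multiplier (hf : IsConformalImmersion f)
    (hS : IsMeanCurvatureSphere f S) (hη : IsLagrangeMultiplier f S η)
    (hk : ∀ (p : M) (X : Tan p), totalForm S η p X *ᵥ (((g⁻¹ : Matˣ) : Mat) *ᵥ ![1, 0]) = 0)
    (hfin : ∀ p, p ∈ finiteSet f g) (hsp : ∀ p, star (coord f g p) * coord f g p = 1) :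
    IsCMCSpherical f := by
  have hF := hS.frame hf g
  have hsp' : ∀ p ∈ finiteSet f g, star (coord f g p) * coord f g p = 1 := fun p _ => hsp p
  have hnorm : ∀ p, ‖coord f g p‖ = 1 := fun p => norm_eq_one_of_star_mul (hsp p)
  obtain ⟨p₀⟩ : Nonempty M := inferInstance
  have hc := eq_const_of_dQ_eq_zero (fun p => hF.smAt_k (hfin p)) (fun p X =>
    hF.dk_eq_zero hsp' (hfin p) X (dH_wedge_dx_of_multiplier hf hS hη hk (hfin p) X)) p₀
  have hsR := fun p => star_eq_neg_of_sq (hF.R_sq p (hfin p))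
  refine ⟨g, fun p => ⟨hfin p, hnorm p⟩, fun p => coord f g p * normalR f g S p,
    -(meanH g S p₀ * coord f g p₀ - normalR f g S p₀).re, fun p => ?_,
    fun p _ => ((hF.smx p (hfin p)).mul (hF.smR p (hfin p))).contMDiffWithinAt, fun p _ => ?_,
    fun p _ X => ?_, fun p _ X => ?_⟩
  · have h1 := inner_mul_left_of_unit (b := 1) (c := normalR f g S p) (hsp p)
    rw [mul_one, Quaternion.inner_def 1, one_mul, Quaternion.re_star,
      re_eq_zero_iff_star.2 (hsR p)] at h1
    exact h1
  · rw [norm_mul, hnorm, one_mul, norm_eq_one_of_sq (hF.R_sq p (hfin p))]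
  · change inner ℝ (dQ (coord f g) p X) _ = 0
    rw [Frame.dx_eq_of_sphere hsp' (hfin p), inner_mul_left_of_unit (hsp p)]
    exact inner_of_anticommute (hF.star_alpha hsp' (hfin p) X) (hsR p)
      (hF.alpha_mul_R hsp' (hfin p) X)
  · refine (hF.mean_sphere hsp' (hfin p) X).trans ?_
    rw [hc p]
    simp only [neg_mul_neg]
    rfl

theorem IsCMCSpherical.exists_multiplier (hf : IsConformalImmersion f) (h : IsCMCSpherical f)
    (hS : IsMeanCurvatureSphere f S) :
    ∃ (g : Matˣ) (η : Form M), IsLagrangeMultiplier f S η ∧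
      (∀ (p : M) (X : Tan p), totalForm S η p X *ᵥ (((g⁻¹ : Matˣ) : Mat) *ᵥ ![1, 0]) = 0) ∧
      ∀ p, p ∈ finiteSet f g ∧ star (coord f g p) * coord f g p = 1 := by
  obtain ⟨g, hg, n, h, hn, hc⟩ := h
  have hF := hS.frame hf g
  have hfin : ∀ p, p ∈ finiteSet f g := fun p => (hg p).1
  have hsp : ∀ p, star (coord f g p) * coord f g p = 1 := fun p => by
    rw [Quaternion.star_mul_self, Quaternion.normSq_eq_norm_mul_self]
    have h1 : ‖coord f g p‖ = 1 := (hg p).2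
    rw [h1, mul_one, Quaternion.coe_one]
  have hsp' : ∀ p ∈ finiteSet f g, star (coord f g p) * coord f g p = 1 := fun p _ => hsp p
  have hU : finiteSet f g = Set.univ := Set.eq_univ_of_forall hfin
  have hsq : ∀ p, (meanH g S p * coord f g p - normalR f g S p).re ^ 2 = h ^ 2 := fun p =>
    hF.sq_k_of_cmc hsp' (fun q _ => hn q) (by rw [hU]; exact hc) (hfin p)
  have hcre : Continuous fun p => (meanH g S p * coord f g p - normalR f g S p).re :=
    Quaternion.continuous_re.comp
      (continuous_iff_continuousAt.2 fun p => (hF.smAt_k (hfin p)).continuousAt)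
  have hdk : ∀ (p : M) (X : Tan p),
      dQ (fun q => meanH g S q * coord f g q - normalR f g S q) p X = 0 := fun p X => by
    rw [dQ_congr (G := fun _ => meanH g S p * coord f g p - normalR f g S p)
      (Filter.Eventually.of_forall fun q => by
        rw [hF.H_mul_x hsp' (hfin q), hF.H_mul_x hsp' (hfin p),
          eq_const_of_sq_eq_const hcre hsq q p]), dQ_const]
  obtain ⟨η, hη, hk⟩ := QSurf.exists_multiplier hf hS hfin fun p X => by
    rw [← sub_eq_zero, hF.wedge_sphere hsp' (hfin p), hdk, hdk, zero_mul, sub_zero, zero_mul]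
  exact ⟨g, η, hη, hk, fun p => ⟨hfin p, hsp p⟩⟩

end Multiplier

end QSurf

/-! ### Normal forms of round 3-spheres relative to a point. -/

namespace QSurf

/-- The preimage of `Im ℍ ∪ {∞}` under the Möbius transformation `g`. -/
def imSphere (g : Matˣ) : Set HP1 :=
  {ℓ | ∀ v ∈ ℓ.submodule, star (((g : Mat) *ᵥ v) 0) * ((g : Mat) *ᵥ v) 1 +
    star (((g : Mat) *ᵥ v) 1) * ((g : Mat) *ᵥ v) 0 = 0}

/-- The preimage of the unit sphere `S³ ⊂ ℍ` under the Möbius transformation `g`. -/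
def unitSphere (g : Matˣ) : Set HP1 :=
  {ℓ | ∀ v ∈ ℓ.submodule, star (((g : Mat) *ᵥ v) 0) * ((g : Mat) *ᵥ v) 0 -
    star (((g : Mat) *ᵥ v) 1) * ((g : Mat) *ᵥ v) 1 = 0}

theorem affine_mem {g : Matˣ} {ℓ : HP1} (hℓ : ¬ToInfinity g ℓ) :
    ((g⁻¹ : Matˣ) : Mat) *ᵥ ![affineCoord g ℓ, 1] ∈ ℓ.submodule := by
  rw [mem_iff_affine hℓ, mulVec_inv_mulVec]
  simp

theorem mem_imSphere_of_toInfinity {g : Matˣ} {ℓ : HP1} (hℓ : ToInfinity g ℓ) :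
    ℓ ∈ imSphere g := by
  intro v hv
  rw [mem_iff_infinity hℓ] at hv
  rw [hv, star_zero, mul_zero, zero_mul, add_zero]

theorem mem_imSphere_iff {g : Matˣ} {ℓ : HP1} (hℓ : ¬ToInfinity g ℓ) :
    ℓ ∈ imSphere g ↔ (affineCoord g ℓ).re = 0 := by
  rw [re_eq_zero_iff_star]
  constructor
  · intro h
    have h1 := h _ (affine_mem hℓ)
    rw [mulVec_inv_mulVec] at h1
    simp only [Matrix.cons_val_zero, Matrix.cons_val_one, star_one, mul_one, one_mul] at h1
    exact eq_neg_of_add_eq_zero_left h1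
  · intro h v hv
    rw [mem_iff_affine hℓ] at hv
    rw [hv, star_mul, h]
    noncomm_ring

theorem mem_unitSphere_iff {g : Matˣ} {ℓ : HP1} : ℓ ∈ unitSphere g ↔
    ¬ToInfinity g ℓ ∧ star (affineCoord g ℓ) * affineCoord g ℓ = 1 := by
  constructor
  · intro h
    have hℓ : ¬ToInfinity g ℓ := by
      intro hi
      have h1 := h (((g⁻¹ : Matˣ) : Mat) *ᵥ ![1, 0])
        (by rw [mem_iff_infinity hi, mulVec_inv_mulVec]; rfl)
      rw [mulVec_inv_mulVec] at h1
      simp at h1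
    refine ⟨hℓ, ?_⟩
    have h1 := h _ (affine_mem hℓ)
    rw [mulVec_inv_mulVec] at h1
    simp only [Matrix.cons_val_zero, Matrix.cons_val_one, star_one, mul_one] at h1
    exact sub_eq_zero.1 h1
  · rintro ⟨hℓ, h⟩ v hv
    rw [mem_iff_affine hℓ] at hv
    rw [hv, star_mul]
    linear_combination (norm := noncomm_ring)
      star (((g : Mat) *ᵥ v) 1) * h * ((g : Mat) *ᵥ v) 1

theorem star_dotProduct_conj (B C : Mat) (v : V) :
    star v ⬝ᵥ ((Cᴴ * B * C) *ᵥ v) = star (C *ᵥ v) ⬝ᵥ (B *ᵥ (C *ᵥ v)) := by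
  rw [mul_assoc, ← Matrix.mulVec_mulVec, ← Matrix.mulVec_mulVec, Matrix.dotProduct_mulVec,
    ← Matrix.star_mulVec]

theorem star_dotProduct_fin_two (a b c d : ℍ[ℝ]) (v : V) :
    star v ⬝ᵥ (!![a, b; c, d] *ᵥ v) =
      star (v 0) * (a * v 0 + b * v 1) + star (v 1) * (c * v 0 + d * v 1) := by
  rw [dotProduct, Fin.sum_univ_two, mulVec_zero_entry, mulVec_one_entry]
  rfl

theorem isHermitian_fin_two {a b c d : ℍ[ℝ]} (ha : star a = a) (hb : star b = c)
    (hd : star d = d) : (!![a, b; c, d] : Mat).IsHermitian := by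
  refine mat_ext ?_ ?_ ?_ ?_
  · exact ha
  · change star c = b
    rw [← hb, star_star]
  · exact hb
  · exact hd

theorem isRoundThreeSphere_imSphere (g : Matˣ) : IsRoundThreeSphere (imSphere g) := by
  have key : ∀ v : V, star v ⬝ᵥ (((g : Mat)ᴴ * !![0, 1; 1, 0] * (g : Mat)) *ᵥ v) =
      star (((g : Mat) *ᵥ v) 0) * ((g : Mat) *ᵥ v) 1 +
        star (((g : Mat) *ᵥ v) 1) * ((g : Mat) *ᵥ v) 0 := fun v => by
    rw [star_dotProduct_conj, star_dotProduct_fin_two]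
    noncomm_ring
  refine ⟨(g : Mat)ᴴ * !![0, 1; 1, 0] * (g : Mat),
    Matrix.isHermitian_conjTranspose_mul_mul _ (isHermitian_fin_two (by simp) (by simp) (by simp)),
    ⟨((g⁻¹ : Matˣ) : Mat) *ᵥ ![1, 1], ?_⟩, ⟨((g⁻¹ : Matˣ) : Mat) *ᵥ ![1, -1], ?_⟩, ?_⟩
  · rw [key, mulVec_inv_mulVec]; simp
  · rw [key, mulVec_inv_mulVec]; simp
  · simp only [key]; rfl

theorem isRoundThreeSphere_unitSphere (g : Matˣ) : IsRoundThreeSphere (unitSphere g) := by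
  have key : ∀ v : V, star v ⬝ᵥ (((g : Mat)ᴴ * !![1, 0; 0, -1] * (g : Mat)) *ᵥ v) =
      star (((g : Mat) *ᵥ v) 0) * ((g : Mat) *ᵥ v) 0 -
        star (((g : Mat) *ᵥ v) 1) * ((g : Mat) *ᵥ v) 1 := fun v => by
    rw [star_dotProduct_conj, star_dotProduct_fin_two]
    noncomm_ring
  refine ⟨(g : Mat)ᴴ * !![1, 0; 0, -1] * (g : Mat),
    Matrix.isHermitian_conjTranspose_mul_mul _ (isHermitian_fin_two (by simp) (by simp) (by simp)),
    ⟨((g⁻¹ : Matˣ) : Mat) *ᵥ ![1, 0], ?_⟩, ⟨((g⁻¹ : Matˣ) : Mat) *ᵥ ![0, 1], ?_⟩, ?_⟩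
  · rw [key, mulVec_inv_mulVec]; simp
  · rw [key, mulVec_inv_mulVec]; simp
  · simp only [key]; rfl

/-- The invertible upper triangular matrices. -/
def upperUnit (a b d : ℍ[ℝ]) (ha : a ≠ 0) (hd : d ≠ 0) : Matˣ where
  val := !![a, b; 0, d]
  inv := !![a⁻¹, -(a⁻¹ * b * d⁻¹); 0, d⁻¹]
  val_inv := by
    rw [Matrix.mul_fin_two, Matrix.one_fin_two]
    simp [← mul_assoc, ha, hd]
  inv_val := by
    rw [Matrix.mul_fin_two, Matrix.one_fin_two]
    simp [mul_assoc, ha, hd]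

theorem upperUnit_mulVec_zero {a b d : ℍ[ℝ]} (ha : a ≠ 0) (hd : d ≠ 0) (v : V) :
    ((upperUnit a b d ha hd : Mat) *ᵥ v) 0 = a * v 0 + b * v 1 := mulVec_zero_entry _ _

theorem upperUnit_mulVec_one {a b d : ℍ[ℝ]} (ha : a ≠ 0) (hd : d ≠ 0) (v : V) :
    ((upperUnit a b d ha hd : Mat) *ᵥ v) 1 = d * v 1 := by
  rw [mulVec_one_entry]
  simp [upperUnit]

theorem exists_toInfinity_of_line (ℓ : HP1) : ∃ g : Matˣ, ToInfinity g ℓ := by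
  by_cases h : ToInfinity 1 ℓ
  · exact ⟨1, h⟩
  refine ⟨swapUnit * upperUnit 1 (-affineCoord 1 ℓ) 1 one_ne_zero one_ne_zero, ?_⟩
  have h1 := (mem_iff_affine h).1 (rep_mem ℓ)
  simp only [Units.val_one, Matrix.one_mulVec] at h1
  rw [ToInfinity, Units.val_mul, ← Matrix.mulVec_mulVec, mulVec_one_entry]
  change (1 : ℍ[ℝ]) * ((!![1, -affineCoord 1 ℓ; 0, 1] : Mat) *ᵥ ℓ.rep) 0 + 0 * _ = 0
  rw [mulVec_zero_entry]
  simp [h1]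

theorem toInfinity_mul_upperUnit {g : Matˣ} {ℓ : HP1} (h : ToInfinity g ℓ) {a b d : ℍ[ℝ]}
    (ha : a ≠ 0) (hd : d ≠ 0) : ToInfinity (upperUnit a b d ha hd * g) ℓ := by
  rw [ToInfinity, Units.val_mul, ← Matrix.mulVec_mulVec, mulVec_one_entry]
  rw [ToInfinity] at h
  simp [upperUnit, h]

/-- A hermitian form in a frame in which a given line is `∞`. -/
theorem exists_hermitian_frame {K : Set HP1} (hK : IsRoundThreeSphere K) {g : Matˣ} {ℓ : HP1}
    (hg : ToInfinity g ℓ) : ∃ (r s : ℝ) (c : ℍ[ℝ]) (F : V → ℍ[ℝ]),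
      (∀ v, F v = star (v 0) * (r * v 0 + c * v 1) + star (v 1) * (star c * v 0 + s * v 1)) ∧
      (∃ v, 0 < (F v).re) ∧ (∃ v, (F v).re < 0) ∧ (r = 0 ↔ ℓ ∈ K) ∧
      ∀ ℓ', ℓ' ∈ K ↔ ∀ v ∈ ℓ'.submodule, F ((g : Mat) *ᵥ v) = 0 := by
  obtain ⟨G, hG, ⟨v₁, h₁⟩, ⟨v₂, h₂⟩, rfl⟩ := hK
  set g' : Mat := ((g⁻¹ : Matˣ) : Mat)
  have hB := Matrix.isHermitian_conjTranspose_mul_mul g' hG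
  set B := g'ᴴ * G * g' with hBdef
  have hBv : ∀ v, star v ⬝ᵥ (G *ᵥ v) = star ((g : Mat) *ᵥ v) ⬝ᵥ (B *ᵥ ((g : Mat) *ᵥ v)) :=
    fun v => by rw [hBdef, star_dotProduct_conj, inv_mulVec_mulVec]
  have h00 := Quaternion.star_eq_self.1 (hB.apply 0 0)
  have h11 := Quaternion.star_eq_self.1 (hB.apply 1 1)
  have hF : ∀ v : V, star v ⬝ᵥ (B *ᵥ v) = star (v 0) * (((B 0 0).re : ℍ[ℝ]) * v 0 + B 0 1 * v 1) +
      star (v 1) * (star (B 0 1) * v 0 + ((B 1 1).re : ℍ[ℝ]) * v 1) := fun v => by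
    rw [← h00, ← h11, hB.apply 1 0, dotProduct, Fin.sum_univ_two, mulVec_zero_entry,
      mulVec_one_entry]
    rfl
  refine ⟨(B 0 0).re, (B 1 1).re, B 0 1, fun v => star v ⬝ᵥ (B *ᵥ v), hF,
    ⟨_, (hBv v₁) ▸ h₁⟩, ⟨_, (hBv v₂) ▸ h₂⟩, ?_, fun ℓ' => ?_⟩
  · constructor
    · intro h0 v hv
      rw [mem_iff_infinity hg] at hv
      rw [hBv, hF, hv, h0]
      simp
    · intro h
      have h1 := h (g' *ᵥ ![1, 0]) (by rw [mem_iff_infinity hg, mulVec_inv_mulVec]; rfl)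
      rw [hBv, mulVec_inv_mulVec, hF] at h1
      refine Quaternion.coe_injective ?_
      simpa using h1
  · refine forall₂_congr fun v _ => ?_
    rw [hBv]

theorem exists_imSphere {K : Set HP1} (hK : IsRoundThreeSphere K) {ℓ : HP1} (hℓ : ℓ ∈ K) :
    ∃ g : Matˣ, ToInfinity g ℓ ∧ K = imSphere g := by
  obtain ⟨g, hg⟩ := exists_toInfinity_of_line ℓ
  obtain ⟨r, s, c, F, hF, ⟨v₁, h₁⟩, ⟨v₂, h₂⟩, hr, hKF⟩ := exists_hermitian_frame hK hg
  have hr0 := hr.2 hℓ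
  -- With `r = c = 0` the form would be `s |v 1|²`, which is semidefinite.
  have hc : c ≠ 0 := by
    rintro rfl
    have hFs : ∀ v, (F v).re = s * ‖v 1‖ ^ 2 := fun v => by
      rw [hF, hr0, ← Quaternion.re_coe s, pow_two, ← Quaternion.normSq_eq_norm_mul_self]
      simp only [Quaternion.coe_zero, zero_mul, star_zero, add_zero, mul_zero, zero_add,
        Quaternion.re_coe]
      rw [coe_comm', ← mul_assoc, Quaternion.star_mul_self, ← Quaternion.coe_mul,
        Quaternion.re_coe, mul_comm]
    rw [hFs] at h₁ h₂
    nlinarith [pos_of_mul_pos_left h₁ (sq_nonneg _), mul_nonneg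
      (pos_of_mul_pos_left h₁ (sq_nonneg _)).le (sq_nonneg ‖v₂ 1‖)]
  have hcs : star c ≠ 0 := star_ne_zero.2 hc
  -- The new first coordinate `c̄ w₀ + (s/2) w₁` splits the term `s |w₁|²` evenly between the two
  -- mixed products. Upper triangular matrices keep `ℓ` at `∞`.
  refine ⟨upperUnit (star c) ((s / 2 : ℝ) : ℍ[ℝ]) 1 hcs one_ne_zero * g,
    toInfinity_mul_upperUnit hg hcs one_ne_zero, Set.ext fun ℓ' => ?_⟩
  rw [hKF]
  refine forall₂_congr fun v _ => ?_
  have hs : (s : ℍ[ℝ]) = ((s / 2 : ℝ) : ℍ[ℝ]) + ((s / 2 : ℝ) : ℍ[ℝ]) := by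
    rw [← Quaternion.coe_add, add_halves]
  rw [Units.val_mul, ← Matrix.mulVec_mulVec, upperUnit_mulVec_zero, upperUnit_mulVec_one, hF, hr0,
    hs]
  generalize (g : Mat) *ᵥ v = w
  simp only [star_add, star_mul, star_star, Quaternion.star_coe, zero_mul, one_mul, zero_add,
    Quaternion.coe_zero]
  have e : ∀ a b t : ℍ[ℝ], star a * (c * b) + star b * (star c * a + (t + t) * b) =
    (star a * c + star b * t) * b + star b * (star c * a + t * b) := fun a b t => by
      noncomm_ring
  rw [e]

theorem exists_unitSphere {K : Set HP1} (hK : IsRoundThreeSphere K) {ℓ : HP1} (hℓ : ℓ ∉ K) :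
    ∃ g : Matˣ, ToInfinity g ℓ ∧ K = unitSphere g := by
  obtain ⟨g, hg⟩ := exists_toInfinity_of_line ℓ
  obtain ⟨r, s, c, F, hF, ⟨v₁, h₁⟩, ⟨v₂, h₂⟩, hr, hKF⟩ := exists_hermitian_frame hK hg
  have hr0 : r ≠ 0 := fun h => hℓ (hr.1 h)
  have hrq : (r : ℍ[ℝ]) ≠ 0 := fun h => hr0 (Quaternion.coe_injective h)
  -- Completing the square: the form is `r (|v₀ + a v₁|² + t |v₁|²)`. Indefiniteness forces `t < 0`,
  -- and scaling `v₁` by `√(-t)` gives the unit sphere.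
  obtain ⟨a, ha⟩ : ∃ a : ℍ[ℝ], a = ((r⁻¹ : ℝ) : ℍ[ℝ]) * c := ⟨_, rfl⟩
  set t : ℝ := s / r - ‖a‖ ^ 2 with ht
  have hFt : ∀ v, F v = r * (star (v 0 + a * v 1) * (v 0 + a * v 1) +
      t * (star (v 1) * v 1)) := fun v => by
    have hc : c = r * a := by
      rw [ha, ← mul_assoc, ← Quaternion.coe_mul, mul_inv_cancel₀ hr0, Quaternion.coe_one, one_mul]
    have hs : (s : ℍ[ℝ]) = r * (t + star a * a) := by
      rw [Quaternion.star_mul_self, Quaternion.normSq_eq_norm_mul_self, ← Quaternion.coe_add,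
        ← Quaternion.coe_mul]
      congr 1
      rw [ht]
      field_simp
      ring
    rw [hF, hs, hc, star_add, star_mul, star_mul, Quaternion.star_coe]
    have e1 := coe_comm' r
    have e2 := coe_comm' t
    linear_combination (norm := noncomm_ring)
      -e1 (star (v 0)) * (v 0 + a * v 1) - e1 (star (v 1) * star a) * v 0 -
      e1 (star (v 1)) * (t + star a * a) * v 1 - r * e2 (star (v 1)) * v 1
  have hFre : ∀ v, (F v).re = r * (‖v 0 + a * v 1‖ ^ 2 + t * ‖v 1‖ ^ 2) := fun v => by
    rw [hFt, Quaternion.star_mul_self, Quaternion.star_mul_self, ← Quaternion.coe_mul,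
      ← Quaternion.coe_add, ← Quaternion.coe_mul, Quaternion.re_coe,
      Quaternion.normSq_eq_norm_mul_self, Quaternion.normSq_eq_norm_mul_self, pow_two, pow_two]
  have ht0 : t < 0 := by
    by_contra hneg
    rw [hFre] at h₁ h₂
    have hp : ∀ v : V, 0 ≤ ‖v 0 + a * v 1‖ ^ 2 + t * ‖v 1‖ ^ 2 := fun v =>
      add_nonneg (sq_nonneg _) (mul_nonneg (not_lt.1 hneg) (sq_nonneg _))
    have h3 := pos_of_mul_pos_left h₁ (hp v₁)
    exact absurd h₂ (not_lt.2 (mul_nonneg h3.le (hp v₂)))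
  set u : ℝ := Real.sqrt (-t) with hu
  have hu2 : u * u = -t := Real.mul_self_sqrt (by linarith)
  have hu0 : (u : ℍ[ℝ]) ≠ 0 := fun h => (Real.sqrt_pos.2 (neg_pos.2 ht0)).ne'
    (Quaternion.coe_injective h)
  refine ⟨upperUnit 1 a u one_ne_zero hu0 * g, toInfinity_mul_upperUnit hg one_ne_zero hu0,
    Set.ext fun ℓ' => ?_⟩
  rw [hKF]
  refine forall₂_congr fun v _ => ?_
  rw [Units.val_mul, ← Matrix.mulVec_mulVec, upperUnit_mulVec_zero, upperUnit_mulVec_one, hFt,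
    mul_eq_zero, or_iff_right hrq, one_mul]
  generalize (g : Mat) *ᵥ v = w
  have htu : (t : ℍ[ℝ]) = -(u * u) := by
    rw [← Quaternion.coe_mul, hu2, Quaternion.coe_neg, neg_neg]
  have e : star (w 1) * u * (u * w 1) = u * u * (star (w 1) * w 1) := by
    rw [← coe_comm', mul_assoc, ← mul_assoc (star (w 1)), ← coe_comm']
    noncomm_ring
  rw [star_mul (u : ℍ[ℝ]), Quaternion.star_coe, e, htu, neg_mul, sub_eq_add_neg]

end QSurf

/-! ### A non-umbilic CMC surface in `S³` with two competing frames. -/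

namespace QSurf

variable {M : Type*} [TopologicalSpace M] [ChartedSpace ℂ M] [IsManifold 𝓘(ℂ, ℂ) ω M]

section Spherical

variable {U : Set M} {x N R H : M → ℍ[ℝ]} {p : M}

/-- The commutant of `R` is spanned over `ℝ` by `1` and `R`; moving `a` across changes the sign of
the `R` part, which is conjugation. -/
theorem mul_eq_star_mul_of_commute {y R a : ℍ[ℝ]} (hR : R * R = -1) (h : y * R = R * y)
    (ha : a * R = -(R * a)) : a * y = star y * a := by
  obtain ⟨s, t, rfl⟩ := exists_eq_add_mul_of_commute hR h
  have e1 := coe_comm' s a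
  have e2 := coe_comm' t a
  have e3 := coe_comm' t R
  rw [star_add, star_mul, Quaternion.star_coe, Quaternion.star_coe, star_eq_neg_of_sq hR]
  linear_combination (norm := noncomm_ring) -e1 - e2 * R + t * ha - e3 * a

/-- Exchanging `y` for its conjugate across both `a` and `±R a` forces `ȳ`, and hence `y`, to
commute with `R`. -/
theorem commute_of_mul_eq_star_mul {y R a b : ℍ[ℝ]} (hR : R * R = -1) (ha : a ≠ 0)
    (h : a * y = star y * a) (hb : b = R * a ∨ b = -(R * a)) (h' : b * y = star y * b) :
    y * R = R * y := by
  have h1 : R * a * y = star y * (R * a) := by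
    rcases hb with rfl | rfl
    · exact h'
    · rw [neg_mul, mul_neg, neg_inj] at h'
      exact h'
  have h2 : star y * R = R * star y := by
    refine mul_right_cancel₀ ha ?_
    rw [mul_assoc, ← h1, mul_assoc, h, mul_assoc]
  have h3 := congrArg star h2
  rw [star_mul, star_mul, star_star, star_eq_neg_of_sq hR, neg_mul, mul_neg, neg_inj] at h3
  exact h3.symm

theorem Frame.dQ_star_mul (hF : Frame U x N R H) (hsp : ∀ p ∈ U, star (x p) * x p = 1)
    (hp : p ∈ U) (c : ℍ[ℝ]) (X : Tan p) :
    dQ (fun q => star (x q) * c) p X = -(star (x p) * dQ x p X * (star (x p) * c)) := by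
  have h := hF.star_alpha hsp hp X
  rw [star_mul, star_star] at h
  rw [dQ_mul (hF.smx p hp).star (SmAt.const c), dQ_const, mul_zero, add_zero,
    dQ_star (hF.smx p hp)]
  linear_combination (norm := noncomm_ring) h * star (x p) * c -
    star (dQ x p X) * mul_star_of_star_mul (hsp p hp) * c

/-- If the form `dR - H dx` does not vanish at `p`, then `star x * c` cannot commute with the
right normal near `p` unless `c = 0`. -/
theorem Frame.eq_zero_of_commute (hF : Frame U x N R H) (hsp : ∀ p ∈ U, star (x p) * x p = 1)
    (hp : p ∈ U) {c : ℍ[ℝ]}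
    (hy : ∀ᶠ q in nhds p, star (x q) * c * R q = R q * (star (x q) * c)) {X : Tan p}
    (hb : dQ R p X - H p * dQ x p X ≠ 0) : c = 0 := by
  have hX : X ≠ 0 := by
    rintro rfl
    apply hb
    rw [show dQ R p 0 = 0 from map_zero _, show dQ x p 0 = 0 from map_zero _, mul_zero, sub_zero]
  have hR := hF.R_sq p hp
  have hyp := hy.self_of_nhds
  have hsy : SmAt (fun q => star (x q) * c) p := (hF.smx p hp).star.mul (SmAt.const c)
  have hd : ∀ Y : Tan p, dQ (fun q => star (x q) * c) p Y * R p + star (x p) * c * dQ R p Y =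
      dQ R p Y * (star (x p) * c) + R p * dQ (fun q => star (x q) * c) p Y := fun Y => by
    rw [← dQ_mul hsy (hF.smR p hp), ← dQ_mul (hF.smR p hp) hsy]
    exact dQ_congr hy Y
  have hk := hF.H_mul_x hsp hp
  set k : ℍ[ℝ] := ((H p * x p - R p).re : ℍ[ℝ]) with hkd
  have hkc : ∀ a, k * a = a * k := fun a => coe_comm' _ a
  have hHdx : ∀ Y : Tan p, H p * dQ x p Y = (k + R p) * (star (x p) * dQ x p Y) := fun Y => by
    rw [← hk, sub_add_cancel, mul_assoc, ← Frame.dx_eq_of_sphere hsp hp]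
  have hα : ∀ Y : Tan p, star (x p) * dQ x p Y * (star (x p) * c) =
      star (star (x p) * c) * (star (x p) * dQ x p Y) := fun Y =>
    mul_eq_star_mul_of_commute hR hyp (hF.alpha_mul_R hsp hp Y)
  have hβ : ∀ Y : Tan p, (dQ R p Y - H p * dQ x p Y) * (star (x p) * c) =
      star (star (x p) * c) * (dQ R p Y - H p * dQ x p Y) := fun Y =>
    mul_eq_star_mul_of_commute hR hyp (hF.b_mul_R hp Y)
  have hys : star (star (x p) * c) * R p = R p * star (star (x p) * c) := by
    have h3 := congrArg star hyp
    rw [star_mul (star (x p) * c) (R p), star_mul (R p), star_eq_neg_of_sq hR, neg_mul,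
      mul_neg, neg_inj] at h3
    exact h3.symm
  -- Differentiate `y R = R y` for `y = x̄ c`, using `dy = -α y` and `dR = b + (k + R) α`, and move
  -- `y` across `α` and `b` at the cost of a conjugation.
  have key : ∀ Y : Tan p,
      (2 * R p * star (star (x p) * c) + (star (x p) * c - star (star (x p) * c)) * (k + R p)) *
        (star (x p) * dQ x p Y) +
      (star (x p) * c - star (star (x p) * c)) * (dQ R p Y - H p * dQ x p Y) = 0 := by
    intro Y
    have h1 := hd Y
    rw [hF.dQ_star_mul hsp hp] at h1
    have h2 := hα Y
    have h3 := hβ Y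
    have h4 := hF.alpha_mul_R hsp hp Y
    have h5 := hHdx Y
    have h6 := hkc (star (star (x p) * c))
    generalize star (star (x p) * c) = z at *
    generalize star (x p) * c = y at *
    generalize star (x p) * dQ x p Y = α at *
    generalize H p * dQ x p Y = γ at *
    linear_combination (norm := noncomm_ring) -(y - z) * h5 + h1 + h2 * R p + z * h4 - hys * α -
      R p * h2 + h3 + h5 * y + (k + R p) * h2 - z * h5 + h6 * α - hys * α
  -- The two terms have opposite types, as `*α = R α` and `*b = -R b`, and their coefficients
  -- commute with `R`. Evaluation at `X` and `rot X` makes each vanish: first `(y - ȳ) b = 0`, so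
  -- `y` is real, then `2 R ȳ α = 0`.
  have k1 := key X
  have k2 := key (rot X)
  have hαr := hF.alpha_rot hsp hp X
  have hbr := hF.b_rot hp X
  have hα0 := hF.alpha_ne_zero hsp hp hX
  rw [hαr, hbr] at k2
  have h6 := hkc (R p)
  have hzy : star (x p) * c = star (star (x p) * c) := by
    generalize star (star (x p) * c) = z at *
    generalize star (x p) * c = y at *
    generalize star (x p) * dQ x p X = α at *
    generalize dQ R p X - H p * dQ x p X = b at *
    have e1 : (y - z) * R p = R p * (y - z) := by rw [sub_mul, mul_sub, hyp, hys]
    have e2 : (2 * R p * z + (y - z) * (k + R p)) * R p =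
        R p * (2 * R p * z + (y - z) * (k + R p)) := by
      linear_combination (norm := noncomm_ring) 2 * R p * hys + (y - z) * h6 + e1 * (k + R p)
    have e : (y - z) * b + (y - z) * b = 0 := by
      generalize 2 * R p * z + (y - z) * (k + R p) = T at *
      generalize y - z = D at *
      linear_combination (norm := noncomm_ring) k1 + R p * k2 - R p * e2 * α - hR * T * α +
        R p * e1 * b + hR * D * b
    exact sub_eq_zero.1 ((mul_eq_zero.1 (two_mul_eq_zero_quaternion e)).resolve_right hb)
  rw [← hzy, sub_self, zero_mul, add_zero, zero_mul, add_zero] at k1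
  have h7 := (mul_eq_zero.1 k1).resolve_right hα0
  have h8 := (mul_eq_zero.1 h7).resolve_left (mul_ne_zero two_ne_zero_quaternion (ne_zero_of_sq hR))
  refine (mul_eq_zero.1 h8).resolve_left fun h => ?_
  have h9 := hsp p hp
  rw [h, zero_mul] at h9
  exact zero_ne_one h9

/-- Spheres whose equation has the form `star x * c + star c * x = const`. -/
theorem Frame.commute_of_const (hF : Frame U x N R H) (hsp : ∀ p ∈ U, star (x p) * x p = 1)
    (hp : p ∈ U) {c d : ℍ[ℝ]} (h : ∀ q ∈ U, star (x q) * c + star c * x q = d) :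
    star (x p) * c * R p = R p * (star (x p) * c) := by
  obtain ⟨X, hX⟩ := exists_tan_ne_zero p
  have key : ∀ Y : Tan p, star (x p) * dQ x p Y * (star (x p) * c) =
      star (star (x p) * c) * (star (x p) * dQ x p Y) := by
    intro Y
    have h1 := dQ_congr (F := fun q => star (x q) * c + star c * x q) (G := fun _ => d)
      (Filter.eventually_of_mem (hF.isOpen.mem_nhds hp) h) Y
    rw [dQ_const, dQ_add ((hF.smx p hp).star.mul (SmAt.const c))
      ((SmAt.const _).mul (hF.smx p hp)), hF.dQ_star_mul hsp hp, dQ_mul (SmAt.const _)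
      (hF.smx p hp), dQ_const, zero_mul, zero_add] at h1
    rw [star_mul, star_star, mul_assoc (star c), ← mul_assoc (x p), mul_star_of_star_mul (hsp p hp),
      one_mul]
    exact neg_add_eq_zero.1 h1
  exact commute_of_mul_eq_star_mul (hF.R_sq p hp) (hF.alpha_ne_zero hsp hp hX) (key X)
    (Or.inl (hF.alpha_rot hsp hp X)) (key (rot X))

/-- The derivative of the mean curvature sphere congruence of a CMC surface in the 3-sphere. -/
theorem Frame.dMat_frameMat_of_sphere (hF : Frame U x N R H)
    (hsp : ∀ p ∈ U, star (x p) * x p = 1) (hp : p ∈ U) (X : Tan p)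
    (hk : dQ (fun q => H q * x q - R q) p X = 0) (c : ℍ[ℝ]) :
    dMat (fun q => frameMat (x q) (N q) (R q) (H q)) p X *ᵥ ![c, 1] =
      ![-(x p * (dQ R p X - H p * dQ x p X)),
        -((dQ R p X - H p * dQ x p X) * (star (x p) * c))] := by
  have hx := mul_star_of_star_mul (hsp p hp)
  have h1 := hF.dH_mul_x hp X
  rw [hk, zero_add] at h1
  have h2 : dQ H p X = (dQ R p X - H p * dQ x p X) * star (x p) := by
    rw [← h1, mul_assoc, hx, mul_one]
  have hNx : dQ N p X * x p + N p * dQ x p X = dQ x p X * R p + x p * dQ R p X := by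
    rw [← dQ_mul (hF.smN p hp) (hF.smx p hp), ← dQ_mul (hF.smx p hp) (hF.smR p hp)]
    exact dQ_congr (Filter.eventually_of_mem (hF.isOpen.mem_nhds hp)
      fun q hq => hF.N_mul_x hsp hq) X
  have hk' := hF.H_mul_x hsp hp
  have h3 := hF.alpha_mul_R hsp hp X
  have h4 := Frame.dx_eq_of_sphere hsp hp X
  have h5 := hF.N_mul_dx hp X
  -- For constant `k` the matrix of `∇S` is off-diagonal, with entries `-x b` and `-b x̄`; here the
  -- upper left entry is shown to vanish.
  have h0 : dQ N p X - (dQ x p X * H p + x p * dQ H p X) = 0 := by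
    have hx0 : x p ≠ 0 := fun h => by
      rw [h, zero_mul] at hx
      exact zero_ne_one hx
    refine mul_right_cancel₀ hx0 ?_
    rw [zero_mul, sub_mul, add_mul, mul_assoc (x p), h1]
    have h6 := coe_comm' (H p * x p - R p).re (dQ x p X)
    have h7 := coe_comm' (H p * x p - R p).re (x p)
    rw [← hk'] at h6 h7
    linear_combination (norm := noncomm_ring) hNx - h5 + x p * H p * h4 -
      h7 * (star (x p) * dQ x p X) - (H p * x p - R p) * h4 + h6 + x p * h3 + h4 * R p
  refine (congrArg (· *ᵥ ![c, 1]) (dMat_frameMat (hF.smx p hp) (hF.smN p hp) (hF.smR p hp)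
    (hF.smH p hp) X)).trans (vec_ext ?_ ?_)
  · rw [mulVec_zero_entry]
    change (dQ N p X - (dQ x p X * H p + x p * dQ H p X)) * c + ((dQ x p X * H p + x p * dQ H p X) *
      x p + x p * H p * dQ x p X - (dQ x p X * R p + x p * dQ R p X) -
      (dQ N p X * x p + N p * dQ x p X)) * 1 = _
    rw [h0]
    change _ = -(x p * (dQ R p X - H p * dQ x p X))
    linear_combination (norm := noncomm_ring) -h0 * x p - h5
  · rw [mulVec_one_entry]
    change -dQ H p X * c + (dQ H p X * x p + H p * dQ x p X - dQ R p X) * 1 =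
      -((dQ R p X - H p * dQ x p X) * (star (x p) * c))
    rw [h1, h2]
    noncomm_ring

end Spherical

end QSurf

namespace QSurf

variable {M : Type*} [TopologicalSpace M] [ChartedSpace ℂ M] [IsManifold 𝓘(ℂ, ℂ) ω M]
  {f : M → HP1} {g g' : Matˣ} {S : M → Mat} {η : Form M}

theorem dMat_conjMat_change {p : M} (hS : SmMatAt S p) (X : Tan p) (v : V) :
    ((g' * g⁻¹ : Matˣ) : Mat) *ᵥ
        (dMat (conjMat g S) p X *ᵥ ((((g' * g⁻¹ : Matˣ)⁻¹ : Matˣ) : Mat) *ᵥ v)) =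
      dMat (conjMat g' S) p X *ᵥ v := by
  rw [dMat_conjMat hS, dMat_conjMat hS]
  simp only [mul_inv_rev, inv_inv, Units.val_mul, ← Matrix.mulVec_mulVec, inv_mulVec_mulVec]

theorem eq_coe_of_star_eq {r : ℍ[ℝ]} (h : star r = r) : r = (r.re : ℍ[ℝ]) :=
  Quaternion.star_eq_self.1 h

/-- A frame in which a CMC surface lies in the unit 3-sphere and one in which it lies in `Im ℍ`
cannot both have constant mean curvature, unless `A_∘ = 0`. -/
theorem totalForm_eq_zero_of_sphere_of_im (hf : IsConformalImmersion f)
    (hS : IsMeanCurvatureSphere f S) (hη : IsLagrangeMultiplier f S η)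
    (hk : ∀ (p : M) (X : Tan p), totalForm S η p X *ᵥ (((g⁻¹ : Matˣ) : Mat) *ᵥ ![1, 0]) = 0)
    (hfin : ∀ p, p ∈ finiteSet f g) (hsp : ∀ p, star (coord f g p) * coord f g p = 1)
    (hH' : ∀ (p : M) (X : Tan p), dQ (meanH g' S) p X = 0) (him : ∀ p, f p ∈ imSphere g')
    (p : M) (X : Tan p) : totalForm S η p X = 0 := by
  by_contra hne
  have hF := hS.frame hf g
  have hsp' : ∀ p ∈ finiteSet f g, star (coord f g p) * coord f g p = 1 := fun p _ => hsp p
  have hb : dQ (normalR f g S) p X - meanH g S p * dQ (coord f g) p X ≠ 0 := by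
    intro h0
    apply hne
    rw [totalForm_eq_kernelForm hf hS hη.le_ker (hfin p) (hk p X), kernelForm, h0, mul_zero]
    have : (!![0, 0; 0, 0] : Mat) = 0 := mat_ext rfl rfl rfl rfl
    rw [this, mul_zero, zero_mul]
  have hdk := fun (p : M) (X : Tan p) => hF.dk_eq_zero hsp' (hfin p) X
    (dH_wedge_dx_of_multiplier hf hS hη hk (hfin p) X)
  set h : Matˣ := g' * g⁻¹ with hh
  obtain ⟨a, ha⟩ : ∃ a, a = (h : Mat) 0 0 := ⟨_, rfl⟩
  obtain ⟨b, hb'⟩ : ∃ b, b = (h : Mat) 0 1 := ⟨_, rfl⟩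
  obtain ⟨c, hc⟩ : ∃ c, c = (h : Mat) 1 0 := ⟨_, rfl⟩
  obtain ⟨d, hd⟩ : ∃ d, d = (h : Mat) 1 1 := ⟨_, rfl⟩
  have hh0 : ∀ v : V, ((h : Mat) *ᵥ v) 0 = a * v 0 + b * v 1 := fun v => by
    rw [mulVec_zero_entry, ha, hb']
  have hh1 : ∀ v : V, ((h : Mat) *ᵥ v) 1 = c * v 0 + d * v 1 := fun v => by
    rw [mulVec_one_entry, hc, hd]
  obtain ⟨r, hr⟩ : ∃ r, r = star a * c + star c * a := ⟨_, rfl⟩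
  obtain ⟨s, hs⟩ : ∃ s, s = star b * d + star d * b := ⟨_, rfl⟩
  obtain ⟨m, hm⟩ : ∃ m, m = star a * d + star c * b := ⟨_, rfl⟩
  have hrs : r = (r.re : ℍ[ℝ]) := eq_coe_of_star_eq (by
    rw [hr, star_add, star_mul, star_mul, star_star, star_star, add_comm])
  have hrc : ∀ q, r * q = q * r := fun q => by rw [hrs]; exact coe_comm' _ q
  -- In the frame `g` the sphere `imSphere g'` has the equation `r |x|² + x̄ m + m̄ x + s = 0`,
  -- where `|x| = 1`. If `m ≠ 0`, the surface lies in a second 3-sphere and is umbilic, which `b ≠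
  -- 0` excludes; so `m = 0`, `s = -r`, and the hermitian forms are proportional.
  have hJ : ∀ p, star (coord f g p) * m + star m * coord f g p = -(r + s) := by
    intro p
    have h1 := him p _ (psi_mem (hfin p))
    have h2 : (g' : Mat) *ᵥ (((g⁻¹ : Matˣ) : Mat) *ᵥ ![coord f g p, 1]) =
        (h : Mat) *ᵥ ![coord f g p, 1] := by
      rw [Matrix.mulVec_mulVec, hh, Units.val_mul]
    rw [h2, hh0, hh1] at h1
    simp only [Matrix.cons_val_zero, Matrix.cons_val_one, mul_one, star_add, star_mul] at h1
    have h3 : star m = star d * a + star b * c := by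
      rw [hm, star_add, star_mul, star_mul, star_star, star_star]
    have h4 := hrc (coord f g p)
    have h5 := hsp p
    rw [h3, hm, hs]
    linear_combination (norm := noncomm_ring) h1 - star (coord f g p) * h4 +
      star (coord f g p) * hr * coord f g p - h5 * r
  have hm0 : m = 0 := hF.eq_zero_of_commute hsp' (hfin p)
    (Filter.Eventually.of_forall fun q => hF.commute_of_const hsp' (hfin q) fun q _ => hJ q) hb
  have hsr : s = -r := by
    have h1 := hJ p
    rw [hm0, star_zero, mul_zero, zero_mul, add_zero, zero_eq_neg, add_comm] at h1
    exact eq_neg_of_add_eq_zero_left h1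
  -- `w` represents the point at infinity of `g'` in the frame `g`.
  set w : V := ((h⁻¹ : Matˣ) : Mat) *ᵥ ![1, 0] with hw
  have hhw : (h : Mat) *ᵥ w = ![1, 0] := mulVec_inv_mulVec h _
  have hw0 : a * w 0 + b * w 1 = 1 := by rw [← hh0, hhw]; rfl
  have hw1 : c * w 0 + d * w 1 = 0 := by rw [← hh1, hhw]; rfl
  have hw0' := congrArg star hw0
  have hw1' := congrArg star hw1
  simp only [star_add, star_mul, star_one, star_zero] at hw0' hw1'
  have hcr : c = star (w 0) * r := by
    have h3 : star m = 0 := by rw [hm0, star_zero]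
    rw [hm, star_add, star_mul, star_mul, star_star, star_star] at h3
    linear_combination (norm := noncomm_ring) -hw0' * c - hw1' * a + star (w 1) * h3 -
      star (w 0) * hr
  have hdr : d = -(star (w 1) * r) := by
    rw [hm0] at hm
    linear_combination (norm := noncomm_ring) -hw0' * d - hw1' * b - star (w 0) * hm -
      star (w 1) * hs + star (w 1) * hsr
  have hr0 : r ≠ 0 := by
    intro h0
    have h1 : ((h : Mat) *ᵥ (((h⁻¹ : Matˣ) : Mat) *ᵥ ![0, 1])) 1 = 1 := by
      rw [mulVec_inv_mulVec]; rfl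
    rw [hh1, hcr, hdr, h0] at h1
    simp at h1
  have hnull : star (w 0) * w 0 = star (w 1) * w 1 := by
    refine mul_left_cancel₀ hr0 ?_
    rw [hcr, hdr] at hw1
    linear_combination (norm := noncomm_ring) hw1 + hrc (star (w 0)) * w 0 -
      hrc (star (w 1)) * w 1
  have hw1ne : w 1 ≠ 0 := by
    intro h0
    rw [h0, star_zero, zero_mul, mul_eq_zero, star_eq_zero, or_self] at hnull
    rw [h0, hnull, mul_zero, mul_zero, add_zero] at hw0
    exact zero_ne_one hw0
  obtain ⟨e, he⟩ : ∃ e, w 0 = e * w 1 := ⟨w 0 * (w 1)⁻¹, by rw [inv_mul_cancel_right₀ hw1ne]⟩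
  have hwe : w = vmul ![e, 1] (w 1) := vec_ext he (one_mul _).symm
  -- `dH' = 0` says that the row `(c, d)` of `h` annihilates `∇S w`. Insert `hcr`, `hdr`, the
  -- off-diagonal form of `∇S` and `w = (e, 1) w₁`.
  have hconj : ∀ (q : M) (Y : Tan q),
      (dQ (normalR f g S) q Y - meanH g S q * dQ (coord f g) q Y) * (star (coord f g q) * e) =
        star (star (coord f g q) * e) *
          (dQ (normalR f g S) q Y - meanH g S q * dQ (coord f g) q Y) := by
    intro q Y
    have hSq := smoothMat_iff.1 hS.smooth q
    have h1 : dMat (conjMat g' S) q Y 1 0 = 0 := by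
      have h2 := dQ_neg (smAt_meanH (g := g') hS q) Y
      rw [hH', neg_zero] at h2
      have h3 : (fun q => -meanH g' S q) = fun q => conjMat g' S q 1 0 := by
        funext q; rw [meanH, neg_neg]
      rw [h3] at h2
      exact h2
    have h4 := congrFun (dMat_conjMat_change (g := g) (g' := g') hSq Y ![1, 0]) 1
    rw [mulVec_one_entry (dMat (conjMat g' S) q Y), h1, ← hh, ← hw, hwe, mulVec_vmul,
      dMat_congr (hS.conjMat_eventuallyEq hf (hfin q)),
      hF.dMat_frameMat_of_sphere hsp' (hfin q) Y (hdk q Y), mulVec_vmul, vmul_apply, hh1, hcr, hdr,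
      he] at h4
    simp only [Matrix.cons_val_zero, Matrix.cons_val_one, mul_zero, add_zero, zero_mul] at h4
    have h5 := (mul_eq_zero.1 h4).resolve_right hw1ne
    rw [star_mul e] at h5
    rw [star_mul (star (coord f g q)), star_star]
    refine sub_eq_zero.1 (((mul_eq_zero (a := star (w 1) * r)).1 ?_).resolve_left
      (mul_ne_zero (star_ne_zero.2 hw1ne) hr0))
    have h6 := hrc (star e)
    generalize dQ (normalR f g S) q Y - meanH g S q * dQ (coord f g) q Y = β at *
    linear_combination (norm := noncomm_ring) h5 - star (w 1) * h6 * coord f g q * β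
  -- By continuity `b ≠ 0` along a coordinate field near `p`. Applying `hconj` to `b` and `*b = -R
  -- b` shows that `x̄ e` commutes with `R` there, so `e = 0`, contrary to `w` being a null vector.
  obtain ⟨v, hv⟩ := exists_chartVec_eq (chart_mem_atlas ℂ p) (mem_chart_source ℂ p) X
  have hev := (hF.smAt_b (chart_mem_atlas ℂ p) (hfin p) (mem_chart_source ℂ p) v).continuousAt
    |>.eventually_ne (by rw [hv]; exact hb)
  have he0 : e = 0 := hF.eq_zero_of_commute hsp' (hfin p) (hev.mono fun q hq =>
    commute_of_mul_eq_star_mul (hF.R_sq q (hfin q)) hq (hconj q _)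
      (Or.inr (hF.b_rot (hfin q) _)) (hconj q _)) hb
  rw [he, he0, zero_mul, star_zero, zero_mul, eq_comm, mul_eq_zero, star_eq_zero, or_self] at hnull
  exact hw1ne hnull

end QSurf

/-! ### Assembly of the three statements. -/

namespace QSurf

theorem mem_imSphere_of_re_eq_zero {M : Type*} {f : M → HP1} {g : Matˣ}
    (him : ∀ p ∈ finiteSet f g, (coord f g p).re = 0) (p : M) : f p ∈ imSphere g := by
  by_cases hp : ToInfinity g (f p)
  · exact mem_imSphere_of_toInfinity hp
  · exact (mem_imSphere_iff hp).2 (him p hp)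

theorem IsCMCEuclidean.exists_sphere {M : Type*} [TopologicalSpace M] [ConnectedSpace M]
    [ChartedSpace ℂ M] [IsManifold 𝓘(ℂ, ℂ) ω M] {f : M → HP1} (hf : IsConformalImmersion f)
    (h : IsCMCEuclidean f) :
    ∃ K : Set HP1, IsRoundThreeSphere K ∧ (∀ p, f p ∈ K) ∧
      ∃ (S : M → Mat) (η : Form M) (ℓ : HP1), IsMeanCurvatureSphere f S ∧
        IsLagrangeMultiplier f S η ∧ KernelIsConstant S η ℓ ∧ ℓ ∈ K := by
  obtain ⟨S, hS⟩ := exists_meanCurvatureSphere hf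
  obtain ⟨g, η, hη, hk, him⟩ := h.exists_multiplier hf hS
  obtain ⟨ℓ, hℓ, -⟩ := exists_toInfinity g
  exact ⟨imSphere g, isRoundThreeSphere_imSphere g, mem_imSphere_of_re_eq_zero him, S, η, ℓ, hS,
    hη, (kernelIsConstant_iff hℓ).2 hk, mem_imSphere_of_toInfinity hℓ⟩

theorem IsCMCSpherical.exists_sphere {M : Type*} [TopologicalSpace M] [ConnectedSpace M]
    [ChartedSpace ℂ M] [IsManifold 𝓘(ℂ, ℂ) ω M] {f : M → HP1} (hf : IsConformalImmersion f)
    (h : IsCMCSpherical f) :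
    ∃ K : Set HP1, IsRoundThreeSphere K ∧ (∀ p, f p ∈ K) ∧
      ∃ (S : M → Mat) (η : Form M) (ℓ : HP1), IsMeanCurvatureSphere f S ∧
        IsLagrangeMultiplier f S η ∧ KernelIsConstant S η ℓ := by
  obtain ⟨S, hS⟩ := exists_meanCurvatureSphere hf
  obtain ⟨g, η, hη, hk, hsp⟩ := h.exists_multiplier hf hS
  obtain ⟨ℓ, hℓ, -⟩ := exists_toInfinity g
  exact ⟨unitSphere g, isRoundThreeSphere_unitSphere g, fun p => mem_unitSphere_iff.2 (hsp p), S,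
    η, ℓ, hS, hη, (kernelIsConstant_iff hℓ).2 hk⟩

section

variable {M : Type*} [TopologicalSpace M] [ConnectedSpace M]
    [ChartedSpace ℂ M] [IsManifold 𝓘(ℂ, ℂ) ω M] {f : M → HP1} {K : Set HP1} {S : M → Mat}
    {η : Form M} {ℓ : HP1}

theorem isCMCEuclidean_of_mem (hf : IsConformalImmersion f) (hK : IsRoundThreeSphere K)
    (hfK : ∀ p, f p ∈ K) (hS : IsMeanCurvatureSphere f S) (hη : IsLagrangeMultiplier f S η)
    (hk : KernelIsConstant S η ℓ) (hℓ : ℓ ∈ K) : IsCMCEuclidean f := by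
  obtain ⟨g, hg, rfl⟩ := exists_imSphere hK hℓ
  exact isCMCEuclidean_of_multiplier hf hS hη ((kernelIsConstant_iff hg).1 hk)
    fun p hp => (mem_imSphere_iff hp).1 (hfK p)

theorem isCMCSpherical_of_notMem (hf : IsConformalImmersion f) (hK : IsRoundThreeSphere K)
    (hfK : ∀ p, f p ∈ K) (hS : IsMeanCurvatureSphere f S) (hη : IsLagrangeMultiplier f S η)
    (hk : KernelIsConstant S η ℓ) (hℓ : ℓ ∉ K) : IsCMCSpherical f := by
  obtain ⟨g, hg, rfl⟩ := exists_unitSphere hK hℓ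
  exact isCMCSpherical_of_multiplier hf hS hη ((kernelIsConstant_iff hg).1 hk)
    (fun p => (mem_unitSphere_iff.1 (hfK p)).1) fun p => (mem_unitSphere_iff.1 (hfK p)).2

/-- The Euclidean frame comes with its own multiplier `η'`, used only for the constancy of the mean
curvature in that frame. If `ℓ ∉ K`, the comparison with the spherical frame at `ℓ` makes `A_∘`
vanish identically. -/
theorem IsCMCEuclidean.mem_of_kernelIsConstant (h : IsCMCEuclidean f)
    (hf : IsConformalImmersion f) (hK : IsRoundThreeSphere K)
    (hfK : ∀ p, f p ∈ K) (hS : IsMeanCurvatureSphere f S) (hη : IsLagrangeMultiplier f S η)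
    (hk : KernelIsConstant S η ℓ) (hA : ∃ (p : M) (X : Tan p), Acirc S η p X ≠ 0) : ℓ ∈ K := by
  by_contra hℓ
  obtain ⟨g, hg, rfl⟩ := exists_unitSphere hK hℓ
  obtain ⟨g', η', hη', hk', him⟩ := h.exists_multiplier hf hS
  obtain ⟨p, X, hX⟩ := hA
  refine hX ?_
  rw [acirc_eq, totalForm_eq_zero_of_sphere_of_im hf hS hη ((kernelIsConstant_iff hg).1 hk)
    (fun p => (mem_unitSphere_iff.1 (hfK p)).1) (fun p => (mem_unitSphere_iff.1 (hfK p)).2)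
    (dQ_meanH_eq_zero hf hS hη' hk' him) (mem_imSphere_of_re_eq_zero him), smul_zero]

end

end QSurf

end

theorem mainTheorem11 {M : Type*} [TopologicalSpace M] [T2Space M] [ConnectedSpace M]
    [ChartedSpace ℂ M] [IsManifold 𝓘(ℂ, ℂ) ω M]
    (f : M → QSurf.HP1) (hf : QSurf.IsConformalImmersion f) :
    ((QSurf.IsCMCEuclidean f ∨ QSurf.IsCMCSpherical f) ↔
      ∃ K : Set QSurf.HP1, QSurf.IsRoundThreeSphere K ∧ (∀ p, f p ∈ K) ∧
        ∃ (S : M → QSurf.Mat) (η : QSurf.Form M) (ℓ : QSurf.HP1),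
          QSurf.IsMeanCurvatureSphere f S ∧ QSurf.IsLagrangeMultiplier f S η ∧
          QSurf.KernelIsConstant S η ℓ) ∧
    (QSurf.IsCMCEuclidean f ↔
      ∃ K : Set QSurf.HP1, QSurf.IsRoundThreeSphere K ∧ (∀ p, f p ∈ K) ∧
        ∃ (S : M → QSurf.Mat) (η : QSurf.Form M) (ℓ : QSurf.HP1),
          QSurf.IsMeanCurvatureSphere f S ∧ QSurf.IsLagrangeMultiplier f S η ∧
          QSurf.KernelIsConstant S η ℓ ∧ ℓ ∈ K) ∧
    (∀ (K : Set QSurf.HP1) (S : M → QSurf.Mat) (η : QSurf.Form M) (ℓ : QSurf.HP1),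
      QSurf.IsRoundThreeSphere K → (∀ p, f p ∈ K) →
      QSurf.IsMeanCurvatureSphere f S → QSurf.IsLagrangeMultiplier f S η →
      QSurf.KernelIsConstant S η ℓ → (∃ (p : M) (X : QSurf.Tan p), QSurf.Acirc S η p X ≠ 0) →
      (QSurf.IsCMCEuclidean f ↔ ℓ ∈ K)) := by
  refine ⟨⟨?_, ?_⟩, ⟨fun h => h.exists_sphere hf, ?_⟩, ?_⟩
  · rintro (h | h)
    · obtain ⟨K, hK, hfK, S, η, ℓ, hS, hη, hk, -⟩ := h.exists_sphere hf
      exact ⟨K, hK, hfK, S, η, ℓ, hS, hη, hk⟩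
    · exact h.exists_sphere hf
  · rintro ⟨K, hK, hfK, S, η, ℓ, hS, hη, hk⟩
    by_cases hℓ : ℓ ∈ K
    · exact Or.inl (QSurf.isCMCEuclidean_of_mem hf hK hfK hS hη hk hℓ)
    · exact Or.inr (QSurf.isCMCSpherical_of_notMem hf hK hfK hS hη hk hℓ)
  · rintro ⟨K, hK, hfK, S, η, ℓ, hS, hη, hk, hℓ⟩
    exact QSurf.isCMCEuclidean_of_mem hf hK hfK hS hη hk hℓ
  · intro K S η ℓ hK hfK hS hη hk hA
    exact ⟨fun h => h.mem_of_kernelIsConstant hf hK hfK hS hη hk hA,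
      QSurf.isCMCEuclidean_of_mem hf hK hfK hS hη hk⟩
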